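/- Let $a:[0,1]\to\mathbb{R}$ be continuous and strictly increasing, differentiable on $(0,1)$ with $a'>0$ almost everywhere. For each $N\ge 1$ let $A=A_N$ be a deterministic real symmetric $N\times N$ matrix with eigenvalues $a_j=a(j/N)$, $1\le j\le N$, and corresponding orthonormal eigenvectors $\phi_1,\dots,\phi_N$ (for instance $A$ diagonal). Let $(H_t)_{t\ge 0}$ be the symmetric Brownian motion with entries $H_t(ij)=H_t(ji)=\sqrt{1/N}\,B_{ij}(t)$ for $i<j$ and $H_t(ii)=\sqrt{2/N}\,B_{ii}(t)$, where the $B_{ij}$, $1\le i\le j\le N$, are independent standard real Brownian motions (for different $N$ they are defined on one probability space, with an arbitrary joint law). Fix $t>0$, put $M_t=A+H_t$, and let $\lambda_1^t\le\dots\le\lambda_N^t$ be its eigenvalues and $\psi_1^t,\dots,\psi_N^t$ a (measurably chosen) orthonormal basis of corresponding eigenvectors. For $\lambda,\alpha\in\mathbb{R}$ set $$\Phi_N(\lambda,\alpha)=\frac1N\sum_{i,j=1}^N \mathbb{E}\big[\langle\psi_i^t,\phi_j\rangle^2\,\mathbf 1_{\{\lambda_i^t\le\lambda\}}\big]\,\mathbf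 1_{\{a_j\le\alpha\}}.$$ Then almost surely, as $N\to\infty$, the empirical eigenvalue distribution of $M_t$ converges weakly to a probability measure with a continuous density $\rho_t$ (the limiting spectral density), the Hilbert transform $H_{\rho_t}(\xi)=\mathrm{p.v.}\!\int_{\mathbb{R}}\frac{\rho_t(x)}{x-\xi}\,dx$ exists for every $\xi\in\mathbb{R}$, and for all $\lambda,\alpha\in\mathbb{R}$ $$\lim_{N\to\infty}\Phi_N(\lambda,\alpha)=\Phi(\lambda,\alpha):=\int_{-\infty}^{\lambda}\rho_t(\xi)\left(\int_{(-\infty,\alpha]\cap a([0,1])}\frac{1}{a'(a^{-1}(x))}\,\frac{t}{(x-\xi-t\,H_{\rho_t}(\xi))^2+t^2\pi^2\rho_t(\xi)^2}\,dx\right)d\xi ,$$ where the inner integral converges whenever $\rho_t(\xi)>0$, the points $\xi$ with $\rho_t(\xi)=0$ contribute $0$, and the outer integral converges absolutely. Moreover, almost surely, for all $\lambda,\alpha$, the random quantity $\frac1N\sum_{i,j}\mathbb{E}[\langle\psi_i^t,\phi_j\rangle^2]\,\mathbf 1_{\{\lambda_i^t\le\lambda\}}\mathbf 1_{\{a_j\le\alpha\}}$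 has the same limit $\Phi(\lambda,\alpha)$. -/

import Mathlib

open MeasureTheory ProbabilityTheory Filter Topology
open scoped NNReal BoundedContinuousFunction Matrix

noncomputable section

namespace FreeOverlap

/-- The vectors `ψ i` are orthonormal eigenvectors of the `N × N` matrix `M` for the eigenvalues
`lam i`, which are listed in increasing order. As there are `N` of them, they form an orthonormal
basis and `lam` lists all the eigenvalues with multiplicity. -/
structure IsOrderedEigenbasis {N : ℕ} (M : Matrix (Fin N) (Fin N) ℝ) (lam : Fin N → ℝ)
    (ψ : Fin N → EuclideanSpace ℝ (Fin N)) : Prop where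
  monotone : Monotone lam
  orthonormal : Orthonormal ℝ ψ
  eigen : ∀ i, M *ᵥ (ψ i).ofLp = lam i • (ψ i).ofLp

/-- `(B i j)` for `i ≤ j` is a family of independent real Brownian motions
(the entries with `j < i` are never used). -/
structure IsIndepBrownianFamily {Ω : Type*} [MeasurableSpace Ω] {N : ℕ}
    (B : Fin N → Fin N → ℝ≥0 → Ω → ℝ) (P : Measure Ω) : Prop where
  brownian : ∀ i j, i ≤ j → IsBrownianReal (B i j) P
  indep : iIndepFun (fun (p : {p : Fin N × Fin N // p.1 ≤ p.2}) (ω : Ω) (s : ℝ≥0) =>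
    B p.1.1 p.1.2 s ω) P

/-- The symmetric Brownian motion `H_t`: entries `√(1/N) B_ij(t)` for `i < j`
and `√(2/N) B_ii(t)` on the diagonal. -/
def symmBrownian {Ω : Type*} {N : ℕ} (B : Fin N → Fin N → ℝ≥0 → Ω → ℝ) (t : ℝ≥0) (ω : Ω) :
    Matrix (Fin N) (Fin N) ℝ :=
  Matrix.of fun i j =>
    if i = j then √(2 / (N : ℝ)) * B i i t ω
    else √(1 / (N : ℝ)) * B (min i j) (max i j) t ω

/-- The hypotheses on the allocation function `a` on `[0, 1]`: continuous and strictly increasing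
on `[0, 1]`, differentiable inside, with a derivative that is positive almost everywhere. -/
structure IsAllocation (a : ℝ → ℝ) : Prop where
  continuousOn : ContinuousOn a (Set.Icc 0 1)
  strictMonoOn : StrictMonoOn a (Set.Icc 0 1)
  differentiableAt : ∀ x ∈ Set.Ioo (0 : ℝ) 1, DifferentiableAt ℝ a x
  deriv_pos : ∀ᵐ x ∂(volume.restrict (Set.Ioo (0 : ℝ) 1)), 0 < deriv a x

/-- The eigenvalues `a_j = a (j / N)`, `j = 1, …, N` (`Fin N` starts at `0`). -/
def alloc (a : ℝ → ℝ) (N : ℕ) (j : Fin N) : ℝ := a (((j : ℕ) + 1 : ℝ) / N)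

/-- The indicator `1_{x ≤ c}`. -/
def indLE (x c : ℝ) : ℝ := (Set.Iic c).indicator 1 x

/-- `Φ_N(l, α) = (1/N) ∑_{i,j} E[⟨ψ_i, φ_j⟩² 1_{λ_i ≤ l}] 1_{a_j ≤ α}`. -/
def overlapCDF {Ω : Type*} [MeasurableSpace Ω] (P : Measure Ω) {N : ℕ}
    (aj : Fin N → ℝ) (φ : Fin N → EuclideanSpace ℝ (Fin N))
    (lam : Fin N → Ω → ℝ) (ψ : Fin N → Ω → EuclideanSpace ℝ (Fin N)) (l α : ℝ) : ℝ :=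
  (1 / (N : ℝ)) * ∑ i, ∑ j,
    (∫ ω, (inner ℝ (ψ i ω) (φ j)) ^ 2 * indLE (lam i ω) l ∂P) * indLE (aj j) α

/-- The variant `(1/N) ∑_{i,j} E[⟨ψ_i, φ_j⟩²] 1_{λ_i ≤ l} 1_{a_j ≤ α}`, in which the expectation
is taken of the squared overlap only; it is a random variable. -/
def overlapCDFRandom {Ω : Type*} [MeasurableSpace Ω] (P : Measure Ω) {N : ℕ}
    (aj : Fin N → ℝ) (φ : Fin N → EuclideanSpace ℝ (Fin N))
    (lam : Fin N → Ω → ℝ) (ψ : Fin N → Ω → EuclideanSpace ℝ (Fin N)) (l α : ℝ) (ω : Ω) : ℝ :=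
  (1 / (N : ℝ)) * ∑ i, ∑ j,
    (∫ ω', (inner ℝ (ψ i ω') (φ j)) ^ 2 ∂P) * indLE (lam i ω) l * indLE (aj j) α

/-- `ρ` is a continuous probability density on the real line. -/
structure IsContinuousDensity (ρ : ℝ → ℝ) : Prop where
  continuous : Continuous ρ
  nonneg : ∀ x, 0 ≤ ρ x
  integrable : Integrable ρ
  integral_eq_one : ∫ x, ρ x = 1

/-- `H` is the Hilbert transform of `ρ`, normalized as
`H(ξ) = p.v. ∫ ρ(x) / (x - ξ) dx`, the principal value existing at every point. -/
def IsHilbertTransform (ρ H : ℝ → ℝ) : Prop :=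
  ∀ ξ, Tendsto (fun ε : ℝ => ∫ x in {x : ℝ | ε < |x - ξ|}, ρ x / (x - ξ)) (𝓝[>] 0) (𝓝 (H ξ))

/-- The empirical distributions of the `lam N` converge weakly to the law with density `ρ`. -/
def EmpiricalTendsto (lam : (N : ℕ) → Fin N → ℝ) (ρ : ℝ → ℝ) : Prop :=
  ∀ f : ℝ →ᵇ ℝ, Tendsto (fun N : ℕ => (1 / (N : ℝ)) * ∑ i, f (lam N i)) atTop
    (𝓝 (∫ x, f x * ρ x))

/-- `1 / a'(a⁻¹(x)) · t / ((x - ξ - t H(ξ))² + t² π² ρ(ξ)²)`, for `x` in `a([0, 1])`. -/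
def limitIntegrand (a : ℝ → ℝ) (t : ℝ) (ρ H : ℝ → ℝ) (ξ x : ℝ) : ℝ :=
  1 / deriv a (Function.invFunOn a (Set.Icc 0 1) x) *
    (t / ((x - ξ - t * H ξ) ^ 2 + t ^ 2 * Real.pi ^ 2 * ρ ξ ^ 2))

/-- The inner integral over `x ≤ α`; `x` ranges over `a([0, 1])`, where `a⁻¹` is defined. -/
def limitInner (a : ℝ → ℝ) (t : ℝ) (ρ H : ℝ → ℝ) (ξ α : ℝ) : ℝ :=
  ∫ x in Set.Iic α ∩ a '' Set.Icc 0 1, limitIntegrand a t ρ H ξ x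

/-- The limit `Φ(l, α)`. -/
def limitCDF (a : ℝ → ℝ) (t : ℝ) (ρ H : ℝ → ℝ) (l α : ℝ) : ℝ :=
  ∫ ξ in Set.Iic l, ρ ξ * limitInner a t ρ H ξ α

end FreeOverlap

end

/-! The proof goes through resolvents. For a unit eigenvector φ_j of A, the mean of ⟨φ_j, (M_t −
z)⁻¹ φ_j⟩ is the Stieltjes transform of the mean distribution of the squared overlaps of φ_j over
the eigenvalues of M_t. Gaussian integration by parts shows that it equals (a_j − z − t m_N(z))⁻¹ up
to O(1/N), where m_N is the mean normalized trace of the resolvent (`norm_loop_le`). The error is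
small because the covariance of H contracts to the normalized trace plus a term of order 1/N, and
because a Gaussian Poincaré inequality bounds the variance of the normalized trace by O(1/N²)
(`integral_norm_normTrace_sub_sq_le`).

Averaging over j gives m_N = g(z + t m_N) + o(1), with g the Stieltjes transform of the law of a(U),
U uniform on (0, 1]. Everything analytic rests on one estimate, `norm_sub_cube_le`: where w ↦ w − t
g(w) takes values in the closed upper half-plane, |w − w'|³ is at most a constant times the distance
of the images. It makes m_N converge to a solution m of the fixed point equation, and it makes m
extend continuously to the real axis. There Im m = π ρ_t, and Re m is the Hilbert transform of ρ_t
(`isHilbertTransform_of_tendsto`).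

Averaging only over a_j ≤ α shows that the Stieltjes transform of the measure with distribution
function Φ_N(·, α) tends to g_α(z + t m(z)), where g_α belongs to the law of a(U) restricted to (−∞,
α]. Since 0 ≤ Im g_α(z + t m(z)) ≤ Im m(z), this limit has bounded boundary values, also where ρ_t
vanishes, and Stieltjes inversion for `IsStieltjesLimit` gives convergence of distribution
functions. The substitution x = a(u) identifies the boundary values with the stated integrand
(`IsAllocation.boundaryDensity_eq`).

Almost sure convergence comes from summable variances at countably many z. For the random variant,
the spectra at two sample points are compared: both are sorted, so the differences of the indicators
of λ_i ≤ l all have one sign, and with weights at most 1/N the change is bounded by the difference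
of the empirical distribution functions (`IsModel.abs_overlapCDFRandom_sub_le`). -/

noncomputable section

namespace FreeOverlap

/-! ### Gaussian integration by parts -/

/-- The law of a family of independent centred Gaussian variables of variance `v`. -/
def gaussianFamily (ι : Type*) [Fintype ι] (v : ℝ≥0) : Measure (ι → ℝ) :=
  Measure.pi fun _ => gaussianReal 0 v

instance (ι : Type*) [Fintype ι] (v : ℝ≥0) : IsProbabilityMeasure (gaussianFamily ι v) := by
  unfold gaussianFamily; infer_instance

lemma hasDerivAt_gaussianPDFReal {v : ℝ≥0} (hv : v ≠ 0) (x : ℝ) :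
    HasDerivAt (gaussianPDFReal 0 v) (-(x / v) * gaussianPDFReal 0 v x) x := by
  have hv' : (v : ℝ) ≠ 0 := by exact_mod_cast hv
  have h : HasDerivAt (fun y : ℝ => -(y - 0) ^ 2 / (2 * (v : ℝ))) (-(x / v)) x := by
    have := (((hasDerivAt_id x).sub_const 0).pow 2).neg.div_const (2 * (v : ℝ))
    refine this.congr_deriv ?_
    simp
    field_simp
  have := h.exp.const_mul (√(2 * Real.pi * v))⁻¹
  refine this.congr_deriv ?_
  simp only [gaussianPDFReal]
  ring

lemma integrable_gaussianReal_iff {v : ℝ≥0} (hv : v ≠ 0) {f : ℝ → ℂ} :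
    Integrable f (gaussianReal 0 v) ↔
      Integrable (fun x => (gaussianPDFReal 0 v x : ℂ) * f x) := by
  rw [gaussianReal_of_var_ne_zero _ hv, integrable_withDensity_iff_integrable_smul₀'
    (measurable_gaussianPDF 0 v).aemeasurable (ae_of_all _ fun x => gaussianPDF_lt_top)]
  simp

/-- Gaussian integration by parts in one dimension. -/
lemma integral_id_mul_gaussianReal {v : ℝ≥0} (hv : v ≠ 0) {f f' : ℝ → ℂ} {C C' : ℝ}
    (hf : ∀ x, HasDerivAt f (f' x) x) (hC : ∀ x, ‖f x‖ ≤ C) (hC' : ∀ x, ‖f' x‖ ≤ C') :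
    ∫ x, (x : ℂ) * f x ∂(gaussianReal 0 v) = v * ∫ x, f' x ∂(gaussianReal 0 v) := by
  have hv' : (v : ℂ) ≠ 0 := by exact_mod_cast hv
  have hfc : Continuous f := continuous_iff_continuousAt.2 fun x => (hf x).continuousAt
  have hf'm : Measurable f' := by
    have : f' = deriv f := funext fun x => (hf x).deriv.symm
    rw [this]; exact measurable_deriv f
  have i1 : Integrable f (gaussianReal 0 v) :=
    .of_bound hfc.aestronglyMeasurable C (ae_of_all _ hC)
  have i2 : Integrable f' (gaussianReal 0 v) :=
    .of_bound hf'm.aestronglyMeasurable C' (ae_of_all _ hC')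
  have i0 : Integrable (fun x : ℝ => (x : ℂ)) (gaussianReal 0 v) :=
    ((memLp_id_gaussianReal 1).integrable (by simp)).ofReal
  have i3 : Integrable (fun x : ℝ => (x : ℂ) * f x) (gaussianReal 0 v) := by
    refine i0.mul_bdd (c := C) hfc.aestronglyMeasurable (ae_of_all _ hC)
  rw [integrable_gaussianReal_iff hv] at i1 i2 i3
  have key := integral_mul_deriv_eq_deriv_mul_of_integrable (u := f) (u' := f')
    (v := fun x => (gaussianPDFReal 0 v x : ℂ))
    (v' := fun x => ((-(x / v) * gaussianPDFReal 0 v x : ℝ) : ℂ))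
    (fun x _ => hf x) (fun x _ => (hasDerivAt_gaussianPDFReal hv x).ofReal_comp)
    (by
      refine (i3.const_mul (-(1 / v : ℂ))).congr (ae_of_all _ fun x => ?_)
      simp only [Pi.mul_apply]; push_cast; ring)
    (i2.congr (ae_of_all _ fun x => by simp [mul_comm]))
    (i1.congr (ae_of_all _ fun x => by simp [mul_comm]))
  rw [integral_gaussianReal_eq_integral_smul hv, integral_gaussianReal_eq_integral_smul hv]
  simp only [Complex.real_smul]
  have e1 : ∫ x, f x * ((-(x / v) * gaussianPDFReal 0 v x : ℝ) : ℂ)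
      = -(1 / v : ℂ) * ∫ x, (gaussianPDFReal 0 v x : ℂ) * ((x : ℂ) * f x) := by
    rw [← integral_const_mul]
    congr 1; ext x; push_cast; ring
  have e2 : ∫ x, f' x * (gaussianPDFReal 0 v x : ℂ) = ∫ x, (gaussianPDFReal 0 v x : ℂ) * f' x := by
    congr 1; ext x; ring
  rw [e1, e2] at key
  have : ∫ x, (gaussianPDFReal 0 v x : ℂ) * ((x : ℂ) * f x)
      = -v * (-(1 / v : ℂ) * ∫ x, (gaussianPDFReal 0 v x : ℂ) * ((x : ℂ) * f x)) := by
    field_simp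
  rw [this, key]; ring

variable {ι : Type*} [Fintype ι]

lemma integrable_eval_gaussianFamily (v : ℝ≥0) (p : ι) :
    Integrable (fun x : ι → ℝ => (x p : ℂ)) (gaussianFamily ι v) := by
  have : Integrable (fun x : ℝ => x) (gaussianReal 0 v) :=
    (memLp_id_gaussianReal 1).integrable (by simp)
  exact ((measurePreserving_eval (fun _ : ι => gaussianReal 0 v) p).integrable_comp_of_integrable
    this).ofReal

variable [DecidableEq ι]

lemma measurable_update_prod (p : ι) :
    Measurable fun q : (ι → ℝ) × ℝ => Function.update q.1 p q.2 := by
  refine measurable_pi_lambda _ fun i => ?_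
  by_cases h : i = p
  · subst h; simpa using measurable_snd
  · simpa [Function.update_of_ne h, Function.comp_def] using
      (measurable_pi_apply i).comp measurable_fst

/-- Resampling one coordinate does not change the law of a product measure. -/
lemma map_update_gaussianFamily (v : ℝ≥0) (p : ι) :
    ((gaussianFamily ι v).prod (gaussianReal 0 v)).map
      (fun q : (ι → ℝ) × ℝ => Function.update q.1 p q.2) = gaussianFamily ι v := by
  symm
  refine Measure.pi_eq fun s hs => ?_
  rw [Measure.map_apply (measurable_update_prod p) (MeasurableSet.univ_pi hs)]
  have : (fun q : (ι → ℝ) × ℝ => Function.update q.1 p q.2) ⁻¹' (Set.univ.pi s)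
      = (Set.univ.pi (Function.update s p Set.univ)) ×ˢ (s p) := by
    ext q
    simp only [Set.mem_preimage, Set.mem_univ_pi, Set.mem_prod]
    constructor
    · intro h
      refine ⟨fun i => ?_, by simpa using h p⟩
      by_cases hi : i = p
      · subst hi; simp
      · simpa [Function.update_of_ne hi] using h i
    · rintro ⟨h1, h2⟩ i
      by_cases hi : i = p
      · subst hi; simpa using h2
      · simpa [Function.update_of_ne hi] using h1 i
  rw [this, Measure.prod_prod, gaussianFamily, Measure.pi_pi]
  rw [← Finset.mul_prod_erase Finset.univ _ (Finset.mem_univ p),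
    ← Finset.mul_prod_erase Finset.univ (fun i => (gaussianReal 0 v) (s i)) (Finset.mem_univ p)]
  simp only [Function.update_self, measure_univ, one_mul]
  rw [mul_comm]
  congr 1
  refine Finset.prod_congr rfl fun i hi => ?_
  rw [Function.update_of_ne (Finset.ne_of_mem_erase hi)]

/-- Freezing all coordinates but one reduces integration by parts for the family to the
one-dimensional case. -/
lemma integral_gaussianFamily_update {v : ℝ≥0} (p : ι) {f : (ι → ℝ) → ℂ}
    (hf : Integrable f (gaussianFamily ι v)) :
    ∫ x, f x ∂(gaussianFamily ι v) =
      ∫ x, ∫ s, f (Function.update x p s) ∂(gaussianReal 0 v) ∂(gaussianFamily ι v) := by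
  have h := map_update_gaussianFamily (ι := ι) v p
  have hf' := hf
  rw [← h] at hf'
  conv_lhs => rw [← h]
  rw [integral_map (measurable_update_prod p).aemeasurable hf'.1]
  exact integral_prod _ (hf'.comp_measurable (measurable_update_prod p))

/-- Gaussian integration by parts for a family of independent Gaussian variables. -/
lemma integral_eval_mul_gaussianFamily {v : ℝ≥0} (hv : v ≠ 0) (p : ι) {f f' : (ι → ℝ) → ℂ}
    {C C' : ℝ} (hfm : Measurable f) (hfm' : Measurable f')
    (hf : ∀ x s, HasDerivAt (fun s => f (Function.update x p s)) (f' (Function.update x p s)) s)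
    (hC : ∀ x, ‖f x‖ ≤ C) (hC' : ∀ x, ‖f' x‖ ≤ C') :
    ∫ x, (x p : ℂ) * f x ∂(gaussianFamily ι v) = v * ∫ x, f' x ∂(gaussianFamily ι v) := by
  have i1 : Integrable (fun x : ι → ℝ => (x p : ℂ) * f x) (gaussianFamily ι v) :=
    (integrable_eval_gaussianFamily v p).mul_bdd (c := C) hfm.aestronglyMeasurable
      (ae_of_all _ hC)
  have i2 : Integrable f' (gaussianFamily ι v) :=
    .of_bound hfm'.aestronglyMeasurable C' (ae_of_all _ hC')
  rw [integral_gaussianFamily_update p i1, integral_gaussianFamily_update p i2,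
    ← integral_const_mul]
  congr 1; ext x
  rw [← integral_id_mul_gaussianReal hv (hf x) (fun _ => hC _) (fun _ => hC' _)]
  simp

/-! ### The Gaussian Poincaré inequality -/

section
variable {ι : Type*} [Fintype ι]

/-- Rotation invariance of a pair of independent copies, which drives the Poincaré inequality, is
available for centred Gaussian measures; this instance and the vanishing mean below supply the
hypotheses. -/
instance (v : ℝ≥0) : IsGaussian (gaussianFamily ι v) := by
  have h1 : iIndepFun (fun (i : ι) (x : ι → ℝ) => x i) (gaussianFamily ι v) :=
    iIndepFun_pi (μ := fun _ : ι => gaussianReal 0 v) (X := fun _ x => x)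
      fun _ => aemeasurable_id
  have h2 := iIndepFun.hasGaussianLaw (fun i => ⟨by
    have : (gaussianFamily ι v).map (fun x : ι → ℝ => x i) = gaussianReal 0 v :=
      (measurePreserving_eval (fun _ : ι => gaussianReal 0 v) i).map_eq
    rw [this]; infer_instance⟩) h1
  have := h2.isGaussian_map
  simpa using this

lemma integral_id_gaussianFamily (v : ℝ≥0) : ∫ x, id x ∂(gaussianFamily ι v) = 0 := by
  have hint : Integrable id (gaussianFamily ι v) := IsGaussian.integrable_id
  ext p
  have := (ContinuousLinearMap.proj (R := ℝ) (φ := fun _ : ι => ℝ) p).integral_comp_comm hint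
  simp only [ContinuousLinearMap.proj_apply] at this
  rw [← this]
  have h := (measurePreserving_eval (fun _ : ι => gaussianReal 0 v) p).map_eq
  have h2 : ∫ y, y ∂((gaussianFamily ι v).map (Function.eval p)) = ∫ x, x p ∂(gaussianFamily ι v) :=
    integral_map (measurable_pi_apply p).aemeasurable aestronglyMeasurable_id
  rw [gaussianFamily, h, integral_id_gaussianReal] at h2
  simpa [gaussianFamily] using h2.symm

lemma integrable_sq_sum_gaussianFamily (v : ℝ≥0) (c : ι → ℝ) :
    Integrable (fun x => (∑ p, c p * x p) ^ 2) (gaussianFamily ι v) := by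
  refine MemLp.integrable_sq ?_
  refine memLp_finsetSum _ fun p _ => MemLp.const_mul ?_ _
  exact (memLp_id_gaussianReal' 2 (by simp)).comp_measurePreserving
    (measurePreserving_eval (fun _ : ι => gaussianReal 0 v) p)

lemma integral_sq_sum_gaussianFamily (v : ℝ≥0) (c : ι → ℝ) :
    ∫ x, (∑ p, c p * x p) ^ 2 ∂(gaussianFamily ι v) = v * ∑ p, c p ^ 2 := by
  have hm : ∀ p, MemLp (fun y : ℝ => c p * y) 2 (gaussianReal 0 v) := fun p =>
    MemLp.const_mul (memLp_id_gaussianReal' 2 (by simp)) _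
  have h := variance_sum_pi (μ := fun _ : ι => gaussianReal 0 v) hm
  have h0 : ∫ x, (∑ p, fun x : ι → ℝ => c p * x p) x ∂(gaussianFamily ι v) = 0 := by
    simp only [Finset.sum_apply]
    rw [integral_finsetSum]
    · refine Finset.sum_eq_zero fun p _ => ?_
      rw [integral_const_mul]
      have := congrFun (integral_id_gaussianFamily (ι := ι) v) p
      have h3 := (ContinuousLinearMap.proj (R := ℝ) (φ := fun _ : ι => ℝ) p).integral_comp_comm
        (IsGaussian.integrable_id (μ := gaussianFamily ι v))
      simp only [ContinuousLinearMap.proj_apply, id] at h3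
      rw [h3]; simpa using Or.inr this
    · intro p _
      have hi : Integrable (fun y : ℝ => y) (gaussianReal 0 v) :=
        (memLp_id_gaussianReal 1).integrable (by simp)
      exact ((measurePreserving_eval (fun _ : ι => gaussianReal 0 v) p).integrable_comp_of_integrable
        hi).const_mul _
  change Var[_; gaussianFamily ι v] = _ at h
  rw [variance_of_integral_eq_zero ?_ h0] at h
  · simp only [Finset.sum_apply] at h
    rw [h, Finset.mul_sum]
    refine Finset.sum_congr rfl fun p _ => ?_
    rw [variance_const_mul, variance_fun_id_gaussianReal]; ring
  · refine Measurable.aemeasurable ?_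
    fun_prop

lemma lintegral_enorm_sum_sq_gaussianFamily (v : ℝ≥0) (c : ι → ℂ) :
    ∫⁻ x, ‖∑ p, c p * (x p : ℂ)‖ₑ ^ 2 ∂(gaussianFamily ι v)
      = ENNReal.ofReal (v * ∑ p, ‖c p‖ ^ 2) := by
  have h : ∀ x : ι → ℝ, ‖∑ p, c p * (x p : ℂ)‖ₑ ^ 2 =
      ENNReal.ofReal ((∑ p, (c p).re * x p) ^ 2 + (∑ p, (c p).im * x p) ^ 2) := by
    intro x
    rw [← ofReal_norm, ← ENNReal.ofReal_pow (norm_nonneg _), ← Complex.normSq_eq_norm_sq,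
      Complex.normSq_apply]
    simp [Complex.re_sum, Complex.im_sum, sq]
  simp_rw [h]
  have hi : Integrable (fun x : ι → ℝ => (∑ p, (c p).re * x p) ^ 2 + (∑ p, (c p).im * x p) ^ 2)
      (gaussianFamily ι v) :=
    (integrable_sq_sum_gaussianFamily v _).add (integrable_sq_sum_gaussianFamily v _)
  rw [← ofReal_integral_eq_lintegral_ofReal hi (ae_of_all _ fun x => by positivity), integral_add (integrable_sq_sum_gaussianFamily v _)
    (integrable_sq_sum_gaussianFamily v _), integral_sq_sum_gaussianFamily,
    integral_sq_sum_gaussianFamily, ← mul_add, ← Finset.sum_add_distrib]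
  simp_rw [← Complex.normSq_eq_norm_sq, Complex.normSq_apply, sq]

/-- Cauchy–Schwarz for the length of a curve. -/
lemma enorm_sub_sq_le_lintegral {f f' : ℝ → ℂ} {b : ℝ} (hb : 0 ≤ b)
    (hf : ∀ x, HasDerivAt f (f' x) x) (hf' : Continuous f') :
    ‖f b - f 0‖ₑ ^ 2 ≤ ENNReal.ofReal b * ∫⁻ s in Set.Ioc 0 b, ‖f' s‖ₑ ^ 2 := by
  rw [← intervalIntegral.integral_eq_sub_of_hasDerivAt (fun x _ => hf x)
    (hf'.intervalIntegrable 0 b), intervalIntegral.integral_of_le hb]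
  have h1 := enorm_integral_le_lintegral_enorm (μ := volume.restrict (Set.Ioc 0 b)) f'
  have h2 := ENNReal.lintegral_mul_le_Lp_mul_Lq (volume.restrict (Set.Ioc 0 b))
    Real.HolderConjugate.two_two (f := fun _ => 1) (g := fun s => ‖f' s‖ₑ) aemeasurable_const
    hf'.measurable.enorm.aemeasurable
  simp only [Pi.mul_apply, one_mul, ENNReal.one_rpow, lintegral_const, MeasurableSet.univ,
    Measure.restrict_apply, Set.univ_inter, Real.volume_Ioc, sub_zero] at h2
  have h3 := pow_le_pow_left' (h1.trans h2) 2
  refine h3.trans_eq ?_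
  rw [mul_pow, ← ENNReal.rpow_natCast, ← ENNReal.rpow_natCast, ← ENNReal.rpow_mul,
    ← ENNReal.rpow_mul]
  simp

/-- The two copies are joined by a quarter circle and not by a segment, because position and
velocity on it form a rotation of the pair (u, w), hence are again two independent copies of the
same Gaussian vector. -/
lemma enorm_sub_sq_le_lintegral_rotation {f : (ι → ℝ) → ℂ}
    {D : (ι → ℝ) → ι → ℂ} (hD : Continuous D)
    (hf : ∀ x y : ℝ → ι → ℝ, ∀ s, (∀ s, HasDerivAt x (y s) s) →
      HasDerivAt (fun s => f (x s)) (∑ p, D (x s) p * (y s p : ℂ)) s) (u w : ι → ℝ) :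
    ‖f w - f u‖ₑ ^ 2 ≤ ENNReal.ofReal (Real.pi / 2) *
      ∫⁻ s : ℝ in Set.Ioc 0 (Real.pi / 2), ‖∑ p, D (Real.cos s • u + Real.sin s • w) p *
        ((-Real.sin s • u + Real.cos s • w) p : ℂ)‖ₑ ^ 2 := by
  obtain ⟨x, hx⟩ : ∃ x : ℝ → ι → ℝ, x = fun s => Real.cos s • u + Real.sin s • w := ⟨_, rfl⟩
  obtain ⟨y, hy⟩ : ∃ y : ℝ → ι → ℝ, y = fun s => -Real.sin s • u + Real.cos s • w := ⟨_, rfl⟩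
  have hd : ∀ s, HasDerivAt x (y s) s := by
    intro s
    rw [hx, hy]
    exact ((Real.hasDerivAt_cos s).smul_const u).add ((Real.hasDerivAt_sin s).smul_const w)
  have hxc : Continuous x := by rw [hx]; fun_prop
  have hyc : Continuous y := by rw [hy]; fun_prop
  have hcd : Continuous fun s => ∑ p, D (x s) p * (y s p : ℂ) := by
    refine continuous_finsetSum _ fun p _ => Continuous.mul ?_ ?_
    · exact (continuous_apply p).comp (hD.comp hxc)
    · exact Complex.continuous_ofReal.comp ((continuous_apply p).comp hyc)
  have h := enorm_sub_sq_le_lintegral (by positivity : (0 : ℝ) ≤ Real.pi / 2)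
    (fun s => hf x y s hd) hcd
  have e1 : x (Real.pi / 2) = w := by simp [hx]
  have e0 : x 0 = u := by simp [hx]
  rw [e1, e0, hx, hy] at h
  exact h

/-- A Poincaré inequality for independent Gaussian variables, for two independent copies. -/
lemma lintegral_enorm_sub_sq_gaussianFamily_le (v : ℝ≥0) {f : (ι → ℝ) → ℂ}
    {D : (ι → ℝ) → ι → ℂ} (hD : Continuous D)
    (hf : ∀ x y : ℝ → ι → ℝ, ∀ s, (∀ s, HasDerivAt x (y s) s) →
      HasDerivAt (fun s => f (x s)) (∑ p, D (x s) p * (y s p : ℂ)) s)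
    {K : ℝ} (hK : ∀ x, ∑ p, ‖D x p‖ ^ 2 ≤ K) :
    ∫⁻ q, ‖f q.2 - f q.1‖ₑ ^ 2 ∂((gaussianFamily ι v).prod (gaussianFamily ι v))
      ≤ ENNReal.ofReal (Real.pi / 2) ^ 2 * ENNReal.ofReal (v * K) := by
  set γ := gaussianFamily ι v
  set G : (ι → ℝ) × (ι → ℝ) → ENNReal := fun q => ‖∑ p, D q.1 p * (q.2 p : ℂ)‖ₑ ^ 2 with hG
  have hGm : Measurable G := by
    have : Continuous fun q : (ι → ℝ) × (ι → ℝ) => ∑ p, D q.1 p * (q.2 p : ℂ) := by fun_prop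
    exact this.measurable.enorm.pow_const 2
  have hpi : (0 : ℝ) ≤ Real.pi / 2 := by positivity
  have hrot : Continuous fun w : ((ι → ℝ) × (ι → ℝ)) × ℝ =>
      ContinuousLinearMap.rotation w.2 w.1 := by
    simp only [ContinuousLinearMap.rotation_apply]; fun_prop
  have step1 : ∀ q : (ι → ℝ) × (ι → ℝ), ‖f q.2 - f q.1‖ₑ ^ 2 ≤
      ENNReal.ofReal (Real.pi / 2) *
        ∫⁻ s : ℝ in Set.Ioc 0 (Real.pi / 2), G (ContinuousLinearMap.rotation s q) := by
    exact fun q => enorm_sub_sq_le_lintegral_rotation hD hf q.1 q.2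
  have step2 : ∀ s : ℝ, ∫⁻ q, G (ContinuousLinearMap.rotation s q) ∂(γ.prod γ)
      ≤ ENNReal.ofReal (v * K) := by
    intro s
    -- Once invariance has removed the rotation, the velocity is independent of the position, and
    -- the inner integral is the variance of a linear form with frozen coefficients.
    rw [← lintegral_map hGm (ContinuousLinearMap.rotation s).continuous.measurable,
      IsGaussian.map_rotation_eq_self (integral_id_gaussianFamily v) s,
      lintegral_prod _ hGm.aemeasurable]
    calc ∫⁻ x, ∫⁻ y, G (x, y) ∂γ ∂γ ≤ ∫⁻ x, ENNReal.ofReal (v * K) ∂γ := by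
          refine lintegral_mono fun x => ?_
          simp only [hG]
          rw [lintegral_enorm_sum_sq_gaussianFamily]
          exact ENNReal.ofReal_le_ofReal (mul_le_mul_of_nonneg_left (hK x) v.2)
      _ = ENNReal.ofReal (v * K) := by simp
  calc ∫⁻ q, ‖f q.2 - f q.1‖ₑ ^ 2 ∂(γ.prod γ)
      ≤ ∫⁻ q, ENNReal.ofReal (Real.pi / 2) *
        (∫⁻ s : ℝ in Set.Ioc 0 (Real.pi / 2), G (ContinuousLinearMap.rotation s q)) ∂(γ.prod γ) :=
        lintegral_mono step1
    _ = ENNReal.ofReal (Real.pi / 2) * ∫⁻ s : ℝ in Set.Ioc 0 (Real.pi / 2),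
        ∫⁻ q, G (ContinuousLinearMap.rotation s q) ∂(γ.prod γ) := by
        rw [lintegral_const_mul']
        · rw [lintegral_lintegral_swap]
          exact (hGm.comp hrot.measurable).aemeasurable
        · simp
    _ ≤ ENNReal.ofReal (Real.pi / 2) * ∫⁻ s : ℝ in Set.Ioc 0 (Real.pi / 2), ENNReal.ofReal (v * K) := by
        exact mul_le_mul' le_rfl (lintegral_mono fun s => step2 s)
    _ = _ := by simp; ring

/-- A Poincaré inequality for independent Gaussian variables. -/
lemma integral_norm_sub_sq_gaussianFamily_le (v : ℝ≥0) {f : (ι → ℝ) → ℂ}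
    {D : (ι → ℝ) → ι → ℂ} (hfm : Continuous f) (hD : Continuous D)
    (hf : ∀ x y : ℝ → ι → ℝ, ∀ s, (∀ s, HasDerivAt x (y s) s) →
      HasDerivAt (fun s => f (x s)) (∑ p, D (x s) p * (y s p : ℂ)) s)
    {C : ℝ} (hC : ∀ x, ‖f x‖ ≤ C) {K : ℝ} (hK0 : 0 ≤ K) (hK : ∀ x, ∑ p, ‖D x p‖ ^ 2 ≤ K) :
    ∫ x, ‖f x - ∫ y, f y ∂(gaussianFamily ι v)‖ ^ 2 ∂(gaussianFamily ι v)
      ≤ (Real.pi / 2) ^ 2 * (v * K) := by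
  have main := lintegral_enorm_sub_sq_gaussianFamily_le v hD hf hK
  set γ := gaussianFamily ι v
  have hi : Integrable f γ := .of_bound hfm.aestronglyMeasurable C (ae_of_all _ hC)
  have hb : ∀ x y, ‖f y - f x‖ ^ 2 ≤ (C + C) ^ 2 := fun x y =>
    pow_le_pow_left₀ (norm_nonneg _) ((norm_sub_le _ _).trans (add_le_add (hC _) (hC _))) 2
  have hi2 : Integrable (fun q : (ι → ℝ) × (ι → ℝ) => ‖f q.2 - f q.1‖ ^ 2) (γ.prod γ) := by
    refine .of_bound ?_ ((C + C) ^ 2) (ae_of_all _ fun q => ?_)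
    · exact Continuous.aestronglyMeasurable (by fun_prop)
    · rw [Real.norm_of_nonneg (by positivity)]; exact hb _ _
  have h1 : ∫ q, ‖f q.2 - f q.1‖ ^ 2 ∂(γ.prod γ) ≤ (Real.pi / 2) ^ 2 * (v * K) := by
    have e : ENNReal.ofReal (∫ q, ‖f q.2 - f q.1‖ ^ 2 ∂(γ.prod γ)) =
        ∫⁻ q, ‖f q.2 - f q.1‖ₑ ^ 2 ∂(γ.prod γ) := by
      rw [ofReal_integral_eq_lintegral_ofReal hi2 (ae_of_all _ fun q => by positivity)]
      simp_rw [← ofReal_norm, ENNReal.ofReal_pow (norm_nonneg _)]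
    rw [← e, ← ENNReal.ofReal_pow (by positivity), ← ENNReal.ofReal_mul (by positivity)] at main
    exact (ENNReal.ofReal_le_ofReal_iff (by positivity)).1 main
  -- Jensen's inequality in one of the two copies passes from their difference to the deviation from
  -- the mean.
  rw [integral_prod_symm _ hi2] at h1
  refine le_trans (integral_mono ?_ hi2.integral_prod_right fun x => ?_) h1
  · refine .of_bound (Continuous.aestronglyMeasurable (by fun_prop)) ((C + C) ^ 2)
      (ae_of_all _ fun x => ?_)
    rw [Real.norm_of_nonneg (by positivity)]
    refine pow_le_pow_left₀ (norm_nonneg _) ((norm_sub_le _ _).trans (add_le_add (hC _) ?_)) 2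
    exact (norm_integral_le_of_norm_le_const (ae_of_all _ hC)).trans (by simp)
  · have e : f x - ∫ y, f y ∂γ = ∫ y, (f x - f y) ∂γ := by
      rw [integral_sub (integrable_const _) hi]; simp
    simp only [e]
    have hj := ConvexOn.map_integral_le (μ := γ) (f := fun y => f x - f y)
      (g := fun w : ℂ => ‖w‖ ^ 2) (s := Set.univ)
      ((convexOn_univ_norm).pow (fun _ _ => norm_nonneg _) 2) (by fun_prop) isClosed_univ
      (ae_of_all _ fun _ => Set.mem_univ _) ((integrable_const _).sub hi) (by
        refine .of_bound (Continuous.aestronglyMeasurable (by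
          simp only [Function.comp_def]; fun_prop)) ((C + C) ^ 2) (ae_of_all _ fun y => ?_)
        simp only [Function.comp_def]
        rw [Real.norm_of_nonneg (by positivity)]
        exact hb _ _)
    exact hj

end

/-! ### Resolvents of real symmetric matrices -/

section Resolvent

open scoped Matrix.Norms.L2Operator

variable {n : Type*} [Fintype n] [DecidableEq n]

/-- The resolvent `(M - z)⁻¹` of a real matrix at a complex point. -/
def resolvent (M : Matrix n n ℝ) (z : ℂ) : Matrix n n ℂ :=
  (M.map Complex.ofReal - z • (1 : Matrix n n ℂ))⁻¹

/-- The quadratic form `uᵀ X u` of a complex matrix at a real vector. -/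
def quadForm (u : n → ℝ) (X : Matrix n n ℂ) : ℂ :=
  (fun i => (u i : ℂ)) ⬝ᵥ (X *ᵥ fun i => (u i : ℂ))

lemma isSelfAdjoint_map_ofReal {M : Matrix n n ℝ} (hM : M.IsSymm) :
    IsSelfAdjoint (M.map Complex.ofReal) := by
  ext i j
  simp [Matrix.star_apply, hM.apply]

lemma isUnit_sub_smul_one {M : Matrix n n ℝ} (hM : M.IsSymm) {z : ℂ} (hz : z.im ≠ 0) :
    IsUnit (M.map Complex.ofReal - z • (1 : Matrix n n ℂ)) := by
  by_contra h
  have h2 : z ∈ spectrum ℂ (M.map Complex.ofReal) := by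
    rw [spectrum.mem_iff, ← IsUnit.neg_iff, neg_sub, Algebra.algebraMap_eq_smul_one]
    exact h
  have := (isSelfAdjoint_map_ofReal hM).mem_spectrum_eq_re h2
  apply hz
  rw [this]; simp

lemma sub_mul_resolvent {M : Matrix n n ℝ} (hM : M.IsSymm) {z : ℂ} (hz : z.im ≠ 0) :
    (M.map Complex.ofReal - z • (1 : Matrix n n ℂ)) * resolvent M z = 1 :=
  Matrix.mul_nonsing_inv _ ((Matrix.isUnit_iff_isUnit_det _).1 (isUnit_sub_smul_one hM hz))

lemma resolvent_mul_sub {M : Matrix n n ℝ} (hM : M.IsSymm) {z : ℂ} (hz : z.im ≠ 0) :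
    resolvent M z * (M.map Complex.ofReal - z • (1 : Matrix n n ℂ)) = 1 :=
  Matrix.nonsing_inv_mul _ ((Matrix.isUnit_iff_isUnit_det _).1 (isUnit_sub_smul_one hM hz))

lemma resolvent_transpose {M : Matrix n n ℝ} (hM : M.IsSymm) (z : ℂ) :
    (resolvent M z)ᵀ = resolvent M z := by
  rw [resolvent, Matrix.transpose_nonsing_inv, Matrix.transpose_sub, Matrix.transpose_smul,
    Matrix.transpose_one, ← Matrix.transpose_map, hM.eq]

/-- With T = M − z, self-adjointness gives T* = T + 2i Im z, hence R − R* = 2i (Im z) R*R; the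
C*-identity turns this into 2 (Im z) ‖R‖² ≤ 2 ‖R‖. -/
lemma norm_resolvent_le {M : Matrix n n ℝ} (hM : M.IsSymm) {z : ℂ} (hz : 0 < z.im) :
    ‖resolvent M z‖ ≤ 1 / z.im := by
  set R := resolvent M z
  set T := M.map Complex.ofReal - z • (1 : Matrix n n ℂ)
  have h1 : T * R = 1 := sub_mul_resolvent hM hz.ne'
  have h2 : star R * star T = 1 := by rw [← star_mul, h1, star_one]
  have h3 : star T = T + (2 * Complex.I * z.im) • (1 : Matrix n n ℂ) := by
    have : star T = M.map Complex.ofReal - (star z) • (1 : Matrix n n ℂ) := by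
      simp only [T, star_sub, star_smul, star_one, (isSelfAdjoint_map_ofReal hM).star_eq]
    rw [this]
    simp only [T]
    rw [sub_add, ← sub_smul]
    congr 2
    apply Complex.ext <;> simp
    ring
  have h4 : (2 * Complex.I * z.im) • (star R * R) = R - star R := by
    have : star R * star T * R = star R * (T * R) + (2 * Complex.I * z.im) • (star R * R) := by
      rw [h3]; noncomm_ring
    rw [h2, h1] at this
    simp only [one_mul, mul_one] at this
    exact (sub_eq_of_eq_add' this).symm
  have h5 : 2 * z.im * (‖R‖ * ‖R‖) ≤ 2 * ‖R‖ := by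
    have e := congrArg norm h4
    rw [norm_smul, CStarRing.norm_star_mul_self] at e
    have : ‖(2 * Complex.I * z.im : ℂ)‖ = 2 * z.im := by
      simp [abs_of_pos hz]
    rw [this] at e
    rw [e]
    refine (norm_sub_le _ _).trans ?_
    rw [norm_star]; linarith
  rcases (norm_nonneg R).eq_or_lt with h0 | h0
  · rw [← h0]; positivity
  · rw [le_div_iff₀ hz]
    nlinarith

lemma norm_quadForm_le (u : n → ℝ) (X : Matrix n n ℂ) :
    ‖quadForm u X‖ ≤ ‖X‖ * ∑ i, u i ^ 2 := by
  set w : EuclideanSpace ℂ n := WithLp.toLp 2 fun i => (u i : ℂ)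
  have h1 : quadForm u X = inner ℂ w ((EuclideanSpace.equiv n ℂ).symm (X *ᵥ w.ofLp)) := by
    simp [quadForm, w, PiLp.inner_apply, dotProduct, mul_comm]
  have h2 : ‖w‖ ^ 2 = ∑ i, u i ^ 2 := by
    rw [EuclideanSpace.norm_sq_eq]; simp [w]
  rw [h1, ← h2]
  refine (norm_inner_le_norm _ _).trans ?_
  have := Matrix.l2_opNorm_mulVec X w
  nlinarith [norm_nonneg w]

/-- Each column is the image of a unit vector, so its length is at most the operator norm. -/
lemma sum_norm_sq_le (X : Matrix n n ℂ) :
    ∑ i, ∑ j, ‖X i j‖ ^ 2 ≤ Fintype.card n * ‖X‖ ^ 2 := by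
  rw [Finset.sum_comm]
  have h : ∀ j, ∑ i, ‖X i j‖ ^ 2 ≤ ‖X‖ ^ 2 := by
    intro j
    have h1 := Matrix.l2_opNorm_mulVec X (EuclideanSpace.single j (1 : ℂ))
    rw [PiLp.norm_single, norm_one, mul_one] at h1
    have h2 := pow_le_pow_left₀ (norm_nonneg _) h1 2
    rw [EuclideanSpace.norm_sq_eq] at h2
    simpa using h2
  calc _ ≤ ∑ j : n, ‖X‖ ^ 2 := Finset.sum_le_sum fun j _ => h j
    _ = _ := by simp

lemma norm_apply_self_le (X : Matrix n n ℂ) (i : n) : ‖X i i‖ ≤ ‖X‖ := by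
  have := norm_quadForm_le (Pi.single i 1) X
  have e : (fun j => ((Pi.single i 1 : n → ℝ) j : ℂ)) = Pi.single i 1 := by
    ext j; by_cases h : j = i
    · subst h; simp
    · simp [h]
  rw [quadForm, e] at this
  simpa [Pi.single_apply] using this

lemma norm_trace_le (X : Matrix n n ℂ) : ‖X.trace‖ ≤ Fintype.card n * ‖X‖ := by
  rw [Matrix.trace]
  refine (norm_sum_le _ _).trans ?_
  calc _ ≤ ∑ j : n, ‖X‖ := Finset.sum_le_sum fun j _ => norm_apply_self_le X j
    _ = _ := by simp

lemma hasDerivAt_resolvent {M : ℝ → Matrix n n ℝ} {M' : Matrix n n ℝ} {s : ℝ} {z : ℂ}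
    (hM : (M s).IsSymm) (hz : z.im ≠ 0) (h : ∀ i j, HasDerivAt (fun s => M s i j) (M' i j) s) :
    HasDerivAt (fun s => resolvent (M s) z)
      (-(resolvent (M s) z * M'.map Complex.ofReal * resolvent (M s) z)) s := by
  have h0 : HasDerivAt (fun s => (M s).map Complex.ofReal - z • (1 : Matrix n n ℂ))
      (M'.map Complex.ofReal) s := by
    refine HasDerivAt.sub_const _ ?_
    have : HasDerivAt (fun s => (fun i j => ((M s i j : ℝ) : ℂ) : n → n → ℂ))
        (fun i j => ((M' i j : ℝ) : ℂ)) s := by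
      rw [hasDerivAt_pi]; intro i
      rw [hasDerivAt_pi]; intro j
      exact (h i j).ofReal_comp
    -- The operator norm induces the entrywise topology, so convergence of the slopes transfers from
    -- functions to matrices.
    rw [hasDerivAt_iff_tendsto_slope] at this ⊢
    exact this
  obtain ⟨u, hu⟩ := isUnit_sub_smul_one hM hz
  have h1 := hasFDerivAt_ringInverse (𝕜 := ℝ) u
  rw [hu] at h1
  have := h1.comp_hasDerivAt s h0
  simp only [Function.comp_def, ← Matrix.nonsing_inv_eq_ringInverse] at this
  refine this.congr_deriv ?_
  simp [ContinuousLinearMap.mulLeftRight_apply, Matrix.coe_units_inv, hu, resolvent]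

lemma continuous_resolvent {X : Type*} [TopologicalSpace X] {M : X → Matrix n n ℝ} {z : ℂ}
    (hM : ∀ x, (M x).IsSymm) (hz : z.im ≠ 0) (h : Continuous M) :
    Continuous fun x => resolvent (M x) z := by
  rw [continuous_iff_continuousAt]
  intro x
  have h0 : Continuous fun x => (M x).map Complex.ofReal - z • (1 : Matrix n n ℂ) :=
    (Continuous.matrix_map h Complex.continuous_ofReal).sub continuous_const
  obtain ⟨u, hu⟩ := isUnit_sub_smul_one (hM x) hz
  have h1 := NormedRing.inverse_continuousAt u
  rw [hu] at h1
  have := ContinuousAt.comp (f := fun x => (M x).map Complex.ofReal - z • (1 : Matrix n n ℂ))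
    h1 h0.continuousAt
  simp only [Function.comp_def, ← Matrix.nonsing_inv_eq_ringInverse] at this
  exact this

end Resolvent

/-! ### The covariance structure of the Gaussian orthogonal ensemble -/

section GOE

variable {N : ℕ}

/-- The coefficient matrices of the entries of the Gaussian orthogonal ensemble. -/
def goeBasis (N : ℕ) (p : {p : Fin N × Fin N // p.1 ≤ p.2}) : Matrix (Fin N) (Fin N) ℝ :=
  Matrix.of fun i j => if (min i j, max i j) = p.1 then
    (if i = j then √(2 / (N : ℝ)) else √(1 / (N : ℝ))) else 0

/-- The Gaussian orthogonal ensemble as a linear function of its independent entries. -/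
def goeMatrix (x : {p : Fin N × Fin N // p.1 ≤ p.2} → ℝ) : Matrix (Fin N) (Fin N) ℝ :=
  ∑ p, x p • goeBasis N p

lemma goeBasis_apply (p : {p : Fin N × Fin N // p.1 ≤ p.2}) (i j : Fin N) :
    goeBasis N p i j = if p = ⟨(min i j, max i j), min_le_max⟩ then
      (if i = j then √(2 / (N : ℝ)) else √(1 / (N : ℝ))) else 0 := by
  simp only [goeBasis, Matrix.of_apply, Subtype.ext_iff, eq_comm]

lemma goeBasis_isSymm (p : {p : Fin N × Fin N // p.1 ≤ p.2}) : (goeBasis N p).IsSymm := by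
  ext i j
  simp [goeBasis, min_comm, max_comm, eq_comm]

lemma goeMatrix_isSymm (x : {p : Fin N × Fin N // p.1 ≤ p.2} → ℝ) : (goeMatrix x).IsSymm := by
  unfold goeMatrix Matrix.IsSymm
  rw [Matrix.transpose_sum]
  simp [(goeBasis_isSymm _).eq]

lemma goeMatrix_apply (x : {p : Fin N × Fin N // p.1 ≤ p.2} → ℝ) (i j : Fin N) :
    goeMatrix x i j = (if i = j then √(2 / (N : ℝ)) else √(1 / (N : ℝ))) *
      x ⟨(min i j, max i j), min_le_max⟩ := by
  simp [goeMatrix, Matrix.sum_apply, goeBasis_apply, mul_comm]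

lemma symmBrownian_eq_goeMatrix {Ω : Type*} (B : Fin N → Fin N → ℝ≥0 → Ω → ℝ) (t : ℝ≥0) (ω : Ω) :
    symmBrownian B t ω = goeMatrix fun p => B p.1.1 p.1.2 t ω := by
  ext i j
  rw [goeMatrix_apply]
  by_cases h : i = j
  · subst h; simp [symmBrownian]
  · simp [symmBrownian, h]

lemma min_max_eq_iff (i j k l : Fin N) :
    (min i j = min k l ∧ max i j = max k l) ↔ (i = k ∧ j = l) ∨ (i = l ∧ j = k) := by
  simp only [Fin.ext_iff, Fin.coe_min, Fin.coe_max]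
  omega

/-- The covariance of the entries of the Gaussian orthogonal ensemble. -/
lemma sum_goeBasis_mul (i j k l : Fin N) :
    ∑ p, goeBasis N p i j * goeBasis N p k l =
      1 / N * ((if i = k ∧ j = l then 1 else 0) + (if i = l ∧ j = k then 1 else 0)) := by
  have hN : (0 : ℝ) ≤ 1 / N := by positivity
  have hN2 : (0 : ℝ) ≤ 2 / N := by positivity
  simp only [goeBasis_apply, ite_mul, zero_mul, Finset.sum_ite_eq',
    Finset.mem_univ, if_true, Subtype.mk.injEq, Prod.mk.injEq, min_max_eq_iff]
  by_cases h1 : i = k ∧ j = l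
  · obtain ⟨rfl, rfl⟩ := h1
    by_cases h2 : i = j
    · subst h2
      simp only [and_self, or_self, if_true, Real.mul_self_sqrt hN2]
      ring
    · have h3 : ¬ (i = j ∧ j = i) := fun h => h2 h.1
      simp only [h3, and_self, true_or, if_true, if_false, if_neg h2, Real.mul_self_sqrt hN]
      ring
  · by_cases h2 : i = l ∧ j = k
    · obtain ⟨rfl, rfl⟩ := h2
      have h3 : i ≠ j := fun h => h1 ⟨h, h.symm⟩
      have h4 : ¬ (i = j ∧ j = i) := fun h => h3 h.1
      simp only [h4, and_self, or_true, if_true, if_false, if_neg h3, if_neg h3.symm,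
        Real.mul_self_sqrt hN]
      ring
    · simp [h1, h2]

/-- This is the expectation of H X H for entries of unit variance. The trace term drives the limit;
the transposed term is special to real symmetric matrices and becomes an error of order 1/N in the
loop equation. -/
lemma sum_goeBasis_mul_mul (X : Matrix (Fin N) (Fin N) ℂ) :
    ∑ p, (goeBasis N p).map Complex.ofReal * X * (goeBasis N p).map Complex.ofReal
      = (1 / N : ℂ) • (Xᵀ + X.trace • (1 : Matrix (Fin N) (Fin N) ℂ)) := by
  ext i l
  have hc : ∀ j k : Fin N, ∑ p, (goeBasis N p i j : ℂ) * (goeBasis N p k l : ℂ) =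
      1 / N * ((if i = k ∧ j = l then 1 else 0) + (if i = l ∧ j = k then 1 else 0)) := by
    intro j k
    have := congrArg (fun r : ℝ => (r : ℂ)) (sum_goeBasis_mul i j k l)
    push_cast at this
    rw [this]
    split_ifs <;> simp
  have : (∑ p, (goeBasis N p).map Complex.ofReal * X * (goeBasis N p).map Complex.ofReal) i l =
      ∑ k, ∑ j, X j k * ∑ p, (goeBasis N p i j : ℂ) * (goeBasis N p k l : ℂ) := by
    simp only [Matrix.sum_apply, Matrix.mul_apply, Matrix.map_apply, Finset.sum_mul,
      Finset.mul_sum]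
    rw [Finset.sum_comm]
    refine Finset.sum_congr rfl fun k _ => ?_
    rw [Finset.sum_comm]
    refine Finset.sum_congr rfl fun j _ => Finset.sum_congr rfl fun p _ => ?_
    ring
  rw [this]
  simp only [hc, Matrix.smul_apply, Matrix.add_apply, Matrix.transpose_apply, Matrix.one_apply,
    smul_eq_mul, Matrix.trace, Matrix.diag_apply]
  simp only [ite_and, mul_add, mul_ite, mul_one, mul_zero, Finset.sum_add_distrib]
  congr 1
  · simp [mul_comm]
  · by_cases h : i = l <;> simp [h, Finset.mul_sum, mul_comm]

/-- Such sums are squared gradient lengths in the Poincaré inequality. The covariance produces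
|X_ji|² and a cross term of X_ji with X_ij; absorbing the latter by 2xy ≤ x² + y² costs the factor
2. -/
lemma sum_norm_trace_goeBasis_mul_sq_le (X : Matrix (Fin N) (Fin N) ℂ) :
    ∑ p, ‖((goeBasis N p).map Complex.ofReal * X).trace‖ ^ 2 ≤ 2 / N * ∑ i, ∑ j, ‖X i j‖ ^ 2 := by
  have h1 : ∀ p, ‖((goeBasis N p).map Complex.ofReal * X).trace‖ ^ 2 =
      ∑ i, ∑ j, ∑ k, ∑ l, goeBasis N p i j * goeBasis N p k l *
        (X j i * (starRingEnd ℂ) (X l k)).re := by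
    intro p
    have : ((‖((goeBasis N p).map Complex.ofReal * X).trace‖ ^ 2 : ℝ) : ℂ) =
      ∑ i, ∑ j, ∑ k, ∑ l, ((goeBasis N p i j * goeBasis N p k l : ℝ) : ℂ) *
        (X j i * (starRingEnd ℂ) (X l k)) := by
      rw [← Complex.normSq_eq_norm_sq, ← Complex.mul_conj]
      simp only [Matrix.trace, Matrix.diag_apply, Matrix.mul_apply, Matrix.map_apply, map_sum,
        map_mul, Complex.conj_ofReal]
      rw [Finset.sum_mul]
      refine Finset.sum_congr rfl fun i _ => ?_
      rw [Finset.sum_mul]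
      refine Finset.sum_congr rfl fun j _ => ?_
      rw [Finset.mul_sum]
      refine Finset.sum_congr rfl fun k _ => ?_
      rw [Finset.mul_sum]
      refine Finset.sum_congr rfl fun l _ => ?_
      push_cast; ring
    have := congrArg Complex.re this
    rw [Complex.ofReal_re] at this
    rw [this]
    simp only [Complex.re_sum, Complex.re_ofReal_mul]
  simp only [h1]
  have h2 : ∑ p, ∑ i, ∑ j, ∑ k, ∑ l, goeBasis N p i j * goeBasis N p k l *
        (X j i * (starRingEnd ℂ) (X l k)).re =
      ∑ i, ∑ j, 1 / N * ((X j i * (starRingEnd ℂ) (X j i)).re +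
        (X j i * (starRingEnd ℂ) (X i j)).re) := by
    rw [Finset.sum_comm]
    refine Finset.sum_congr rfl fun i _ => ?_
    rw [Finset.sum_comm]
    refine Finset.sum_congr rfl fun j _ => ?_
    rw [Finset.sum_comm]
    have : ∀ k, ∑ p, ∑ l, goeBasis N p i j * goeBasis N p k l *
        (X j i * (starRingEnd ℂ) (X l k)).re = ∑ l, (1 / N * ((if i = k ∧ j = l then 1 else 0) +
          (if i = l ∧ j = k then 1 else 0))) * (X j i * (starRingEnd ℂ) (X l k)).re := by
      intro k
      rw [Finset.sum_comm]
      refine Finset.sum_congr rfl fun l _ => ?_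
      rw [← Finset.sum_mul, sum_goeBasis_mul]
    simp only [this]
    simp only [ite_and, mul_add, add_mul, mul_ite, mul_one, mul_zero, ite_mul, zero_mul,
      Finset.sum_add_distrib]
    simp
  rw [h2]
  have h3 : ∀ i j, 1 / (N : ℝ) * ((X j i * (starRingEnd ℂ) (X j i)).re +
        (X j i * (starRingEnd ℂ) (X i j)).re) ≤
        1 / N * (‖X j i‖ ^ 2 + (‖X j i‖ ^ 2 + ‖X i j‖ ^ 2) / 2) := by
    intro i j
    refine mul_le_mul_of_nonneg_left (add_le_add ?_ ?_) (by positivity)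
    · rw [Complex.mul_conj, Complex.ofReal_re, Complex.normSq_eq_norm_sq]
    · refine (Complex.re_le_norm _).trans ?_
      rw [norm_mul, Complex.norm_conj]
      nlinarith [sq_nonneg (‖X j i‖ - ‖X i j‖)]
  refine (Finset.sum_le_sum fun i _ => Finset.sum_le_sum fun j _ => h3 i j).trans_eq ?_
  have hs : ∑ i, ∑ j, ‖X j i‖ ^ 2 = ∑ i, ∑ j, ‖X i j‖ ^ 2 := Finset.sum_comm
  simp only [← Finset.mul_sum, Finset.sum_add_distrib, ← Finset.sum_div, hs]
  ring

end GOE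

/-! ### Trace fluctuations and the approximate loop equation -/

section LoopEquation

open scoped Matrix.Norms.L2Operator

variable {N : ℕ}

/-- The normalized trace. -/
def normTrace (X : Matrix (Fin N) (Fin N) ℂ) : ℂ := 1 / N * X.trace

/-- The law of the independent entries of the Gaussian orthogonal ensemble. -/
abbrev goeLaw (N : ℕ) (v : ℝ≥0) : Measure ({p : Fin N × Fin N // p.1 ≤ p.2} → ℝ) :=
  gaussianFamily _ v

lemma norm_normTrace_le (X : Matrix (Fin N) (Fin N) ℂ) : ‖normTrace X‖ ≤ ‖X‖ := by
  rw [normTrace, norm_mul]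
  rcases N.eq_zero_or_pos with h | h
  · subst h; simp
  have h1 := norm_trace_le X
  have hN : (0 : ℝ) < N := by exact_mod_cast h
  simp only [Fintype.card_fin] at h1
  simp only [norm_div, norm_one, Complex.norm_natCast]
  rw [one_div, inv_mul_le_iff₀ hN]
  exact h1

lemma continuous_goeMatrix :
    Continuous (goeMatrix : ({p : Fin N × Fin N // p.1 ≤ p.2} → ℝ) → Matrix (Fin N) (Fin N) ℝ) := by
  unfold goeMatrix; fun_prop

lemma goeMatrix_map_ofReal (y : {p : Fin N × Fin N // p.1 ≤ p.2} → ℝ) :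
    (goeMatrix y).map Complex.ofReal = ∑ p, (y p : ℂ) • (goeBasis N p).map Complex.ofReal := by
  ext i j
  simp [goeMatrix, Matrix.sum_apply]

variable {A : Matrix (Fin N) (Fin N) ℝ}

lemma add_goeMatrix_isSymm (hA : A.IsSymm) (x : {p : Fin N × Fin N // p.1 ≤ p.2} → ℝ) :
    (A + goeMatrix x).IsSymm := by
  unfold Matrix.IsSymm
  rw [Matrix.transpose_add, hA.eq, (goeMatrix_isSymm x).eq]

lemma hasDerivAt_resolvent_goe (hA : A.IsSymm) {z : ℂ} (hz : z.im ≠ 0)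
    {x : ℝ → {p : Fin N × Fin N // p.1 ≤ p.2} → ℝ} {y : {p : Fin N × Fin N // p.1 ≤ p.2} → ℝ}
    {s : ℝ} (h : HasDerivAt x y s) :
    HasDerivAt (fun s => resolvent (A + goeMatrix (x s)) z)
      (-(resolvent (A + goeMatrix (x s)) z * (goeMatrix y).map Complex.ofReal *
        resolvent (A + goeMatrix (x s)) z)) s := by
  refine hasDerivAt_resolvent (add_goeMatrix_isSymm hA _) hz fun i j => ?_
  simp only [Matrix.add_apply, goeMatrix_apply]
  exact ((((hasDerivAt_pi.1 h) _).const_mul _).const_add _)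

lemma continuous_resolvent_goe (hA : A.IsSymm) {z : ℂ} (hz : z.im ≠ 0) :
    Continuous fun x => resolvent (A + goeMatrix x) z :=
  continuous_resolvent (add_goeMatrix_isSymm hA) hz (continuous_const.add continuous_goeMatrix)

lemma norm_resolvent_goe_le (hA : A.IsSymm) {z : ℂ} (hz : 0 < z.im)
    (x : {p : Fin N × Fin N // p.1 ≤ p.2} → ℝ) :
    ‖resolvent (A + goeMatrix x) z‖ ≤ 1 / z.im :=
  norm_resolvent_le (add_goeMatrix_isSymm hA x) hz

/-- The normalized trace of the resolvent, as a continuous linear map. -/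
def normTraceCLM (N : ℕ) : Matrix (Fin N) (Fin N) ℂ →L[ℝ] ℂ :=
  LinearMap.toContinuousLinearMap
    ((1 / (N : ℂ)) • (Matrix.traceLinearMap (Fin N) ℝ ℂ))

lemma normTraceCLM_apply (X : Matrix (Fin N) (Fin N) ℂ) : normTraceCLM N X = normTrace X := by
  simp [normTraceCLM, normTrace]

/-- The quadratic form of a matrix, as a continuous linear map. -/
def quadFormCLM (u : Fin N → ℝ) : Matrix (Fin N) (Fin N) ℂ →L[ℝ] ℂ :=
  LinearMap.toContinuousLinearMap
    { toFun := quadForm u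
      map_add' := fun X Y => by simp [quadForm, Matrix.add_mulVec, dotProduct_add]
      map_smul' := fun c X => by simp [quadForm, Matrix.smul_mulVec] }

lemma quadFormCLM_apply (u : Fin N → ℝ) (X : Matrix (Fin N) (Fin N) ℂ) :
    quadFormCLM u X = quadForm u X := rfl

/-- The variance of the normalized trace of the resolvent is of order `1 / N²`. -/
lemma integral_norm_normTrace_sub_sq_le (hA : A.IsSymm) (v : ℝ≥0) {z : ℂ} (hz : 0 < z.im) :
    ∫ x, ‖normTrace (resolvent (A + goeMatrix x) z) -
        ∫ y, normTrace (resolvent (A + goeMatrix y) z) ∂(goeLaw N v)‖ ^ 2 ∂(goeLaw N v)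
      ≤ (Real.pi / 2) ^ 2 * (v * (2 / z.im ^ 4 / N ^ 2)) := by
  rcases N.eq_zero_or_pos with h0 | h0
  · subst h0; simp [normTrace]
  have hR := continuous_resolvent_goe hA hz.ne'
  -- `D` is the gradient of the normalized trace: the direction E contributes −tr(R E R)/N, which is
  -- −tr(E R²)/N by cyclicity.
  refine integral_norm_sub_sq_gaussianFamily_le v
    (f := fun x => normTrace (resolvent (A + goeMatrix x) z))
    (D := fun x p => -(1 / N * ((goeBasis N p).map Complex.ofReal *
      (resolvent (A + goeMatrix x) z * resolvent (A + goeMatrix x) z)).trace))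
    ?_ ?_ ?_ (C := 1 / z.im) ?_ (by positivity) ?_
  · simp_rw [← normTraceCLM_apply]
    exact (normTraceCLM N).continuous.comp hR
  · refine continuous_pi fun p => Continuous.neg (continuous_const.mul ?_)
    exact (continuous_const.mul (hR.mul hR)).matrix_trace
  · intro x y s h
    have h1 := (normTraceCLM N).hasFDerivAt.comp_hasDerivAt s
      (hasDerivAt_resolvent_goe hA hz.ne' (h s))
    simp only [Function.comp_def, normTraceCLM_apply] at h1
    refine h1.congr_deriv ?_
    rw [goeMatrix_map_ofReal, normTrace, Matrix.trace_neg, Matrix.trace_mul_comm, ← mul_assoc,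
      Matrix.trace_mul_comm, Finset.sum_mul, Matrix.trace_sum, mul_neg, Finset.mul_sum,
      ← Finset.sum_neg_distrib]
    refine Finset.sum_congr rfl fun p _ => ?_
    rw [Matrix.smul_mul, Matrix.trace_smul, smul_eq_mul]
    ring
  · intro x
    exact (norm_normTrace_le _).trans (norm_resolvent_goe_le hA hz x)
  · intro x
    set R := resolvent (A + goeMatrix x) z
    have hRn : ‖R‖ ≤ 1 / z.im := norm_resolvent_goe_le hA hz x
    have h1 := sum_norm_trace_goeBasis_mul_sq_le (R * R)
    have h2 := sum_norm_sq_le (R * R)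
    have hN : (0 : ℝ) < N := by exact_mod_cast h0
    have h3 : ‖R * R‖ ^ 2 ≤ (1 / z.im * (1 / z.im)) ^ 2 :=
      pow_le_pow_left₀ (norm_nonneg _)
        ((norm_mul_le _ _).trans (mul_le_mul hRn hRn (norm_nonneg _) (by positivity))) 2
    simp only [norm_neg, norm_mul, norm_div, norm_one, Complex.norm_natCast, mul_pow,
      ← Finset.mul_sum]
    -- The factor N lost in passing from the Frobenius to the operator norm cancels against the
    -- entry variance 1/N, and the squared normalization 1/N² is left over.
    calc (1 / (N : ℝ)) ^ 2 * ∑ p, ‖((goeBasis N p).map Complex.ofReal * (R * R)).trace‖ ^ 2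
        ≤ (1 / (N : ℝ)) ^ 2 * (2 / N * (N * (1 / z.im * (1 / z.im)) ^ 2)) := by
          refine mul_le_mul_of_nonneg_left (h1.trans ?_) (by positivity)
          refine mul_le_mul_of_nonneg_left (h2.trans ?_) (by positivity)
          simp only [Fintype.card_fin]
          exact mul_le_mul_of_nonneg_left h3 hN.le
      _ = 2 / z.im ^ 4 / N ^ 2 := by field_simp

/-- Jensen's inequality for the square, used for the trace fluctuations and again for the uniform
bound on Stieltjes transforms. -/
lemma integral_norm_le_sqrt {Ω : Type*} [MeasurableSpace Ω] {P : Measure Ω}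
    [IsProbabilityMeasure P] {f : Ω → ℂ} (hf : AEStronglyMeasurable f P) {C : ℝ}
    (hC : ∀ x, ‖f x‖ ≤ C) : (∫ x, ‖f x‖ ∂P) ^ 2 ≤ ∫ x, ‖f x‖ ^ 2 ∂P := by
  refine ConvexOn.map_integral_le (μ := P) (f := fun x => ‖f x‖) (g := fun r : ℝ => r ^ 2)
    (s := Set.univ) (Even.convexOn_pow (by decide)) (by fun_prop) isClosed_univ
    (ae_of_all _ fun _ => Set.mem_univ _) (Integrable.of_bound hf.norm C (ae_of_all _ fun x => ?_))
    (Integrable.of_bound (hf.norm.pow 2) (C ^ 2) (ae_of_all _ fun x => ?_))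
  · simpa using hC x
  · simpa using pow_le_pow_left₀ (norm_nonneg _) (hC x) 2

/-- The error constant in the loop equation. -/
def loopConst (v : ℝ≥0) (η : ℝ) : ℝ :=
  v * (1 / η ^ 2) + v * (Real.pi / 2 * √(v * (2 / η ^ 4)) * (1 / η))

/-- The approximate loop equation for the diagonal entries of the mean resolvent in an
eigenbasis of the deterministic part. -/
lemma norm_loop_le (hA : A.IsSymm) {v : ℝ≥0} (hv : v ≠ 0) {z : ℂ} (hz : 0 < z.im)
    {u : Fin N → ℝ} {α : ℝ} (hu : ∑ i, u i ^ 2 = 1) (hAu : A *ᵥ u = α • u) :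
    ‖((α : ℂ) - z - v * ∫ y, normTrace (resolvent (A + goeMatrix y) z) ∂(goeLaw N v)) *
        (∫ x, quadForm u (resolvent (A + goeMatrix x) z) ∂(goeLaw N v)) - 1‖
      ≤ loopConst v z.im / N := by
  classical
  have h0 : 0 < N := by
    rcases N.eq_zero_or_pos with h | h
    · subst h; simp at hu
    · exact h
  have hN : (0 : ℝ) < N := by exact_mod_cast h0
  set γ := goeLaw N v
  set R := fun x => resolvent (A + goeMatrix x) z with hRdef
  have hR : Continuous R := continuous_resolvent_goe hA hz.ne'
  have hRn : ∀ x, ‖R x‖ ≤ 1 / z.im := norm_resolvent_goe_le hA hz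
  have hη : 0 ≤ 1 / z.im := by positivity
  have hq : ∀ X, ‖quadForm u X‖ ≤ ‖X‖ := fun X => by
    simpa [hu] using norm_quadForm_le u X
  have hqc : Continuous (quadForm u) := (quadFormCLM u).continuous
  have hmc : Continuous (normTrace (N := N)) := by
    have h : normTrace (N := N) = normTraceCLM N := funext fun X => (normTraceCLM_apply X).symm
    rw [h]; exact (normTraceCLM N).continuous
  set E := fun p => (goeBasis N p).map Complex.ofReal
  -- integrability
  have bI : ∀ {f : ({p : Fin N × Fin N // p.1 ≤ p.2} → ℝ) → ℂ} (C : ℝ), Continuous f →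
      (∀ x, ‖f x‖ ≤ C) → Integrable f γ := fun C hf hC =>
    .of_bound hf.aestronglyMeasurable C (ae_of_all _ hC)
  have iq : Integrable (fun x => quadForm u (R x)) γ :=
    bI _ (hqc.comp hR) fun x => (hq _).trans (hRn x)
  have im : Integrable (fun x => normTrace (R x)) γ :=
    bI _ (hmc.comp hR) fun x => (norm_normTrace_le _).trans (hRn x)
  have iqq : Integrable (fun x => quadForm u (R x * R x)) γ :=
    bI _ (hqc.comp (hR.mul hR)) fun x => (hq _).trans ((norm_mul_le _ _).trans
      (mul_le_mul (hRn x) (hRn x) (norm_nonneg _) hη))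
  have imq : Integrable (fun x => normTrace (R x) * quadForm u (R x)) γ :=
    bI (1 / z.im * (1 / z.im)) ((hmc.comp hR).mul (hqc.comp hR)) fun x => by
      rw [norm_mul]
      exact mul_le_mul ((norm_normTrace_le _).trans (hRn x)) ((hq _).trans (hRn x))
        (norm_nonneg _) hη
  have ixp : ∀ p, Integrable (fun x => (x p : ℂ) * quadForm u (E p * R x)) γ := fun p =>
    (integrable_eval_gaussianFamily v p).mul_bdd (c := ‖E p‖ * (1 / z.im))
      (hqc.comp (continuous_const.mul hR)).aestronglyMeasurable (ae_of_all _ fun x =>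
        (hq _).trans ((norm_mul_le _ _).trans (mul_le_mul_of_nonneg_left (hRn x) (norm_nonneg _))))
  -- Gaussian integration by parts
  have stein : ∀ p, ∫ x, (x p : ℂ) * quadForm u (E p * R x) ∂γ =
      v * ∫ x, -quadForm u (E p * R x * E p * R x) ∂γ := by
    intro p
    refine integral_eval_mul_gaussianFamily hv p (C := ‖E p‖ * (1 / z.im))
      (C' := ‖E p‖ * (1 / z.im) * ‖E p‖ * (1 / z.im))
      (hqc.comp (continuous_const.mul hR)).measurable
      (hqc.comp ((((continuous_const.mul hR).mul continuous_const).mul hR))).neg.measurable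
      ?_ ?_ ?_
    · intro x s
      have hup : HasDerivAt (fun s => Function.update x p s) (Pi.single p (1 : ℝ)) s :=
        hasDerivAt_update x p s
      have h1 := (quadFormCLM u).hasFDerivAt.comp_hasDerivAt s
        ((hasDerivAt_resolvent_goe hA hz.ne' hup).const_mul (E p))
      simp only [Function.comp_def, quadFormCLM_apply] at h1
      refine h1.congr_deriv ?_
      have : (goeMatrix (Pi.single p (1 : ℝ))).map Complex.ofReal = E p := by
        rw [goeMatrix_map_ofReal]
        rw [Finset.sum_eq_single p]
        · simp [E]
        · intro q _ hq
          simp [hq]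
        · simp
      rw [this, ← quadFormCLM_apply, ← quadFormCLM_apply, mul_neg, map_neg]
      simp only [hRdef, mul_assoc]
    · intro x
      exact (hq _).trans ((norm_mul_le _ _).trans
        (mul_le_mul_of_nonneg_left (hRn x) (norm_nonneg _)))
    · intro x
      rw [norm_neg]
      refine (hq _).trans ?_
      have h1 : ‖E p * R x‖ ≤ ‖E p‖ * (1 / z.im) := (norm_mul_le _ _).trans
        (mul_le_mul_of_nonneg_left (hRn x) (norm_nonneg _))
      have h2 : ‖E p * R x * E p‖ ≤ ‖E p‖ * (1 / z.im) * ‖E p‖ := (norm_mul_le _ _).trans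
        (mul_le_mul_of_nonneg_right h1 (norm_nonneg _))
      exact (norm_mul_le _ _).trans (mul_le_mul h2 (hRn x) (norm_nonneg _) (by positivity))
  have isum : ∀ p, Integrable (fun x => -quadForm u (E p * R x * E p * R x)) γ := by
    intro p
    refine bI (‖E p‖ * (1 / z.im) * ‖E p‖ * (1 / z.im))
      (hqc.comp ((((continuous_const.mul hR).mul continuous_const).mul hR))).neg fun x => ?_
    rw [norm_neg]
    refine (hq _).trans ?_
    have h1 : ‖E p * R x‖ ≤ ‖E p‖ * (1 / z.im) := (norm_mul_le _ _).trans
      (mul_le_mul_of_nonneg_left (hRn x) (norm_nonneg _))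
    have h2 : ‖E p * R x * E p‖ ≤ ‖E p‖ * (1 / z.im) * ‖E p‖ := (norm_mul_le _ _).trans
      (mul_le_mul_of_nonneg_right h1 (norm_nonneg _))
    exact (norm_mul_le _ _).trans (mul_le_mul h2 (hRn x) (norm_nonneg _) (by positivity))
  -- The resolvent is symmetric, so the transposed term of the contraction becomes R²/N, while the
  -- trace term keeps its full size.
  have contr : ∀ x, ∑ p, -quadForm u (E p * R x * E p * R x) =
      -(1 / N * quadForm u (R x * R x) + normTrace (R x) * quadForm u (R x)) := by
    intro x
    have e1 : ∑ p, E p * R x * E p * R x = (1 / N : ℂ) • (R x * R x) + normTrace (R x) • R x := by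
      rw [← Finset.sum_mul, sum_goeBasis_mul_mul,
        resolvent_transpose (add_goeMatrix_isSymm hA x)]
      simp only [Matrix.smul_mul, add_mul, one_mul, smul_add, smul_smul, normTrace, hRdef]
    have qs : ∀ (c : ℂ) X, quadForm u (c • X) = c * quadForm u X := fun c X => by
      simp [quadForm, Matrix.smul_mulVec]
    rw [Finset.sum_neg_distrib, ← qs, ← qs]
    simp only [← quadFormCLM_apply]
    rw [← map_add, ← e1, map_sum]
  -- the pointwise resolvent identity
  have ptw : ∀ x, ((α : ℂ) - z) * quadForm u (R x) + ∑ p, (x p : ℂ) * quadForm u (E p * R x)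
      = 1 := by
    intro x
    have h1 : ((A + goeMatrix x).map Complex.ofReal - z • (1 : Matrix (Fin N) (Fin N) ℂ)) * R x = 1 :=
      sub_mul_resolvent (add_goeMatrix_isSymm hA x) hz.ne'
    have h2 : (A + goeMatrix x).map Complex.ofReal =
        A.map Complex.ofReal + ∑ p, (x p : ℂ) • E p := by
      rw [← goeMatrix_map_ofReal]
      ext i j; simp
    have h3 : quadForm u (A.map Complex.ofReal * R x) = α * quadForm u (R x) := by
      have hv : (fun i => (u i : ℂ)) ᵥ* A.map Complex.ofReal = (α : ℂ) • fun i => (u i : ℂ) := by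
        rw [← Matrix.mulVec_transpose, ← Matrix.transpose_map, hA.eq]
        ext i
        have := congrArg (fun r : ℝ => (r : ℂ)) (congrFun hAu i)
        simpa [Matrix.mulVec, dotProduct] using this
      unfold quadForm
      rw [← Matrix.mulVec_mulVec, Matrix.dotProduct_mulVec, hv, smul_dotProduct, smul_eq_mul]
    have h4 : quadForm u 1 = 1 := by
      have := congrArg (fun r : ℝ => (r : ℂ)) hu
      simpa [quadForm, dotProduct, sq] using this
    have qs : ∀ (c : ℂ) X, quadForm u (c • X) = c * quadForm u X := fun c X => by
      simp [quadForm, Matrix.smul_mulVec]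
    have h5 := congrArg (quadFormCLM u) h1
    rw [h2, sub_mul, add_mul, map_sub, map_add, Finset.sum_mul, map_sum] at h5
    simp only [quadFormCLM_apply, h3, h4, Matrix.smul_mul, one_mul, qs] at h5
    linear_combination h5
  have main : ((α : ℂ) - z) * (∫ x, quadForm u (R x) ∂γ) -
      v * (1 / N * (∫ x, quadForm u (R x * R x) ∂γ)
        + ∫ x, normTrace (R x) * quadForm u (R x) ∂γ) = 1 := by
    have h1 : ∫ x, (((α : ℂ) - z) * quadForm u (R x) +
        ∑ p, (x p : ℂ) * quadForm u (E p * R x)) ∂γ = 1 := by simp [ptw]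
    rw [integral_add (iq.const_mul _) (integrable_finsetSum _ fun p _ => ixp p),
      integral_const_mul, integral_finsetSum _ fun p _ => ixp p] at h1
    simp only [stein] at h1
    rw [← Finset.mul_sum, ← integral_finsetSum _ fun p _ => isum p] at h1
    simp only [contr] at h1
    rw [integral_neg, integral_add (iqq.const_mul _) imq, integral_const_mul] at h1
    linear_combination h1
  set mbar := ∫ y, normTrace (R y) ∂γ with hmbar
  have hmbar_le : ‖mbar‖ ≤ 1 / z.im := by
    refine (norm_integral_le_of_norm_le_const (C := 1 / z.im) (ae_of_all _ fun x =>
      (norm_normTrace_le _).trans (hRn x))).trans (by simp)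
  -- Replacing the random trace by its mean leaves two errors: the R²/N term and a covariance. The
  -- covariance is at most the mean fluctuation of the trace, of order 1/N, times the bound 1 / Im z
  -- on the quadratic form.
  have err : ((α : ℂ) - z - v * mbar) * (∫ x, quadForm u (R x) ∂γ) - 1 =
      v * (1 / N * (∫ x, quadForm u (R x * R x) ∂γ)) +
        v * ∫ x, (normTrace (R x) - mbar) * quadForm u (R x) ∂γ := by
    have : ∫ x, (normTrace (R x) - mbar) * quadForm u (R x) ∂γ =
        (∫ x, normTrace (R x) * quadForm u (R x) ∂γ) - mbar * ∫ x, quadForm u (R x) ∂γ := by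
      rw [← integral_const_mul, ← integral_sub imq (iq.const_mul _)]
      congr 1; ext x; ring
    rw [this]; linear_combination main
  have b1 : ‖∫ x, quadForm u (R x * R x) ∂γ‖ ≤ 1 / z.im ^ 2 := by
    refine (norm_integral_le_of_norm_le_const (C := 1 / z.im ^ 2) (ae_of_all _ fun x => ?_)).trans
      (by simp)
    refine (hq _).trans ((norm_mul_le _ _).trans
      ((mul_le_mul (hRn x) (hRn x) (norm_nonneg _) hη).trans_eq ?_))
    field_simp
  have b2 : ∫ x, ‖normTrace (R x) - mbar‖ ∂γ ≤ Real.pi / 2 * √(v * (2 / z.im ^ 4)) / N := by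
    have hv2 := integral_norm_normTrace_sub_sq_le hA v hz
    have hcs := integral_norm_le_sqrt (P := γ) (f := fun x => normTrace (R x) - mbar)
      ((hmc.comp hR).sub continuous_const).aestronglyMeasurable (C := 1 / z.im + 1 / z.im)
      fun x => (norm_sub_le _ _).trans (add_le_add ((norm_normTrace_le _).trans (hRn x)) hmbar_le)
    refine le_of_abs_le (abs_le_of_sq_le_sq ((hcs.trans hv2).trans_eq ?_) (by positivity))
    rw [div_pow _ (N : ℝ), mul_pow _ (√_), Real.sq_sqrt (by positivity)]
    field_simp
  have b3 : ‖∫ x, (normTrace (R x) - mbar) * quadForm u (R x) ∂γ‖ ≤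
      Real.pi / 2 * √(v * (2 / z.im ^ 4)) / N * (1 / z.im) := by
    refine (norm_integral_le_integral_norm _).trans ?_
    refine le_trans ?_ (mul_le_mul_of_nonneg_right b2 hη)
    rw [← integral_mul_const]
    refine integral_mono_of_nonneg (ae_of_all _ fun x => norm_nonneg _)
      ((im.sub (integrable_const _)).norm.mul_const _) (ae_of_all _ fun x => ?_)
    simp only [norm_mul]
    exact mul_le_mul_of_nonneg_left ((hq _).trans (hRn x)) (norm_nonneg _)
  rw [err]
  refine (norm_add_le _ _).trans ?_
  have hvn : ‖((v : ℝ) : ℂ)‖ = v := by simp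
  rw [norm_mul, norm_mul, norm_mul]
  have hvn' : ‖(v : ℂ)‖ = v := hvn
  rw [hvn']
  have hNn : ‖(1 / N : ℂ)‖ = 1 / N := by simp
  rw [hNn, loopConst, add_div]
  refine add_le_add ?_ ?_
  · calc (v : ℝ) * (1 / N * ‖∫ x, quadForm u (R x * R x) ∂γ‖) ≤ v * (1 / N * (1 / z.im ^ 2)) := by
          gcongr
      _ = _ := by ring
  · calc (v : ℝ) * ‖∫ x, (normTrace (R x) - mbar) * quadForm u (R x) ∂γ‖
        ≤ v * (Real.pi / 2 * √(v * (2 / z.im ^ 4)) / N * (1 / z.im)) := by gcongr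
      _ = _ := by ring

end LoopEquation

/-! ### Stieltjes transforms of finite measures -/

section Stieltjes

/-- The Stieltjes transform `∫ (x - w)⁻¹ dμ(x)` of a measure on the line. -/
def stieltjes (μ : Measure ℝ) (w : ℂ) : ℂ := ∫ x, ((x : ℂ) - w)⁻¹ ∂μ

lemma im_le_norm_ofReal_sub (x : ℝ) (w : ℂ) : w.im ≤ ‖(x : ℂ) - w‖ := by
  have := Complex.abs_im_le_norm ((x : ℂ) - w)
  simp only [Complex.sub_im, Complex.ofReal_im, zero_sub, abs_neg] at this
  exact (le_abs_self _).trans this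

lemma ofReal_sub_ne_zero (x : ℝ) {w : ℂ} (hw : 0 < w.im) : (x : ℂ) - w ≠ 0 :=
  norm_pos_iff.1 (hw.trans_le (im_le_norm_ofReal_sub x w))

lemma norm_inv_ofReal_sub_le (x : ℝ) {w : ℂ} (hw : 0 < w.im) : ‖((x : ℂ) - w)⁻¹‖ ≤ 1 / w.im := by
  rw [norm_inv, ← one_div]
  exact one_div_le_one_div_of_le hw (im_le_norm_ofReal_sub x w)

lemma im_inv_ofReal_sub (x : ℝ) (w : ℂ) : ((x : ℂ) - w)⁻¹.im = w.im * ‖((x : ℂ) - w)⁻¹‖ ^ 2 := by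
  rw [Complex.inv_im, norm_inv, inv_pow, ← Complex.normSq_eq_norm_sq]
  simp [div_eq_mul_inv]

lemma measurable_inv_ofReal_sub (w : ℂ) : Measurable fun x : ℝ => ((x : ℂ) - w)⁻¹ :=
  (Complex.measurable_ofReal.sub_const w).inv

variable {μ : Measure ℝ} [IsFiniteMeasure μ]

lemma integrable_inv_ofReal_sub {w : ℂ} (hw : 0 < w.im) :
    Integrable (fun x : ℝ => ((x : ℂ) - w)⁻¹) μ :=
  .of_bound (measurable_inv_ofReal_sub w).aestronglyMeasurable (1 / w.im)
    (ae_of_all _ fun x => norm_inv_ofReal_sub_le x hw)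

lemma integrable_norm_inv_ofReal_sub_sq {w : ℂ} (hw : 0 < w.im) :
    Integrable (fun x : ℝ => ‖((x : ℂ) - w)⁻¹‖ ^ 2) μ :=
  .of_bound ((measurable_inv_ofReal_sub w).norm.pow_const 2).aestronglyMeasurable ((1 / w.im) ^ 2)
    (ae_of_all _ fun x => by
      rw [Real.norm_of_nonneg (by positivity)]
      exact pow_le_pow_left₀ (norm_nonneg _) (norm_inv_ofReal_sub_le x hw) 2)

lemma im_stieltjes {w : ℂ} (hw : 0 < w.im) :
    (stieltjes μ w).im = w.im * ∫ x, ‖((x : ℂ) - w)⁻¹‖ ^ 2 ∂μ := by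
  rw [← integral_const_mul]
  simp only [← im_inv_ofReal_sub]
  exact (integral_im (integrable_inv_ofReal_sub hw)).symm

lemma im_stieltjes_nonneg {w : ℂ} (hw : 0 < w.im) : 0 ≤ (stieltjes μ w).im := by
  rw [im_stieltjes hw]
  exact mul_nonneg hw.le (integral_nonneg fun x => by positivity)

lemma norm_stieltjes_le {w : ℂ} (hw : 0 < w.im) : ‖stieltjes μ w‖ ≤ μ.real Set.univ / w.im := by
  refine (norm_integral_le_of_norm_le_const (ae_of_all _ fun x =>
    norm_inv_ofReal_sub_le x hw)).trans_eq ?_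
  ring

/-- The imaginary part of (x − w)⁻¹ is positive, so it is monotone in the measure after integration.
Later this lets m dominate the transforms of the truncated allocation laws. -/
lemma im_stieltjes_mono {ν : Measure ℝ} (h : ν ≤ μ) {w : ℂ} (hw : 0 < w.im) :
    (stieltjes ν w).im ≤ (stieltjes μ w).im := by
  have : IsFiniteMeasure ν := isFiniteMeasure_of_le μ h
  rw [im_stieltjes hw, im_stieltjes hw]
  exact mul_le_mul_of_nonneg_left (integral_mono_measure h (ae_of_all _ fun x => by positivity)
    (integrable_norm_inv_ofReal_sub_sq hw)) hw.le

lemma inv_ofReal_sub_sub (x : ℝ) {w w' : ℂ} (hw : 0 < w.im) (hw' : 0 < w'.im) :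
    ((x : ℂ) - w)⁻¹ - ((x : ℂ) - w')⁻¹ = (w - w') * (((x : ℂ) - w)⁻¹ * ((x : ℂ) - w')⁻¹) := by
  have h1 := ofReal_sub_ne_zero x hw
  have h2 := ofReal_sub_ne_zero x hw'
  field_simp
  ring

lemma integrable_inv_mul_inv {w w' : ℂ} (hw : 0 < w.im) (hw' : 0 < w'.im) :
    Integrable (fun x : ℝ => ((x : ℂ) - w)⁻¹ * ((x : ℂ) - w')⁻¹) μ :=
  (integrable_inv_ofReal_sub hw).mul_bdd (c := 1 / w'.im)
    (measurable_inv_ofReal_sub w').aestronglyMeasurable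
    (ae_of_all _ fun x => norm_inv_ofReal_sub_le x hw')

/-- The resolvent identity under the integral; both the Lipschitz bound and the injectivity estimate
`norm_sub_cube_le` start from it. -/
lemma stieltjes_sub {w w' : ℂ} (hw : 0 < w.im) (hw' : 0 < w'.im) :
    stieltjes μ w - stieltjes μ w' =
      (w - w') * ∫ x, ((x : ℂ) - w)⁻¹ * ((x : ℂ) - w')⁻¹ ∂μ := by
  rw [stieltjes, stieltjes, ← integral_sub (integrable_inv_ofReal_sub hw)
    (integrable_inv_ofReal_sub hw'), ← integral_const_mul]
  simp only [inv_ofReal_sub_sub _ hw hw']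

lemma norm_stieltjes_sub_le {w w' : ℂ} (hw : 0 < w.im) (hw' : 0 < w'.im) :
    ‖stieltjes μ w - stieltjes μ w'‖ ≤ ‖w - w'‖ * (μ.real Set.univ / (w.im * w'.im)) := by
  rw [stieltjes_sub hw hw', norm_mul]
  refine mul_le_mul_of_nonneg_left ?_ (norm_nonneg _)
  refine (norm_integral_le_of_norm_le_const (C := 1 / w.im * (1 / w'.im))
    (ae_of_all _ fun x => ?_)).trans_eq (by field_simp)
  rw [norm_mul]
  exact mul_le_mul (norm_inv_ofReal_sub_le x hw) (norm_inv_ofReal_sub_le x hw') (norm_nonneg _)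
    (by positivity)

lemma continuousAt_stieltjes {w : ℂ} (hw : 0 < w.im) : ContinuousAt (stieltjes μ) w := by
  rw [ContinuousAt, tendsto_iff_norm_sub_tendsto_zero]
  have h1 : Tendsto (fun w' : ℂ => ‖w' - w‖ * (μ.real Set.univ / (w'.im * w.im))) (𝓝 w)
      (𝓝 (‖w - w‖ * (μ.real Set.univ / (w.im * w.im)))) := by
    refine Tendsto.mul (((continuous_id.sub continuous_const).norm).tendsto w) (Tendsto.div tendsto_const_nhds ?_ (by positivity))
    exact (Complex.continuous_im.tendsto w).mul tendsto_const_nhds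
  rw [sub_self, norm_zero, zero_mul] at h1
  refine squeeze_zero' (.of_forall fun _ => norm_nonneg _) ?_ h1
  filter_upwards [(Complex.continuous_im.tendsto w).eventually (lt_mem_nhds hw)] with w' hw'
  exact norm_stieltjes_sub_le hw' hw

end Stieltjes

/-! ### The fixed point equation and its boundary regularity -/

section Subordination

variable {μ : Measure ℝ} {t : ℝ} {m : ℂ → ℂ}

/-- The function `m` solves `m(z) = g(z + t m(z))` on the upper half-plane. -/
def IsSubordinated (μ : Measure ℝ) (t : ℝ) (m : ℂ → ℂ) : Prop :=
  ∀ z : ℂ, 0 < z.im → 0 ≤ (m z).im ∧ m z = stieltjes μ (z + t * m z)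

lemma IsSubordinated.im_pos (hm : IsSubordinated μ t m) (ht : 0 < t) {z : ℂ} (hz : 0 < z.im) :
    z.im ≤ (z + t * m z).im ∧ 0 < (z + t * m z).im := by
  have h : z.im ≤ (z + t * m z).im := by
    simp only [Complex.add_im, Complex.im_ofReal_mul]
    nlinarith [(hm z hz).1]
  exact ⟨h, hz.trans_le h⟩

/-- The subordinated point is a preimage of z under w ↦ w − t g(w), so regularity of m reduces to
quantitative injectivity of this map. -/
lemma IsSubordinated.sub_eq (hm : IsSubordinated μ t m) {z : ℂ} (hz : 0 < z.im) :
    (z + t * m z) - t * stieltjes μ (z + t * m z) = z := by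
  rw [← (hm z hz).2]; ring

variable [IsProbabilityMeasure μ]

/-- The imaginary part of w − t g(w) is Im w times 1 − t ∫ |x − w|⁻² dμ, and the factor Im w can be
divided out without loss near the real axis. -/
lemma mul_integral_norm_inv_sq_le_one {w : ℂ} (hw : 0 < w.im)
    (h : 0 ≤ (w - t * stieltjes μ w).im) : t * ∫ x, ‖((x : ℂ) - w)⁻¹‖ ^ 2 ∂μ ≤ 1 := by
  rw [Complex.sub_im, Complex.im_ofReal_mul, im_stieltjes hw] at h
  have : 0 ≤ w.im * (1 - t * ∫ x, ‖((x : ℂ) - w)⁻¹‖ ^ 2 ∂μ) := by linarith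
  linarith [nonneg_of_mul_nonneg_right this hw]

/-- Jensen's inequality turns the preceding second moment bound into one for the transform itself.
It does not involve Im w, which keeps m bounded up to the real axis. -/
lemma norm_stieltjes_sq_le (ht : 0 < t) {w : ℂ} (hw : 0 < w.im)
    (h : 0 ≤ (w - t * stieltjes μ w).im) : ‖stieltjes μ w‖ ^ 2 ≤ 1 / t := by
  have h1 := mul_integral_norm_inv_sq_le_one hw h
  have h2 := integral_norm_le_sqrt (P := μ) (f := fun x : ℝ => ((x : ℂ) - w)⁻¹)
    (measurable_inv_ofReal_sub w).aestronglyMeasurable (fun x => norm_inv_ofReal_sub_le x hw)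
  have h3 : ‖stieltjes μ w‖ ≤ ∫ x, ‖((x : ℂ) - w)⁻¹‖ ∂μ := norm_integral_le_integral_norm _
  have h4 := pow_le_pow_left₀ (norm_nonneg _) h3 2
  rw [le_div_iff₀ ht]
  nlinarith

/-- Quantitative injectivity of `w ↦ w - t g(w)` where it takes values in the upper half-plane. -/
lemma norm_sub_cube_le (ht : 0 < t) {K R : ℝ} (hK : ∀ᵐ x ∂μ, |x| ≤ K) {w w' : ℂ} (hw : 0 < w.im)
    (hw' : 0 < w'.im) (h : 0 ≤ (w - t * stieltjes μ w).im)
    (h' : 0 ≤ (w' - t * stieltjes μ w').im) (hR : ‖w‖ ≤ R) (hR' : ‖w'‖ ≤ R) :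
    ‖w - w'‖ ^ 3 ≤ 2 * (K + R) ^ 4 / t *
      ‖(w - t * stieltjes μ w) - (w' - t * stieltjes μ w')‖ := by
  have hRpos : 0 < R := (hw.trans_le ((le_abs_self _).trans (Complex.abs_im_le_norm w))).trans_le hR
  have hKnn : 0 ≤ K := by
    obtain ⟨x, hx⟩ := hK.exists
    exact (abs_nonneg x).trans hx
  have hKR : 0 < K + R := by linarith
  set I := ∫ x, ((x : ℂ) - w)⁻¹ * ((x : ℂ) - w')⁻¹ ∂μ with hI
  -- It remains to bound |1 − t I| from below by a multiple of |w − w'|².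
  have e : (w - t * stieltjes μ w) - (w' - t * stieltjes μ w') = (w - w') * (1 - t * I) := by
    have := stieltjes_sub (μ := μ) hw hw'
    linear_combination (-(t : ℂ)) * this
  -- From |p − q̄|² = |p|² + |q|² − 2 Re(pq), the real part of pq lies below the mean of the squares
  -- by |p − q̄|²/2, and |p − q̄| is at least |w − w'| / (K + R)².
  have ptw : ∀ᵐ x : ℝ ∂μ, (((x : ℂ) - w)⁻¹ * ((x : ℂ) - w')⁻¹).re ≤
      (‖((x : ℂ) - w)⁻¹‖ ^ 2 + ‖((x : ℂ) - w')⁻¹‖ ^ 2) / 2 - ‖w - w'‖ ^ 2 / (2 * (K + R) ^ 4) := by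
    filter_upwards [hK] with x hx
    set p := ((x : ℂ) - w)⁻¹ with hp
    set q := ((x : ℂ) - w')⁻¹ with hq
    have hpn : 1 / (K + R) ≤ ‖p‖ := by
      rw [hp, norm_inv, ← one_div]
      refine one_div_le_one_div_of_le (norm_pos_iff.2 (ofReal_sub_ne_zero x hw)) ?_
      exact (norm_sub_le _ _).trans (add_le_add (by simpa using hx) hR)
    have hqn : 1 / (K + R) ≤ ‖q‖ := by
      rw [hq, norm_inv, ← one_div]
      refine one_div_le_one_div_of_le (norm_pos_iff.2 (ofReal_sub_ne_zero x hw')) ?_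
      exact (norm_sub_le _ _).trans (add_le_add (by simpa using hx) hR')
    have h1 : ‖p - star q‖ ^ 2 = ‖p‖ ^ 2 + ‖q‖ ^ 2 - 2 * (p * q).re := by
      rw [← Complex.normSq_eq_norm_sq, ← Complex.normSq_eq_norm_sq, ← Complex.normSq_eq_norm_sq,
        Complex.normSq_apply, Complex.normSq_apply, Complex.normSq_apply]
      simp
      ring
    have h2 : p - star q = (w - star w') * (p * star q) := by
      have a1 := ofReal_sub_ne_zero x hw
      have a2 : (x : ℂ) - star w' ≠ 0 := by
        have := ofReal_sub_ne_zero x hw'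
        intro h0
        apply this
        have := congrArg star h0
        simpa using this
      have : star q = ((x : ℂ) - star w')⁻¹ := by simp [hq]
      rw [this, hp]
      field_simp
      ring
    -- Both points lie in the upper half-plane, so reflecting one of them in the real axis moves it
    -- farther from the other.
    have h3 : ‖w - w'‖ ≤ ‖w - star w'‖ := by
      refine le_of_abs_le (abs_le_of_sq_le_sq ?_ (norm_nonneg _))
      rw [← Complex.normSq_eq_norm_sq, ← Complex.normSq_eq_norm_sq, Complex.normSq_apply,
        Complex.normSq_apply]
      simp
      nlinarith [mul_pos hw hw']
    have h4 : ‖w - w'‖ * (1 / (K + R) * (1 / (K + R))) ≤ ‖p - star q‖ := by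
      rw [h2, norm_mul, norm_mul, norm_star]
      exact mul_le_mul h3 (mul_le_mul hpn hqn (by positivity) (norm_nonneg _)) (by positivity)
        (norm_nonneg _)
    have h5 := pow_le_pow_left₀ (by positivity) h4 2
    rw [h1] at h5
    have h6 : (‖w - w'‖ * (1 / (K + R) * (1 / (K + R)))) ^ 2 = 2 * (‖w - w'‖ ^ 2 / (2 * (K + R) ^ 4)) := by
      field_simp
    rw [h6] at h5
    linarith
  have i1 := integrable_norm_inv_ofReal_sub_sq (μ := μ) hw
  have i2 := integrable_norm_inv_ofReal_sub_sq (μ := μ) hw'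
  have i3 : Integrable (fun x : ℝ => (‖((x : ℂ) - w)⁻¹‖ ^ 2 + ‖((x : ℂ) - w')⁻¹‖ ^ 2) / 2) μ :=
    (i1.add i2).div_const 2
  have hint := integral_mono_ae (integrable_inv_mul_inv (μ := μ) hw hw').re
    (i3.sub (integrable_const (‖w - w'‖ ^ 2 / (2 * (K + R) ^ 4)))) ptw
  have hre : ∫ x, (((x : ℂ) - w)⁻¹ * ((x : ℂ) - w')⁻¹).re ∂μ = I.re :=
    integral_re (integrable_inv_mul_inv (μ := μ) hw hw')
  have hrhs : ∫ x, ((‖((x : ℂ) - w)⁻¹‖ ^ 2 + ‖((x : ℂ) - w')⁻¹‖ ^ 2) / 2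
      - ‖w - w'‖ ^ 2 / (2 * (K + R) ^ 4)) ∂μ = ((∫ x, ‖((x : ℂ) - w)⁻¹‖ ^ 2 ∂μ) +
        ∫ x, ‖((x : ℂ) - w')⁻¹‖ ^ 2 ∂μ) / 2 - ‖w - w'‖ ^ 2 / (2 * (K + R) ^ 4) := by
    rw [integral_sub i3 (integrable_const _), integral_div,
      integral_add i1 i2]
    simp
  have hle : I.re ≤ ((∫ x, ‖((x : ℂ) - w)⁻¹‖ ^ 2 ∂μ) +
        ∫ x, ‖((x : ℂ) - w')⁻¹‖ ^ 2 ∂μ) / 2 - ‖w - w'‖ ^ 2 / (2 * (K + R) ^ 4) := by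
    rw [← hre, ← hrhs]; exact hint
  have b1 := mul_integral_norm_inv_sq_le_one hw h
  have b2 := mul_integral_norm_inv_sq_le_one hw' h'
  -- Each second moment is at most 1/t, so t Re I is at most 1 minus t times the gap.
  have h7 : t * (‖w - w'‖ ^ 2 / (2 * (K + R) ^ 4)) ≤ ‖1 - t * I‖ := by
    have h8 : (1 - t * I).re ≤ ‖1 - t * I‖ := Complex.re_le_norm _
    rw [Complex.sub_re, Complex.re_ofReal_mul, Complex.one_re] at h8
    have := mul_le_mul_of_nonneg_left hle ht.le
    linarith
  rw [e, norm_mul]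
  have h9 := mul_le_mul_of_nonneg_left h7 (norm_nonneg (w - w'))
  calc ‖w - w'‖ ^ 3 = 2 * (K + R) ^ 4 / t *
        (‖w - w'‖ * (t * (‖w - w'‖ ^ 2 / (2 * (K + R) ^ 4)))) := by field_simp
    _ ≤ _ := mul_le_mul_of_nonneg_left h9 (by positivity)

/-- Approximate solutions of the fixed point equation converge to a solution. -/
lemma exists_tendsto_of_approx (ht : 0 < t) {K : ℝ} (hK : ∀ᵐ x ∂μ, |x| ≤ K) {z : ℂ}
    (hz : 0 < z.im) {u : ℕ → ℂ} (hu : ∀ n, 0 ≤ (u n).im)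
    (h : Tendsto (fun n => u n - stieltjes μ (z + t * u n)) atTop (𝓝 0)) :
    ∃ m : ℂ, Tendsto u atTop (𝓝 m) ∧ 0 ≤ m.im ∧ m = stieltjes μ (z + t * m) := by
  set w := fun n => z + t * u n with hw
  have hwim : ∀ n, z.im ≤ (w n).im := fun n => by
    simp only [hw, Complex.add_im, Complex.im_ofReal_mul]
    nlinarith [hu n]
  have hwpos : ∀ n, 0 < (w n).im := fun n => hz.trans_le (hwim n)
  -- The images of the points w n converge to z, and the injectivity estimate then makes the points
  -- themselves a Cauchy sequence; no compactness or separate uniqueness argument is needed.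
  have hF : ∀ n, w n - t * stieltjes μ (w n) = z + t * (u n - stieltjes μ (w n)) := fun n => by
    simp only [hw]; ring
  have hFt : Tendsto (fun n => w n - t * stieltjes μ (w n)) atTop (𝓝 z) := by
    simp only [hF]
    simpa using (h.const_mul (t : ℂ)).const_add z
  have hev : ∀ᶠ n in atTop, 0 ≤ (w n - t * stieltjes μ (w n)).im := by
    filter_upwards [((Complex.continuous_im.tendsto z).comp hFt).eventually (lt_mem_nhds hz)]
      with n hn using le_of_lt hn
  have hbd : ∀ᶠ n in atTop, ‖w n‖ ≤ ‖z‖ + t * (1 + 1 / z.im) := by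
    have h1 : Tendsto (fun n => ‖u n - stieltjes μ (w n)‖) atTop (𝓝 0) := by
      simpa using h.norm
    filter_upwards [h1.eventually (gt_mem_nhds zero_lt_one)] with n hn
    have h2 : ‖stieltjes μ (w n)‖ ≤ 1 / z.im := (norm_stieltjes_le (hwpos n)).trans (by
      simpa using one_div_le_one_div_of_le hz (hwim n))
    have h3 : ‖u n‖ ≤ 1 + 1 / z.im := by
      have := norm_add_le (u n - stieltjes μ (w n)) (stieltjes μ (w n))
      rw [sub_add_cancel] at this
      linarith
    refine (norm_add_le _ _).trans ?_
    rw [norm_mul, Complex.norm_real, Real.norm_of_nonneg ht.le]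
    gcongr
  set R := ‖z‖ + t * (1 + 1 / z.im)
  have hcw : CauchySeq w := by
    rw [Metric.cauchySeq_iff']
    intro ε hε
    set C := 2 * (K + R) ^ 4 / t
    have hC : 0 ≤ C := div_nonneg (by positivity) ht.le
    have hc := hFt.cauchySeq
    rw [Metric.cauchySeq_iff'] at hc
    obtain ⟨n₁, hn₁⟩ := Metric.cauchySeq_iff.1 hFt.cauchySeq (ε ^ 3 / (C + 1)) (by positivity)
    obtain ⟨n₂, hn₂⟩ := eventually_atTop.1 (hev.and hbd)
    refine ⟨max n₁ n₂, fun n hn => ?_⟩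
    have g1 := hn₂ n ((le_max_right _ _).trans hn)
    have g2 := hn₂ _ (le_max_right n₁ n₂)
    have g3 := hn₁ n ((le_max_left _ _).trans hn) _ (le_max_left n₁ n₂)
    rw [dist_eq_norm] at g3 ⊢
    have g4 := norm_sub_cube_le ht hK (hwpos n) (hwpos _) g1.1 g2.1 g1.2 g2.2
    by_contra hcon
    push Not at hcon
    have g5 := pow_le_pow_left₀ hε.le hcon 3
    rw [lt_div_iff₀ (by positivity)] at g3
    nlinarith [norm_nonneg (w n - t * stieltjes μ (w n) - (w (max n₁ n₂) -
      t * stieltjes μ (w (max n₁ n₂))))]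
  obtain ⟨w₀, hw₀⟩ := cauchySeq_tendsto_of_complete hcw
  have htc : (t : ℂ) ≠ 0 := by exact_mod_cast ht.ne'
  have hu' : u = fun n => (w n - z) / t := by
    ext n; simp only [hw]; field_simp; ring
  have hut : Tendsto u atTop (𝓝 ((w₀ - z) / t)) := by
    rw [hu']; exact (hw₀.sub_const z).div_const _
  have hw₀e : z + t * ((w₀ - z) / t) = w₀ := by field_simp; ring
  have hw₀pos : 0 < w₀.im := hz.trans_le
    (ge_of_tendsto' ((Complex.continuous_im.tendsto w₀).comp hw₀) hwim)
  refine ⟨(w₀ - z) / t, hut, ge_of_tendsto' ((Complex.continuous_im.tendsto _).comp hut) hu, ?_⟩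
  rw [hw₀e]
  have h1 := hut.sub ((continuousAt_stieltjes (μ := μ) hw₀pos).tendsto.comp hw₀)
  exact sub_eq_zero.1 (tendsto_nhds_unique h1 h)

/-- The condition of `norm_stieltjes_sq_le` holds at the subordinated point because its image is z.
-/
lemma IsSubordinated.norm_le (hm : IsSubordinated μ t m) (ht : 0 < t) {z : ℂ} (hz : 0 < z.im) :
    ‖m z‖ ≤ 1 / √t := by
  have h := norm_stieltjes_sq_le (μ := μ) ht (hm.im_pos ht hz).2 (by rw [hm.sub_eq hz]; exact hz.le)
  rw [← (hm z hz).2] at h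
  refine le_of_abs_le (abs_le_of_sq_le_sq (h.trans_eq ?_) (by positivity))
  rw [div_pow, Real.sq_sqrt ht.le, one_pow]

lemma IsSubordinated.norm_add_le (hm : IsSubordinated μ t m) (ht : 0 < t) {z : ℂ}
    (hz : 0 < z.im) : ‖z + t * m z‖ ≤ ‖z‖ + √t := by
  refine (_root_.norm_add_le _ _).trans ?_
  rw [norm_mul, Complex.norm_real, Real.norm_of_nonneg ht.le]
  have := mul_le_mul_of_nonneg_left (hm.norm_le ht hz) ht.le
  rw [mul_one_div, Real.div_sqrt] at this
  linarith

/-- The solution has limits at every point of the closed upper half-plane. -/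
lemma IsSubordinated.exists_tendsto (hm : IsSubordinated μ t m) (ht : 0 < t) {K : ℝ}
    (hK : ∀ᵐ x ∂μ, |x| ≤ K) {z₀ : ℂ} (hz₀ : z₀ ∈ closure {z : ℂ | 0 < z.im}) :
    ∃ y, Tendsto m (𝓝[{z : ℂ | 0 < z.im}] z₀) (𝓝 y) := by
  have hne : (𝓝[{z : ℂ | 0 < z.im}] z₀).NeBot := mem_closure_iff_nhdsWithin_neBot.1 hz₀
  set w := fun z => z + t * m z with hw
  -- The function m is recovered from w by an affine formula, so a limit of w suffices.
  suffices hc : Cauchy (map w (𝓝[{z : ℂ | 0 < z.im}] z₀)) by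
    obtain ⟨w₀, hw₀⟩ := CompleteSpace.complete hc
    have htc : (t : ℂ) ≠ 0 := by exact_mod_cast ht.ne'
    refine ⟨(w₀ - z₀) / t, ?_⟩
    have hm' : m = fun z => (w z - z) / t := by
      ext z; simp only [hw]; field_simp; ring
    rw [hm']
    have h1 : Tendsto w (𝓝[{z : ℂ | 0 < z.im}] z₀) (𝓝 w₀) := hw₀
    have h2 : Tendsto (fun z : ℂ => z) (𝓝[{z : ℂ | 0 < z.im}] z₀) (𝓝 z₀) := nhdsWithin_le_nhds
    exact (h1.sub h2).div_const _
  rw [Metric.cauchy_iff]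
  refine ⟨hne.map _, fun ε hε => ?_⟩
  set R := ‖z₀‖ + 1 + √t
  set C := 2 * (K + R) ^ 4 / t
  have hC : 0 ≤ C := div_nonneg (by positivity) ht.le
  -- The bound 1 keeps the points in a region where the constant C applies; the other bound puts any
  -- two of them within ε³/(C + 1), so that the cube estimate yields distance below ε.
  set δ := min 1 (ε ^ 3 / (C + 1) / 2)
  have hδ : 0 < δ := lt_min one_pos (by positivity)
  refine ⟨w '' (Metric.ball z₀ δ ∩ {z : ℂ | 0 < z.im}), image_mem_map
    (inter_mem (mem_nhdsWithin_of_mem_nhds (Metric.ball_mem_nhds _ hδ)) self_mem_nhdsWithin), ?_⟩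
  rintro _ ⟨z, ⟨hzb, hz⟩, rfl⟩ _ ⟨z', ⟨hzb', hz'⟩, rfl⟩
  have hb : ∀ y ∈ Metric.ball z₀ δ, ‖y‖ ≤ ‖z₀‖ + 1 := fun y hy => by
    rw [mem_ball_iff_norm] at hy
    have := _root_.norm_add_le (y - z₀) z₀
    rw [sub_add_cancel] at this
    have : δ ≤ 1 := min_le_left _ _
    linarith
  have g := norm_sub_cube_le (R := R) ht hK (hm.im_pos ht hz).2 (hm.im_pos ht hz').2
    (by rw [hm.sub_eq hz]; exact le_of_lt hz) (by rw [hm.sub_eq hz']; exact le_of_lt hz')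
    ((hm.norm_add_le ht hz).trans (by linarith [hb z hzb]))
    ((hm.norm_add_le ht hz').trans (by linarith [hb z' hzb']))
  rw [hm.sub_eq hz, hm.sub_eq hz'] at g
  have g2 : ‖z - z'‖ < ε ^ 3 / (C + 1) := by
    rw [← dist_eq_norm]
    have h1 := dist_triangle_right z z' z₀
    have h2 : δ ≤ ε ^ 3 / (C + 1) / 2 := min_le_right _ _
    rw [Metric.mem_ball] at hzb hzb'
    linarith
  rw [dist_eq_norm]
  by_contra hcon
  push Not at hcon
  have g5 := pow_le_pow_left₀ hε.le hcon 3
  rw [lt_div_iff₀ (by positivity)] at g2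
  simp only [hw] at g5
  nlinarith [norm_nonneg (z - z')]

lemma ofReal_mem_closure (ξ : ℝ) : (ξ : ℂ) ∈ closure {z : ℂ | 0 < z.im} := by
  rw [Complex.closure_setOfPred_lt_im]; simp

/-- The boundary values of the solution on the real line. -/
def boundaryValue (m : ℂ → ℂ) (ξ : ℝ) : ℂ := extendFrom {z : ℂ | 0 < z.im} m ξ

lemma IsSubordinated.continuous_boundaryValue (hm : IsSubordinated μ t m) (ht : 0 < t) {K : ℝ}
    (hK : ∀ᵐ x ∂μ, |x| ≤ K) : Continuous (boundaryValue m) := by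
  have h := continuousOn_extendFrom (f := m) (A := {z : ℂ | 0 < z.im})
    (B := closure {z : ℂ | 0 < z.im}) subset_rfl fun x hx => hm.exists_tendsto ht hK hx
  exact h.comp_continuous Complex.continuous_ofReal ofReal_mem_closure

lemma tendsto_add_mul_I (ξ : ℝ) :
    Tendsto (fun η : ℝ => (ξ : ℂ) + η * Complex.I) (𝓝[>] 0) (𝓝[{z : ℂ | 0 < z.im}] (ξ : ℂ)) := by
  refine tendsto_nhdsWithin_iff.2 ⟨?_, ?_⟩
  · have : Continuous fun η : ℝ => (ξ : ℂ) + η * Complex.I := by fun_prop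
    have h := this.tendsto 0
    simp only [Complex.ofReal_zero, zero_mul, add_zero] at h
    exact h.mono_left nhdsWithin_le_nhds
  · filter_upwards [self_mem_nhdsWithin] with η hη
    simpa using hη

lemma IsSubordinated.tendsto_boundaryValue (hm : IsSubordinated μ t m) (ht : 0 < t) {K : ℝ}
    (hK : ∀ᵐ x ∂μ, |x| ≤ K) (ξ : ℝ) :
    Tendsto (fun η : ℝ => m (ξ + η * Complex.I)) (𝓝[>] 0) (𝓝 (boundaryValue m ξ)) :=
  (tendsto_extendFrom (hm.exists_tendsto ht hK (ofReal_mem_closure ξ))).comp (tendsto_add_mul_I ξ)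

lemma IsSubordinated.im_boundaryValue_nonneg (hm : IsSubordinated μ t m) (ht : 0 < t) {K : ℝ}
    (hK : ∀ᵐ x ∂μ, |x| ≤ K) (ξ : ℝ) : 0 ≤ (boundaryValue m ξ).im := by
  refine ge_of_tendsto ((Complex.continuous_im.tendsto _).comp (hm.tendsto_boundaryValue ht hK ξ)) ?_
  filter_upwards [self_mem_nhdsWithin] with η hη
  exact (hm _ (by simpa using hη)).1

/-- At an interior point the limit is taken over a full neighbourhood, which contains the point, so
the limit must be the value there. -/
lemma IsSubordinated.continuousAt (hm : IsSubordinated μ t m) (ht : 0 < t) {K : ℝ}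
    (hK : ∀ᵐ x ∂μ, |x| ≤ K) {z : ℂ} (hz : 0 < z.im) : ContinuousAt m z := by
  have hmem : {z : ℂ | 0 < z.im} ∈ 𝓝 z := (isOpen_lt continuous_const Complex.continuous_im).mem_nhds hz
  obtain ⟨y, hy⟩ := hm.exists_tendsto ht hK (subset_closure hz)
  rw [nhdsWithin_eq_nhds.2 hmem] at hy
  have e := tendsto_nhds_unique (hy.mono_left (pure_le_nhds z)) (tendsto_pure_nhds m z)
  rwa [e] at hy

end Subordination

/-! ### Boundary values for the truncated allocation law -/

section BoundaryDensity

variable {μ ν : Measure ℝ} {t : ℝ} {m : ℂ → ℂ}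

lemma IsSubordinated.im_partial_nonneg [IsFiniteMeasure ν] (hm : IsSubordinated μ t m) (ht : 0 < t)
    {z : ℂ} (hz : 0 < z.im) : 0 ≤ (stieltjes ν (z + t * m z)).im :=
  im_stieltjes_nonneg (hm.im_pos ht hz).2

variable [IsProbabilityMeasure μ]

lemma IsSubordinated.im_partial_le (hm : IsSubordinated μ t m) (ht : 0 < t) (hν : ν ≤ μ)
    {z : ℂ} (hz : 0 < z.im) : (stieltjes ν (z + t * m z)).im ≤ (m z).im := by
  have h := im_stieltjes_mono hν (hm.im_pos ht hz).2
  rwa [← (hm z hz).2] at h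

/-- The boundary density of the Stieltjes transform of `ν` at the subordinated point. -/
def boundaryDensity (ν : Measure ℝ) (t : ℝ) (m : ℂ → ℂ) (ξ : ℝ) : ℝ :=
  if 0 < (boundaryValue m ξ).im then
    (stieltjes ν (ξ + t * boundaryValue m ξ)).im / Real.pi else 0

/-- Where the boundary value of m has positive imaginary part, the subordinated point stays inside
the half-plane and the transform of ν is continuous there. Where it is real, the quantity is
squeezed between 0 and Im m / π, so nothing about the regularity of ν is needed. -/
lemma IsSubordinated.tendsto_boundaryDensity (hm : IsSubordinated μ t m) (ht : 0 < t) {K : ℝ}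
    (hK : ∀ᵐ x ∂μ, |x| ≤ K) (hν : ν ≤ μ) (ξ : ℝ) :
    Tendsto (fun η : ℝ => (stieltjes ν (ξ + η * Complex.I + t * m (ξ + η * Complex.I))).im / Real.pi)
      (𝓝[>] 0) (𝓝 (boundaryDensity ν t m ξ)) := by
  have : IsFiniteMeasure ν := isFiniteMeasure_of_le μ hν
  have h1 := hm.tendsto_boundaryValue ht hK ξ
  rw [boundaryDensity]
  split_ifs with h
  · refine Tendsto.div_const ((Complex.continuous_im.tendsto _).comp ?_) _
    have h2 : Tendsto (fun η : ℝ => (ξ : ℂ) + η * Complex.I + t * m (ξ + η * Complex.I)) (𝓝[>] 0)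
        (𝓝 (ξ + t * boundaryValue m ξ)) :=
      ((tendsto_add_mul_I ξ).mono_right nhdsWithin_le_nhds).add (h1.const_mul _)
    refine (continuousAt_stieltjes ?_).tendsto.comp h2
    simp only [Complex.add_im, Complex.ofReal_im, Complex.im_ofReal_mul, zero_add]
    positivity
  · have h0 : (boundaryValue m ξ).im = 0 :=
      le_antisymm (not_lt.1 h) (hm.im_boundaryValue_nonneg ht hK ξ)
    have h2 : Tendsto (fun η : ℝ => (m (ξ + η * Complex.I)).im / Real.pi) (𝓝[>] 0) (𝓝 0) := by
      have := ((Complex.continuous_im.tendsto _).comp h1).div_const Real.pi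
      rwa [h0, zero_div] at this
    refine tendsto_of_tendsto_of_tendsto_of_le_of_le' tendsto_const_nhds h2 ?_ ?_
    · filter_upwards [self_mem_nhdsWithin] with η hη
      exact div_nonneg (hm.im_partial_nonneg ht (by simpa using hη)) Real.pi_pos.le
    · filter_upwards [self_mem_nhdsWithin] with η hη
      exact div_le_div_of_nonneg_right (hm.im_partial_le ht hν (by simpa using hη)) Real.pi_pos.le

/-- The support is bounded and m is bounded, so −iη (x − w)⁻¹ tends to 1 uniformly in x. This
asymptotics is what later excludes escape of mass to infinity. -/
lemma IsSubordinated.tendsto_mul_im (hm : IsSubordinated μ t m) (ht : 0 < t) {K : ℝ}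
    (hK : ∀ᵐ x ∂μ, |x| ≤ K) (hν : ν ≤ μ) :
    Tendsto (fun η : ℝ => η * (stieltjes ν (η * Complex.I + t * m (η * Complex.I))).im)
      atTop (𝓝 (ν.real Set.univ)) := by
  have : IsFiniteMeasure ν := isFiniteMeasure_of_le μ hν
  have hKν : ∀ᵐ x ∂ν, |x| ≤ K := ae_mono hν hK
  have key : ∀ η : ℝ, 0 < η →
      ‖η * (stieltjes ν (η * Complex.I + t * m (η * Complex.I))).im - ν.real Set.univ‖ ≤
        (K + √t) / η * ν.real Set.univ := by
    intro η hη
    have hz : 0 < ((η : ℂ) * Complex.I).im := by simpa using hη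
    set w := (η : ℂ) * Complex.I + t * m (η * Complex.I) with hw
    have hwim : η ≤ w.im := le_of_eq_of_le (by simp) (hm.im_pos ht hz).1
    have hwpos : 0 < w.im := hη.trans_le hwim
    have e1 : η * (stieltjes ν w).im - ν.real Set.univ =
        (∫ x, (-(η * Complex.I) * ((x : ℂ) - w)⁻¹ - 1) ∂ν).re := by
      rw [integral_sub ((integrable_inv_ofReal_sub hwpos).const_mul _) (integrable_const _),
        integral_const_mul]
      simp [stieltjes]
    rw [e1]
    refine (Complex.abs_re_le_norm _).trans ?_
    refine norm_integral_le_of_norm_le_const ?_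
    filter_upwards [hKν] with x hx
    have hne := ofReal_sub_ne_zero x hwpos
    have e2 : -(η * Complex.I) * ((x : ℂ) - w)⁻¹ - 1 =
        -(x - t * m (η * Complex.I)) * ((x : ℂ) - w)⁻¹ := by
      field_simp
      simp only [hw]
      ring
    rw [e2, norm_mul, norm_neg, div_eq_mul_one_div]
    refine mul_le_mul ?_ ((norm_inv_ofReal_sub_le x hwpos).trans
      (one_div_le_one_div_of_le hη hwim)) (norm_nonneg _) ?_
    · refine (_root_.norm_sub_le _ _).trans (add_le_add (by simpa using hx) ?_)
      rw [norm_mul, Complex.norm_real, Real.norm_of_nonneg ht.le]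
      have := mul_le_mul_of_nonneg_left (hm.norm_le ht hz) ht.le
      rwa [mul_one_div, Real.div_sqrt] at this
    · have := (abs_nonneg x).trans hx
      positivity
  rw [tendsto_iff_norm_sub_tendsto_zero]
  have hlim : Tendsto (fun η : ℝ => (K + √t) / η * ν.real Set.univ) atTop (𝓝 0) := by
    have := (tendsto_const_nhds (x := K + √t)).div_atTop tendsto_id
    simpa using this.mul_const (ν.real Set.univ)
  refine squeeze_zero' (.of_forall fun _ => norm_nonneg _) ?_ hlim
  filter_upwards [eventually_gt_atTop 0] with η hη using key η hη

end BoundaryDensity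

/-! ### Poisson smoothing -/

section WeakConvergence

lemma tendsto_of_forall_approx {a : ℕ → ℝ} {L : ℝ}
    (h : ∀ ε > 0, ∃ (b : ℕ → ℝ) (b' : ℝ), Tendsto b atTop (𝓝 b') ∧
      (∀ᶠ N in atTop, |a N - b N| ≤ ε) ∧ |b' - L| ≤ ε) : Tendsto a atTop (𝓝 L) := by
  rw [Metric.tendsto_atTop']
  intro ε hε
  obtain ⟨b, b', hb, h1, h2⟩ := h (ε / 4) (by positivity)
  obtain ⟨n₁, hn₁⟩ := eventually_atTop.1 (h1.and (hb.eventually (Metric.ball_mem_nhds b' (by positivity : 0 < ε / 4))))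
  refine ⟨n₁, fun n hn => ?_⟩
  obtain ⟨g1, g2⟩ := hn₁ n hn.le
  rw [Real.dist_eq] at g2
  rw [Real.dist_eq]
  rw [abs_le] at g1 h2
  rw [abs_lt] at g2 ⊢
  constructor <;> linarith

/-- The Poisson smoothing of a function. -/
def poissonSmooth (f : ℝ → ℝ) (η x : ℝ) : ℝ :=
  Real.pi⁻¹ * ∫ y, f (x + η * y) * (1 + y ^ 2)⁻¹

lemma integrable_mul_cauchy {f : ℝ → ℝ} (hf : Continuous f) {B : ℝ} (hB : ∀ x, |f x| ≤ B) :
    Integrable fun y => f y * (1 + y ^ 2)⁻¹ :=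
  integrable_inv_one_add_sq.bdd_mul (c := B) hf.aestronglyMeasurable (ae_of_all _ hB)

/-- The Poisson kernel is an approximate identity: uniform continuity handles |ηy| < δ, and the
remaining tail of the Cauchy density does not depend on x. -/
lemma exists_poissonSmooth_sub_le {f : ℝ → ℝ} (hf : UniformContinuous f) {B : ℝ}
    (hB : ∀ x, |f x| ≤ B) {ε : ℝ} (hε : 0 < ε) :
    ∀ᶠ η : ℝ in 𝓝[>] 0, ∀ x, |poissonSmooth f η x - f x| ≤ ε := by
  obtain ⟨δ, hδ, hfδ⟩ := Metric.uniformContinuous_iff.1 hf (ε / 2) (by positivity)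
  have hB0 : 0 ≤ B := (abs_nonneg _).trans (hB 0)
  have hmeas : ∀ η : ℝ, MeasurableSet {y : ℝ | δ ≤ |η * y|} := fun η =>
    measurableSet_le measurable_const (by fun_prop)
  have htail : Tendsto (fun η : ℝ => Real.pi⁻¹ * ∫ y, Set.indicator {y : ℝ | δ ≤ |η * y|}
      (fun y => 2 * B * (1 + y ^ 2)⁻¹) y) (𝓝[>] 0) (𝓝 (Real.pi⁻¹ * ∫ y : ℝ, 0)) := by
    refine Tendsto.const_mul _ ?_
    refine tendsto_integral_filter_of_dominated_convergence (fun y => 2 * B * (1 + y ^ 2)⁻¹)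
      ?_ ?_ (integrable_inv_one_add_sq.const_mul _) ?_
    · refine .of_forall fun η => ?_
      exact ((integrable_inv_one_add_sq.const_mul (2 * B)).indicator (hmeas η)).1
    · refine .of_forall fun η => ae_of_all _ fun y => ?_
      refine (norm_indicator_le_norm_self _ _).trans_eq ?_
      rw [Real.norm_of_nonneg (by positivity)]
    · refine ae_of_all _ fun y => ?_
      refine tendsto_const_nhds.congr' ?_
      have : Tendsto (fun η : ℝ => |η * y|) (𝓝[>] 0) (𝓝 0) := by
        have h : Continuous fun η : ℝ => |η * y| := by fun_prop
        simpa using (h.tendsto 0).mono_left (nhdsWithin_le_nhds (s := Set.Ioi 0))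
      filter_upwards [this.eventually (gt_mem_nhds hδ)] with η hη
      rw [Set.indicator_of_notMem]
      simpa using hη
  simp only [integral_zero, mul_zero] at htail
  filter_upwards [htail.eventually (gt_mem_nhds (by positivity : 0 < ε / 2))] with η hη x
  have e : poissonSmooth f η x - f x =
      Real.pi⁻¹ * ∫ y, (f (x + η * y) - f x) * (1 + y ^ 2)⁻¹ := by
    have h1 : Integrable fun y => f (x + η * y) * (1 + y ^ 2)⁻¹ :=
      integrable_mul_cauchy (hf.continuous.comp (by fun_prop)) fun y => hB _
    simp only [sub_mul]
    rw [integral_sub h1 (integrable_inv_one_add_sq.const_mul _), integral_const_mul,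
      integral_univ_inv_one_add_sq, poissonSmooth]
    field_simp
  have i1 : Integrable fun y : ℝ => ε / 2 * (1 + y ^ 2)⁻¹ := integrable_inv_one_add_sq.const_mul _
  have i2 : Integrable (Set.indicator {y : ℝ | δ ≤ |η * y|} (fun y => 2 * B * (1 + y ^ 2)⁻¹)) :=
    (integrable_inv_one_add_sq.const_mul (2 * B)).indicator (hmeas η)
  have b : ‖∫ y, (f (x + η * y) - f x) * (1 + y ^ 2)⁻¹‖ ≤
      ∫ y, (ε / 2 * (1 + y ^ 2)⁻¹ + Set.indicator {y : ℝ | δ ≤ |η * y|}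
        (fun y => 2 * B * (1 + y ^ 2)⁻¹) y) := by
    refine norm_integral_le_of_norm_le (i1.add i2) (ae_of_all _ fun y => ?_)
    have hp : 0 ≤ (1 + y ^ 2)⁻¹ := by positivity
    rw [Real.norm_eq_abs, abs_mul, abs_of_nonneg hp]
    by_cases hy : δ ≤ |η * y|
    · rw [Set.indicator_of_mem (by exact hy)]
      have : |f (x + η * y) - f x| ≤ 2 * B := (abs_sub _ _).trans (by linarith [hB (x + η * y), hB x])
      have := mul_le_mul_of_nonneg_right this hp
      have : 0 ≤ ε / 2 * (1 + y ^ 2)⁻¹ := by positivity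
      linarith
    · rw [Set.indicator_of_notMem (by exact hy), add_zero]
      refine mul_le_mul_of_nonneg_right ?_ hp
      have := hfδ (a := x + η * y) (b := x) (by rw [Real.dist_eq]; simpa using hy)
      rw [Real.dist_eq] at this
      exact this.le
  rw [integral_add i1 i2, integral_const_mul, integral_univ_inv_one_add_sq, Real.norm_eq_abs] at b
  rw [e, abs_mul, abs_of_pos (by positivity : 0 < Real.pi⁻¹)]
  refine (mul_le_mul_of_nonneg_left b (by positivity)).trans ?_
  rw [mul_add]
  have : Real.pi⁻¹ * (ε / 2 * Real.pi) = ε / 2 := by field_simp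
  rw [this]
  linarith

lemma norm_inv_ofReal_sub_sq (x ξ η : ℝ) :
    ‖((x : ℂ) - (ξ + η * Complex.I))⁻¹‖ ^ 2 = ((x - ξ) ^ 2 + η ^ 2)⁻¹ := by
  rw [norm_inv, inv_pow, ← Complex.normSq_eq_norm_sq, Complex.normSq_apply]
  simp [sq]

lemma im_inv_ofReal_sub_add_mul_I (x ξ η : ℝ) :
    ((x : ℂ) - (ξ + η * Complex.I))⁻¹.im = η * ((x - ξ) ^ 2 + η ^ 2)⁻¹ := by
  rw [im_inv_ofReal_sub, norm_inv_ofReal_sub_sq]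
  simp

lemma poissonSmooth_eq (f : ℝ → ℝ) {η : ℝ} (hη : 0 < η) (x : ℝ) :
    poissonSmooth f η x =
      Real.pi⁻¹ * ∫ ξ, f ξ * ((x : ℂ) - (ξ + η * Complex.I))⁻¹.im := by
  rw [poissonSmooth]
  congr 1
  set F : ℝ → ℝ := fun ξ => f ξ * ((x : ℂ) - (ξ + η * Complex.I))⁻¹.im
  have h1 : ∀ y, f (x + η * y) * (1 + y ^ 2)⁻¹ = η * F (x + η * y) := by
    intro y
    simp only [F, im_inv_ofReal_sub_add_mul_I]
    have : (x - (x + η * y)) ^ 2 + η ^ 2 = η ^ 2 * (1 + y ^ 2) := by ring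
    rw [this]
    have : (1 + y ^ 2) ≠ 0 := by positivity
    field_simp
  simp only [h1]
  rw [integral_const_mul, Measure.integral_comp_mul_left (fun y => F (x + y)) η,
    integral_add_left_eq_self F x, abs_of_pos (by positivity), smul_eq_mul]
  field_simp

variable {ν : Measure ℝ} [IsFiniteMeasure ν]

lemma continuous_stieltjes_line {η : ℝ} (hη : 0 < η) :
    Continuous fun ξ : ℝ => stieltjes ν (ξ + η * Complex.I) := by
  rw [continuous_iff_continuousAt]
  intro ξ
  have h : ContinuousAt (fun ξ : ℝ => (ξ : ℂ) + η * Complex.I) ξ := by fun_prop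
  exact ContinuousAt.comp (g := stieltjes ν) (continuousAt_stieltjes (by simpa using hη)) h

/-- Fubini moves the smoothing from the test function to the measure, where it becomes the imaginary
part of the Stieltjes transform at height η. This is the weak form of Stieltjes inversion. -/
lemma integral_poissonSmooth {f : ℝ → ℝ} (hf : Continuous f) (hfc : HasCompactSupport f)
    {η : ℝ} (hη : 0 < η) :
    ∫ x, poissonSmooth f η x ∂ν =
      Real.pi⁻¹ * ∫ ξ, f ξ * (stieltjes ν (ξ + η * Complex.I)).im := by
  simp only [poissonSmooth_eq f hη]
  rw [integral_const_mul]
  congr 1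
  have hfi : Integrable f := hf.integrable_of_hasCompactSupport hfc
  have hc : Continuous fun q : ℝ × ℝ => ((q.1 : ℂ) - (q.2 + η * Complex.I))⁻¹.im := by
    refine Complex.continuous_im.comp (Continuous.inv₀ (by fun_prop) fun q => ?_)
    exact ofReal_sub_ne_zero q.1 (by simpa using hη)
  have hint : Integrable (fun q : ℝ × ℝ => f q.2 * ((q.1 : ℂ) - (q.2 + η * Complex.I))⁻¹.im)
      (ν.prod volume) := by
    refine (hfi.comp_snd ν).mul_bdd (c := 1 / η) hc.aestronglyMeasurable (ae_of_all _ fun q => ?_)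
    refine (Complex.abs_im_le_norm _).trans ?_
    have := norm_inv_ofReal_sub_le q.1 (w := (q.2 : ℂ) + η * Complex.I) (by simpa using hη)
    simpa using this
  rw [integral_integral_swap hint]
  congr 1; ext ξ
  rw [integral_const_mul]
  congr 1
  exact integral_im (integrable_inv_ofReal_sub (by simpa using hη))

end WeakConvergence

/-! ### From Stieltjes transforms to weak convergence and distribution functions -/

section StieltjesLimit

/-- The Stieltjes transforms of `ν N` converge to `g`, whose imaginary part is bounded and has
boundary values `π r`, and no mass escapes to infinity. -/
structure IsStieltjesLimit (ν : ℕ → Measure ℝ) (g : ℂ → ℂ) (r : ℝ → ℝ) (c C : ℝ) : Prop where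
  mass : Tendsto (fun N => (ν N).real Set.univ) atTop (𝓝 c)
  conv : ∀ z : ℂ, 0 < z.im → Tendsto (fun N => stieltjes (ν N) z) atTop (𝓝 (g z))
  bound : ∀ z : ℂ, 0 < z.im → |(g z).im| ≤ C
  boundary : ∀ ξ : ℝ, Tendsto (fun η : ℝ => (g (ξ + η * Complex.I)).im / Real.pi) (𝓝[>] 0) (𝓝 (r ξ))
  tail : Tendsto (fun η : ℝ => η * (g (η * Complex.I)).im) atTop (𝓝 c)

/-- A continuous cutoff function, equal to `1` on `[-R, R]` and to `0` off `[-2R, 2R]`. -/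
def cutoff (R x : ℝ) : ℝ := max 0 (min 1 (2 - |x| / R))

lemma continuous_cutoff (R : ℝ) : Continuous (cutoff R) := by unfold cutoff; fun_prop

lemma cutoff_nonneg (R x : ℝ) : 0 ≤ cutoff R x := le_max_left _ _

lemma cutoff_le_one (R x : ℝ) : cutoff R x ≤ 1 := max_le zero_le_one (min_le_left _ _)

lemma cutoff_eq_one {R x : ℝ} (hR : 0 < R) (hx : |x| ≤ R) : cutoff R x = 1 := by
  have : |x| / R ≤ 1 := (div_le_one hR).2 hx
  rw [cutoff, min_eq_left (by linarith), max_eq_right zero_le_one]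

lemma hasCompactSupport_cutoff {R : ℝ} (hR : 0 < R) : HasCompactSupport (cutoff R) := by
  refine HasCompactSupport.intro (isCompact_Icc (a := -(2 * R)) (b := 2 * R)) fun x hx => ?_
  have h : 2 * R < |x| := by
    by_contra h
    exact hx (abs_le.1 (not_lt.1 h))
  have : 2 ≤ |x| / R := (le_div_iff₀ hR).2 h.le
  rw [cutoff, max_eq_left]
  exact (min_le_right _ _).trans (by linarith)

/-- The bracket equals x²/(x² + R²), which is at least 1/2 off [−R, R]; hence the factor 2. Its
integral is read off from the Stieltjes transform at iR, so tails can be controlled through `tail`.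
-/
lemma one_sub_cutoff_le {R : ℝ} (hR : 0 < R) (x : ℝ) :
    1 - cutoff R x ≤ 2 * (1 - R * ((x : ℂ) - R * Complex.I)⁻¹.im) := by
  have e := im_inv_ofReal_sub_add_mul_I x 0 R
  simp only [Complex.ofReal_zero, zero_add, sub_zero] at e
  rw [e]
  have hpos : 0 < x ^ 2 + R ^ 2 := by positivity
  have e2 : 1 - R * (R * (x ^ 2 + R ^ 2)⁻¹) = x ^ 2 / (x ^ 2 + R ^ 2) := by
    field_simp; ring
  rw [e2]
  by_cases hx : |x| ≤ R
  · rw [cutoff_eq_one hR hx, sub_self]; positivity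
  · have h1 : R ^ 2 ≤ x ^ 2 := by
      rw [← sq_abs x]; exact pow_le_pow_left₀ hR.le (not_le.1 hx).le 2
    have h2 : 1 / 2 ≤ x ^ 2 / (x ^ 2 + R ^ 2) := by
      rw [div_le_div_iff₀ (by norm_num) hpos]; linarith
    linarith [cutoff_nonneg R x]

lemma tendsto_cutoff (x : ℝ) : Tendsto (fun R => cutoff R x) atTop (𝓝 1) := by
  refine tendsto_const_nhds.congr' ?_
  filter_upwards [eventually_gt_atTop 0, eventually_ge_atTop |x|] with R h1 h2
  exact (cutoff_eq_one h1 h2).symm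

variable {ν : ℕ → Measure ℝ} [∀ N, IsFiniteMeasure (ν N)] {g : ℂ → ℂ} {r : ℝ → ℝ} {c C : ℝ}

/-- No regularity of g is assumed; on a horizontal line its imaginary part is a pointwise limit of
continuous functions. -/
lemma IsStieltjesLimit.measurable_im (h : IsStieltjesLimit ν g r c C) {η : ℝ} (hη : 0 < η) :
    Measurable fun ξ : ℝ => (g (ξ + η * Complex.I)).im := by
  refine measurable_of_tendsto_metrizable
    (f := fun N (ξ : ℝ) => (stieltjes (ν N) (ξ + η * Complex.I)).im)
    (fun N => (Complex.continuous_im.comp (continuous_stieltjes_line hη)).measurable)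
    (tendsto_pi_nhds.2 fun ξ => ?_)
  exact (Complex.continuous_im.tendsto _).comp (h.conv _ (by simpa using hη))

lemma IsStieltjesLimit.im_nonneg (h : IsStieltjesLimit ν g r c C) {z : ℂ} (hz : 0 < z.im) :
    0 ≤ (g z).im :=
  ge_of_tendsto' ((Complex.continuous_im.tendsto _).comp (h.conv z hz))
    fun _ => im_stieltjes_nonneg hz

lemma IsStieltjesLimit.nonneg (h : IsStieltjesLimit ν g r c C) (ξ : ℝ) : 0 ≤ r ξ := by
  refine ge_of_tendsto (h.boundary ξ) ?_
  filter_upwards [self_mem_nhdsWithin] with η hη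
  exact div_nonneg (h.im_nonneg (by simpa using hη)) Real.pi_pos.le

lemma IsStieltjesLimit.measurable (h : IsStieltjesLimit ν g r c C) : Measurable r := by
  have hs : Tendsto (fun n : ℕ => 1 / ((n : ℝ) + 1)) atTop (𝓝[>] 0) :=
    tendsto_nhdsWithin_iff.2 ⟨tendsto_one_div_add_atTop_nhds_zero_nat,
      .of_forall fun n => by simp only [Set.mem_Ioi]; positivity⟩
  refine measurable_of_tendsto_metrizable
    (f := fun (n : ℕ) (ξ : ℝ) => (g (ξ + ((1 / ((n : ℝ) + 1) : ℝ) : ℂ) * Complex.I)).im / Real.pi)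
    (fun n => (h.measurable_im (by positivity)).div_const _)
    (tendsto_pi_nhds.2 fun ξ => (h.boundary ξ).comp hs)

/-- At a fixed height η, convergence of the transforms gives convergence of the smoothed integrals.
The smoothing error is uniform in large N since the masses are bounded, and on the limit side
`bound` permits dominated convergence as η → 0. -/
lemma IsStieltjesLimit.tendsto_integral_of_hasCompactSupport (h : IsStieltjesLimit ν g r c C)
    {f : ℝ → ℝ} (hf : Continuous f) (hfc : HasCompactSupport f) :
    Tendsto (fun N => ∫ x, f x ∂(ν N)) atTop (𝓝 (∫ x, f x * r x)) := by
  obtain ⟨B, hB⟩ := hfc.exists_bound_of_continuous hf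
  have hfi : Integrable f := hf.integrable_of_hasCompactSupport hfc
  have hc0 : 0 ≤ c := ge_of_tendsto' h.mass fun _ => measureReal_nonneg
  have hmass : ∀ᶠ N in atTop, (ν N).real Set.univ ≤ c + 1 :=
    (h.mass.eventually (gt_mem_nhds (lt_add_one c))).mono fun _ h => h.le
  have lim2 : Tendsto (fun η : ℝ => Real.pi⁻¹ * ∫ ξ, f ξ * (g (ξ + η * Complex.I)).im) (𝓝[>] 0)
      (𝓝 (∫ x, f x * r x)) := by
    have : Tendsto (fun η : ℝ => ∫ ξ, f ξ * ((g (ξ + η * Complex.I)).im / Real.pi)) (𝓝[>] 0)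
        (𝓝 (∫ x, f x * r x)) := by
      refine tendsto_integral_filter_of_dominated_convergence (fun ξ => ‖f ξ‖ * (C / Real.pi))
        ?_ ?_ (hfi.norm.mul_const _) (ae_of_all _ fun ξ => (h.boundary ξ).const_mul _)
      · filter_upwards [self_mem_nhdsWithin] with η hη
        exact hf.aestronglyMeasurable.mul ((h.measurable_im hη).div_const _).aestronglyMeasurable
      · filter_upwards [self_mem_nhdsWithin] with η hη
        refine ae_of_all _ fun ξ => ?_
        rw [norm_mul, norm_div, Real.norm_of_nonneg Real.pi_pos.le]
        have := h.bound (ξ + η * Complex.I) (by simpa using hη)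
        exact mul_le_mul_of_nonneg_left (div_le_div_of_nonneg_right this Real.pi_pos.le)
          (norm_nonneg _)
    refine this.congr fun η => ?_
    rw [← integral_const_mul]
    congr 1; ext ξ; ring
  refine tendsto_of_forall_approx fun ε hε => ?_
  -- The masses are eventually at most c + 1, so this tolerance integrates to at most ε.
  have e1 := exists_poissonSmooth_sub_le (hfc.uniformContinuous_of_continuous hf)
    (fun x => by simpa using hB x) (ε := ε / (c + 1)) (by positivity)
  have e2 := lim2.eventually (Metric.closedBall_mem_nhds _ hε)
  obtain ⟨η, ⟨h1, h2⟩, hη⟩ := ((e1.and e2).and self_mem_nhdsWithin).exists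
  have hη : 0 < η := hη
  refine ⟨fun N => ∫ x, poissonSmooth f η x ∂(ν N), _, ?_, ?_, h2⟩
  · simp only [integral_poissonSmooth hf hfc hη]
    refine Tendsto.const_mul _ ?_
    refine tendsto_integral_filter_of_dominated_convergence (fun ξ => ‖f ξ‖ * ((c + 1) / η))
      (.of_forall fun N => hf.aestronglyMeasurable.mul (Complex.continuous_im.comp
        (continuous_stieltjes_line hη)).aestronglyMeasurable) ?_ (hfi.norm.mul_const _)
        (ae_of_all _ fun ξ => ?_)
    · filter_upwards [hmass] with N hN
      refine ae_of_all _ fun ξ => ?_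
      rw [norm_mul]
      refine mul_le_mul_of_nonneg_left ((Complex.abs_im_le_norm _).trans ?_) (norm_nonneg _)
      refine (norm_stieltjes_le (by simpa using hη)).trans ?_
      simpa using div_le_div_of_nonneg_right hN hη.le
    · exact ((Complex.continuous_im.tendsto _).comp (h.conv _ (by simpa using hη))).const_mul _
  · filter_upwards [hmass] with N hN
    have i1 : Integrable f (ν N) := .of_bound hf.aestronglyMeasurable B (ae_of_all _ hB)
    have hpm : Measurable (poissonSmooth f η) := by
      have : poissonSmooth f η = fun x => Real.pi⁻¹ * ∫ y, f (x + η * y) * (1 + y ^ 2)⁻¹ := rfl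
      rw [this]
      refine Measurable.const_mul ?_ _
      refine StronglyMeasurable.measurable (StronglyMeasurable.integral_prod_right' (ν := volume)
        (f := fun q : ℝ × ℝ => f (q.1 + η * q.2) * (1 + q.2 ^ 2)⁻¹) ?_)
      refine Continuous.stronglyMeasurable ((hf.comp (by fun_prop)).mul
        (Continuous.inv₀ (by fun_prop) fun q => by positivity))
    have i2 : Integrable (poissonSmooth f η) (ν N) := by
      refine .of_bound hpm.aestronglyMeasurable (B + ε / (c + 1)) (ae_of_all _ fun x => ?_)
      have g1 := h1 x
      have g2 := hB x
      rw [Real.norm_eq_abs] at g2 ⊢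
      have := abs_add_le (poissonSmooth f η x - f x) (f x)
      rw [sub_add_cancel] at this
      linarith
    rw [← integral_sub i1 i2, ← Real.norm_eq_abs]
    refine (norm_integral_le_of_norm_le_const (C := ε / (c + 1)) (ae_of_all _ fun x => ?_)).trans ?_
    · rw [Real.norm_eq_abs, abs_sub_comm]; exact h1 x
    · calc ε / (c + 1) * (ν N).real Set.univ ≤ ε / (c + 1) * (c + 1) := by gcongr
        _ = ε := by field_simp

/-- Fatou's lemma along growing cutoffs: every truncated integral is a limit of integrals bounded by
the masses, hence at most c. -/
lemma IsStieltjesLimit.integrable (h : IsStieltjesLimit ν g r c C) : Integrable r := by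
  have hm := h.measurable
  refine ⟨hm.aestronglyMeasurable, ?_⟩
  have hb : ∀ n : ℕ, ∫⁻ x, ENNReal.ofReal (cutoff (n + 1) x * r x) ≤ ENNReal.ofReal c := by
    intro n
    have hn : (0 : ℝ) < n + 1 := by positivity
    have hl := h.tendsto_integral_of_hasCompactSupport (continuous_cutoff (n + 1))
      (hasCompactSupport_cutoff hn)
    have hle : ∫ x, cutoff (n + 1) x * r x ≤ c := by
      refine le_of_tendsto_of_tendsto' (b := atTop) hl h.mass fun N => ?_
      have : ∫ x, cutoff (n + 1) x ∂(ν N) ≤ ∫ x, (1 : ℝ) ∂(ν N) := by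
        refine integral_mono (.of_bound (continuous_cutoff _).aestronglyMeasurable 1
          (ae_of_all _ fun x => ?_)) (integrable_const _) fun x => cutoff_le_one _ _
        rw [Real.norm_of_nonneg (cutoff_nonneg _ _)]; exact cutoff_le_one _ _
      simpa using this
    have hrb : ∀ ξ, r ξ ≤ C / Real.pi := fun ξ => by
      refine le_of_tendsto (h.boundary ξ) ?_
      filter_upwards [self_mem_nhdsWithin] with η hη
      exact div_le_div_of_nonneg_right ((le_abs_self _).trans (h.bound _ (by simpa using hη)))
        Real.pi_pos.le
    have hi : Integrable fun x => cutoff (n + 1) x * r x :=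
      ((continuous_cutoff _).integrable_of_hasCompactSupport (hasCompactSupport_cutoff hn)).mul_bdd
        (c := C / Real.pi) hm.aestronglyMeasurable (ae_of_all _ fun x => by
          rw [Real.norm_of_nonneg (h.nonneg x)]; exact hrb x)
    rw [← ofReal_integral_eq_lintegral_ofReal hi
      (ae_of_all _ fun x => mul_nonneg (cutoff_nonneg _ _) (h.nonneg x))]
    exact ENNReal.ofReal_le_ofReal hle
  have hlim : ∀ x, liminf (fun n : ℕ => ENNReal.ofReal (cutoff (n + 1) x * r x)) atTop =
      ENNReal.ofReal (r x) := by
    intro x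
    refine Tendsto.liminf_eq (f := atTop) ((ENNReal.continuous_ofReal.tendsto _).comp ?_)
    have h1 : Tendsto (fun n : ℕ => (n : ℝ) + 1) atTop atTop :=
      tendsto_atTop_add_const_right _ _ tendsto_natCast_atTop_atTop
    simpa using ((tendsto_cutoff x).comp h1).mul_const (r x)
  have hF := lintegral_liminf_le (μ := volume) (u := atTop)
    (f := fun (n : ℕ) x => ENNReal.ofReal (cutoff (n + 1) x * r x))
    fun n => ((continuous_cutoff _).measurable.mul hm).ennreal_ofReal
  simp only [hlim] at hF
  rw [hasFiniteIntegral_iff_ofReal (ae_of_all _ h.nonneg)]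
  refine (hF.trans ?_).trans_lt (ENNReal.ofReal_lt_top (r := c))
  exact liminf_le_of_le (by isBoundedDefault) fun b hb' => by
    obtain ⟨n, hn⟩ := hb'.exists
    exact hn.trans (hb n)

/-- Convergence of Stieltjes transforms without loss of mass implies weak convergence. -/
lemma IsStieltjesLimit.tendsto_integral (h : IsStieltjesLimit ν g r c C)
    {f : ℝ → ℝ} (hf : Continuous f) {B : ℝ} (hB : ∀ x, |f x| ≤ B) :
    Tendsto (fun N => ∫ x, f x ∂(ν N)) atTop (𝓝 (∫ x, f x * r x)) := by
  have hB0 : 0 ≤ B := (abs_nonneg _).trans (hB 0)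
  have hr := h.integrable
  have t1 : Tendsto (fun R : ℝ => ∫ x, f x * cutoff R x * r x) atTop (𝓝 (∫ x, f x * r x)) := by
    refine tendsto_integral_filter_of_dominated_convergence (fun x => B * ‖r x‖)
      (.of_forall fun R => ((hf.mul (continuous_cutoff R)).aestronglyMeasurable).mul hr.1)
      (.of_forall fun R => ae_of_all _ fun x => ?_) (hr.norm.const_mul _)
      (ae_of_all _ fun x => ?_)
    · rw [norm_mul, norm_mul, Real.norm_of_nonneg (cutoff_nonneg R x)]
      refine mul_le_mul_of_nonneg_right ?_ (norm_nonneg _)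
      calc ‖f x‖ * cutoff R x ≤ B * 1 :=
            mul_le_mul (hB x) (cutoff_le_one _ _) (cutoff_nonneg _ _) hB0
        _ = B := mul_one B
    · simpa using ((tendsto_cutoff x).const_mul (f x)).mul_const (r x)
  -- This is the limit in N of the bound for the error made by the cutoff; `tail` makes it small for
  -- large R.
  have t2 : Tendsto (fun R : ℝ => B * (2 * (c - R * (g (R * Complex.I)).im))) atTop (𝓝 0) := by
    simpa using ((h.tail.const_sub c).const_mul 2).const_mul B
  refine tendsto_of_forall_approx fun ε hε => ?_
  obtain ⟨R, ⟨hR1, hR2⟩, hR⟩ := (((t1.eventually (Metric.closedBall_mem_nhds _ hε)).and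
    (t2.eventually (gt_mem_nhds hε))).and (eventually_gt_atTop (0 : ℝ))).exists
  refine ⟨fun N => ∫ x, f x * cutoff R x ∂(ν N), _,
    h.tendsto_integral_of_hasCompactSupport (hf.mul (continuous_cutoff R))
      ((hasCompactSupport_cutoff hR).mul_left), ?_, hR1⟩
  have hz : 0 < ((R : ℂ) * Complex.I).im := by simpa using hR
  have t3 : Tendsto (fun N => B * (2 * ((ν N).real Set.univ -
      R * (stieltjes (ν N) (R * Complex.I)).im))) atTop
      (𝓝 (B * (2 * (c - R * (g (R * Complex.I)).im)))) :=
    ((h.mass.sub (((Complex.continuous_im.tendsto _).comp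
      (h.conv _ hz)).const_mul R)).const_mul 2).const_mul B
  filter_upwards [t3.eventually (gt_mem_nhds hR2)] with N hN
  have i1 : Integrable f (ν N) := .of_bound hf.aestronglyMeasurable B (ae_of_all _ hB)
  have i2 : Integrable (fun x => f x * cutoff R x) (ν N) :=
    .of_bound (hf.mul (continuous_cutoff R)).aestronglyMeasurable B (ae_of_all _ fun x => by
      rw [norm_mul, Real.norm_of_nonneg (cutoff_nonneg R x)]
      calc ‖f x‖ * cutoff R x ≤ B * 1 :=
            mul_le_mul (hB x) (cutoff_le_one _ _) (cutoff_nonneg _ _) hB0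
        _ = B := mul_one B)
  have i3 : Integrable (fun x : ℝ => ((x : ℂ) - R * Complex.I)⁻¹.im) (ν N) :=
    (integrable_inv_ofReal_sub hz).im
  have i4 : Integrable (fun x : ℝ => 1 - R * ((x : ℂ) - R * Complex.I)⁻¹.im) (ν N) :=
    (integrable_const _).sub (i3.const_mul R)
  rw [← integral_sub i1 i2, ← Real.norm_eq_abs]
  refine (norm_integral_le_of_norm_le (g := fun x : ℝ => B * (2 * (1 - R * ((x : ℂ) - R * Complex.I)⁻¹.im)))
    ((i4.const_mul 2).const_mul B) (ae_of_all _ fun x => ?_)).trans ?_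
  · have : f x - f x * cutoff R x = f x * (1 - cutoff R x) := by ring
    rw [this, norm_mul, Real.norm_of_nonneg (sub_nonneg.2 (cutoff_le_one _ _))]
    exact mul_le_mul (hB x) (one_sub_cutoff_le hR x) (sub_nonneg.2 (cutoff_le_one _ _)) hB0
  · rw [integral_const_mul, integral_const_mul, integral_sub (integrable_const _) (i3.const_mul R),
      integral_const_mul]
    have : ∫ x : ℝ, ((x : ℂ) - R * Complex.I)⁻¹.im ∂(ν N) = (stieltjes (ν N) (R * Complex.I)).im :=
      integral_im (integrable_inv_ofReal_sub hz)
    rw [this]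
    simpa using hN.le

/-- A continuous approximation from above of the indicator of `(-∞, l]`. -/
def ramp (l δ x : ℝ) : ℝ := max 0 (min 1 ((l + δ - x) / δ))

lemma continuous_ramp (l δ : ℝ) : Continuous (ramp l δ) := by unfold ramp; fun_prop

lemma ramp_nonneg (l δ x : ℝ) : 0 ≤ ramp l δ x := le_max_left _ _

lemma ramp_le_one (l δ x : ℝ) : ramp l δ x ≤ 1 := max_le zero_le_one (min_le_left _ _)

lemma ramp_eq_one {l δ x : ℝ} (hδ : 0 < δ) (hx : x ≤ l) : ramp l δ x = 1 := by
  have : 1 ≤ (l + δ - x) / δ := (le_div_iff₀ hδ).2 (by linarith)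
  rw [ramp, min_eq_left this, max_eq_right zero_le_one]

lemma ramp_eq_zero {l δ x : ℝ} (hδ : 0 < δ) (hx : l + δ ≤ x) : ramp l δ x = 0 := by
  have : (l + δ - x) / δ ≤ 0 := div_nonpos_of_nonpos_of_nonneg (by linarith) hδ.le
  rw [ramp, max_eq_left ((min_le_right _ _).trans this)]

lemma abs_ramp_le (l δ x : ℝ) : |ramp l δ x| ≤ 1 := by
  rw [abs_of_nonneg (ramp_nonneg _ _ _)]; exact ramp_le_one _ _ _

lemma indicator_le_ramp {l δ : ℝ} (hδ : 0 < δ) (x : ℝ) :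
    (Set.Iic l).indicator 1 x ≤ ramp l δ x := by
  by_cases h : x ≤ l
  · rw [ramp_eq_one hδ h, Set.indicator_of_mem (by exact h)]; simp
  · rw [Set.indicator_of_notMem (by exact h)]; exact ramp_nonneg _ _ _

lemma ramp_sub_le_indicator {l δ : ℝ} (hδ : 0 < δ) (x : ℝ) :
    ramp (l - δ) δ x ≤ (Set.Iic l).indicator 1 x := by
  by_cases h : x ≤ l
  · rw [Set.indicator_of_mem (by exact h)]; exact ramp_le_one _ _ _
  · rw [Set.indicator_of_notMem (by exact h), ramp_eq_zero hδ (by linarith [not_le.1 h])]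

/-- Convergence of distribution functions. -/
lemma IsStieltjesLimit.tendsto_cdf (h : IsStieltjesLimit ν g r c C) (l : ℝ) :
    Tendsto (fun N => (ν N).real (Set.Iic l)) atTop (𝓝 (∫ x in Set.Iic l, r x)) := by
  have hr := h.integrable
  have e0 : ∫ x in Set.Iic l, r x = ∫ x, (Set.Iic l).indicator 1 x * r x := by
    rw [← integral_indicator measurableSet_Iic]
    congr 1; ext x
    by_cases hx : x ∈ Set.Iic l <;> simp [hx]
  have hbd : ∀ (l' δ x : ℝ), ‖ramp l' δ x * r x‖ ≤ ‖r x‖ := fun l' δ x => by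
    rw [norm_mul]
    exact mul_le_of_le_one_left (norm_nonneg _) (abs_ramp_le _ _ _)
  have t1 : Tendsto (fun δ : ℝ => ∫ x, ramp l δ x * r x) (𝓝[>] 0) (𝓝 (∫ x in Set.Iic l, r x)) := by
    rw [e0]
    refine tendsto_integral_filter_of_dominated_convergence (fun x => ‖r x‖)
      (.of_forall fun δ => (continuous_ramp l δ).aestronglyMeasurable.mul hr.1)
      (.of_forall fun δ => ae_of_all _ fun x => hbd _ _ _) hr.norm (ae_of_all _ fun x => ?_)
    refine Tendsto.mul_const _ ?_
    refine tendsto_const_nhds.congr' ?_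
    by_cases hx : x ≤ l
    · filter_upwards [self_mem_nhdsWithin] with δ hδ
      rw [ramp_eq_one hδ hx, Set.indicator_of_mem (by exact hx)]; simp
    · filter_upwards [Ioo_mem_nhdsGT (sub_pos.2 (not_le.1 hx))] with δ hδ
      rw [ramp_eq_zero hδ.1 (by linarith [hδ.2]), Set.indicator_of_notMem (by exact hx)]
  have t2 : Tendsto (fun δ : ℝ => ∫ x, ramp (l - δ) δ x * r x) (𝓝[>] 0)
      (𝓝 (∫ x in Set.Iic l, r x)) := by
    rw [e0]
    refine tendsto_integral_filter_of_dominated_convergence (fun x => ‖r x‖)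
      (.of_forall fun δ => (continuous_ramp _ δ).aestronglyMeasurable.mul hr.1)
      (.of_forall fun δ => ae_of_all _ fun x => hbd _ _ _) hr.norm ?_
    -- At l itself the lower ramp is 0 while the indicator is 1; the limit has a density, so this
    -- point does not count.
    have hne : ∀ᵐ x : ℝ, x ≠ l := by
      rw [ae_iff]; simp
    filter_upwards [hne] with x hxl
    refine Tendsto.mul_const _ ?_
    refine tendsto_const_nhds.congr' ?_
    by_cases hx : x ≤ l
    · filter_upwards [Ioo_mem_nhdsGT (sub_pos.2 (lt_of_le_of_ne hx hxl))] with δ hδ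
      rw [ramp_eq_one hδ.1 (by linarith [hδ.2]), Set.indicator_of_mem (by exact hx)]; simp
    · filter_upwards [self_mem_nhdsWithin] with δ hδ
      have hδ : 0 < δ := hδ
      rw [ramp_eq_zero hδ (by linarith [not_le.1 hx]), Set.indicator_of_notMem (by exact hx)]
  have hind : ∀ N, ∫ x, (Set.Iic l).indicator 1 x ∂(ν N) = (ν N).real (Set.Iic l) := fun N =>
    integral_indicator_one measurableSet_Iic
  have iind : ∀ N, Integrable ((Set.Iic l).indicator (1 : ℝ → ℝ)) (ν N) := fun N =>
    (integrable_const (1 : ℝ)).indicator measurableSet_Iic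
  have iramp : ∀ N l' δ, Integrable (ramp l' δ) (ν N) := fun N l' δ =>
    .of_bound (continuous_ramp _ _).aestronglyMeasurable 1 (ae_of_all _ fun x => abs_ramp_le _ _ _)
  rw [Metric.tendsto_nhds]
  intro ε hε
  obtain ⟨δ, ⟨h1, h2⟩, hδ⟩ := (((t1.eventually (Metric.ball_mem_nhds _ (half_pos hε))).and
    (t2.eventually (Metric.ball_mem_nhds _ (half_pos hε)))).and self_mem_nhdsWithin).exists
  have hδ : 0 < δ := hδ
  have u1 := (h.tendsto_integral (continuous_ramp l δ) (abs_ramp_le l δ)).eventually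
    (Metric.ball_mem_nhds _ (half_pos hε))
  have u2 := (h.tendsto_integral (continuous_ramp (l - δ) δ) (abs_ramp_le (l - δ) δ)).eventually
    (Metric.ball_mem_nhds _ (half_pos hε))
  filter_upwards [u1, u2] with N g1 g2
  have g3 := integral_mono (iind N) (iramp N l δ) (indicator_le_ramp hδ)
  have g4 := integral_mono (iramp N (l - δ) δ) (iind N) (ramp_sub_le_indicator hδ)
  rw [hind] at g3 g4
  rw [Real.dist_eq, abs_lt] at *
  constructor <;> linarith [h1.1, h1.2, h2.1, h2.2, g1.1, g1.2, g2.1, g2.2]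

end StieltjesLimit

/-! ### Existence of the principal value -/

section HilbertTransform

/-- The difference of the truncated kernel `1 / y` and the conjugate Poisson kernel. -/
def conjKernel (y : ℝ) : ℝ := Set.indicator {y : ℝ | 1 < |y|} (fun y => y⁻¹) y - y * (1 + y ^ 2)⁻¹

lemma measurable_conjKernel : Measurable conjKernel := by
  unfold conjKernel
  refine Measurable.sub (Measurable.indicator measurable_inv ?_) (by fun_prop)
  exact measurableSet_lt measurable_const (by fun_prop)

/-- For |y| > 1 the two kernels differ by y⁻¹ (1 + y²)⁻¹: the slow decay 1/y cancels and an
integrable kernel remains. -/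
lemma norm_conjKernel_le (y : ℝ) : ‖conjKernel y‖ ≤ (1 + y ^ 2)⁻¹ := by
  have hp : 0 < 1 + y ^ 2 := by positivity
  rw [Real.norm_eq_abs, conjKernel]
  by_cases hy : 1 < |y|
  · have hy0 : y ≠ 0 := by rintro rfl; simp at hy; linarith
    rw [Set.indicator_of_mem (by exact hy)]
    have : y⁻¹ - y * (1 + y ^ 2)⁻¹ = y⁻¹ * (1 + y ^ 2)⁻¹ := by field_simp; ring
    rw [this, abs_mul, abs_inv, abs_of_pos (inv_pos.2 hp)]
    exact mul_le_of_le_one_left (inv_pos.2 hp).le (inv_le_one_of_one_le₀ hy.le)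
  · rw [Set.indicator_of_notMem (by exact hy), zero_sub, abs_neg, abs_mul,
      abs_of_pos (inv_pos.2 hp)]
    exact mul_le_of_le_one_left (inv_pos.2 hp).le (not_lt.1 hy)

lemma conjKernel_neg (y : ℝ) : conjKernel (-y) = -conjKernel y := by
  by_cases hy : 1 < |y|
  · have hy' : 1 < |-y| := by rwa [abs_neg]
    rw [conjKernel, conjKernel, Set.indicator_of_mem (by exact hy'),
      Set.indicator_of_mem (by exact hy), inv_neg]
    ring
  · have hy' : ¬ 1 < |-y| := by rwa [abs_neg]
    rw [conjKernel, conjKernel, Set.indicator_of_notMem (by exact hy'),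
      Set.indicator_of_notMem (by exact hy)]
    ring

lemma integral_conjKernel : ∫ y, conjKernel y = 0 := by
  have h := integral_neg_eq_self conjKernel volume
  simp only [conjKernel_neg, integral_neg] at h
  linarith

lemma conjKernel_scale {ε : ℝ} (hε : 0 < ε) (y : ℝ) :
    Set.indicator {u : ℝ | ε < |u|} (fun u => u⁻¹) (ε * y) -
      (ε * y) * ((ε * y) ^ 2 + ε ^ 2)⁻¹ = ε⁻¹ * conjKernel y := by
  have hiff : ε < |ε * y| ↔ 1 < |y| := by
    rw [abs_mul, abs_of_pos hε]
    exact lt_mul_iff_one_lt_right hε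
  have hp : 1 + y ^ 2 ≠ 0 := by positivity
  have e : (ε * y) ^ 2 + ε ^ 2 = ε ^ 2 * (1 + y ^ 2) := by ring
  have e2 : ε * y * ((ε * y) ^ 2 + ε ^ 2)⁻¹ = ε⁻¹ * (y * (1 + y ^ 2)⁻¹) := by
    rw [e]; field_simp
  rw [e2, conjKernel, mul_sub]
  congr 1
  by_cases hy : 1 < |y|
  · rw [Set.indicator_of_mem (by exact hiff.2 hy), Set.indicator_of_mem (by exact hy), mul_inv]
  · rw [Set.indicator_of_notMem (by exact fun h => hy (hiff.1 h)),
      Set.indicator_of_notMem (by exact hy), mul_zero]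

variable {ρ : ℝ → ℝ} {C : ℝ}

lemma re_inv_ofReal_sub_add_mul_I (x ξ η : ℝ) :
    ((x : ℂ) - (ξ + η * Complex.I))⁻¹.re = (x - ξ) * ((x - ξ) ^ 2 + η ^ 2)⁻¹ := by
  rw [Complex.inv_re, Complex.normSq_apply]
  simp [sq, div_eq_mul_inv]

/-- The truncation radius and the height above the axis are both ε, so the substitution x = ξ + εy
carries the difference of the two kernels to one fixed integrable kernel. -/
lemma integral_truncated_sub (hρi : Integrable ρ)
    (ξ : ℝ) {ε : ℝ} (hε : 0 < ε) :
    (∫ x in {x : ℝ | ε < |x - ξ|}, ρ x / (x - ξ)) -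
      ∫ x, ρ x * ((x : ℂ) - (ξ + ε * Complex.I))⁻¹.re = ∫ y, ρ (ξ + ε * y) * conjKernel y := by
  have hmeas : MeasurableSet {x : ℝ | ε < |x - ξ|} := measurableSet_lt measurable_const (by fun_prop)
  have i1 : Integrable (Set.indicator {x : ℝ | ε < |x - ξ|} fun x => ρ x / (x - ξ)) := by
    have : (Set.indicator {x : ℝ | ε < |x - ξ|} fun x => ρ x / (x - ξ)) =
        fun x => ρ x * Set.indicator {x : ℝ | ε < |x - ξ|} (fun x => (x - ξ)⁻¹) x := by
      ext x
      by_cases hx : x ∈ {x : ℝ | ε < |x - ξ|} <;> simp [hx, div_eq_mul_inv]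
    rw [this]
    refine hρi.mul_bdd (c := ε⁻¹) (Measurable.indicator (by fun_prop) hmeas).aestronglyMeasurable
      (ae_of_all _ fun x => ?_)
    by_cases hx : x ∈ {x : ℝ | ε < |x - ξ|}
    · rw [Set.indicator_of_mem hx, norm_inv]
      exact inv_anti₀ hε (le_of_lt hx)
    · rw [Set.indicator_of_notMem hx, norm_zero]; positivity
  have i2 : Integrable fun x : ℝ => ρ x * ((x : ℂ) - (ξ + ε * Complex.I))⁻¹.re := by
    refine hρi.mul_bdd (c := 1 / ε)
      (Complex.measurable_re.comp (measurable_inv_ofReal_sub _)).aestronglyMeasurable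
      (ae_of_all _ fun x => (Complex.abs_re_le_norm _).trans ?_)
    simpa using norm_inv_ofReal_sub_le x (w := (ξ : ℂ) + ε * Complex.I) (by simpa using hε)
  rw [← integral_indicator hmeas, ← integral_sub i1 i2]
  set F : ℝ → ℝ := fun u => ρ (ξ + u) * (Set.indicator {u : ℝ | ε < |u|} (fun u => u⁻¹) u -
      u * (u ^ 2 + ε ^ 2)⁻¹) with hF
  have e1 : ∀ x, Set.indicator {x : ℝ | ε < |x - ξ|} (fun x => ρ x / (x - ξ)) x -
      ρ x * ((x : ℂ) - (ξ + ε * Complex.I))⁻¹.re = F (x - ξ) := by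
    intro x
    simp only [hF, re_inv_ofReal_sub_add_mul_I]
    rw [add_sub_cancel, mul_sub]
    congr 1
    by_cases hx : ε < |x - ξ|
    · rw [Set.indicator_of_mem (by exact hx), Set.indicator_of_mem (by exact hx), div_eq_mul_inv]
    · rw [Set.indicator_of_notMem (by exact hx), Set.indicator_of_notMem (by exact hx), mul_zero]
  have e2 : ∀ y, ρ (ξ + ε * y) * conjKernel y = ε * F (ε * y) := by
    intro y
    simp only [hF]
    rw [conjKernel_scale hε]
    field_simp
  simp only [e1, e2]
  rw [integral_sub_right_eq_self F ξ, integral_const_mul, Measure.integral_comp_mul_left F ε,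
    abs_of_pos (by positivity), smul_eq_mul]
  field_simp

/-- If the Cauchy integral of a bounded continuous density has boundary values, the principal
value integrals converge to their real part. -/
lemma isHilbertTransform_of_tendsto (hρ : Continuous ρ) (hρi : Integrable ρ)
    (hC : ∀ x, |ρ x| ≤ C) {m : ℂ → ℂ} {m₀ : ℝ → ℂ}
    (hm : ∀ z : ℂ, 0 < z.im → m z = ∫ x, (ρ x : ℂ) * ((x : ℂ) - z)⁻¹)
    (hm₀ : ∀ ξ : ℝ, Tendsto (fun η : ℝ => m (ξ + η * Complex.I)) (𝓝[>] 0) (𝓝 (m₀ ξ))) :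
    IsHilbertTransform ρ fun ξ => (m₀ ξ).re := by
  intro ξ
  have hK : Integrable conjKernel :=
    integrable_inv_one_add_sq.mono' measurable_conjKernel.aestronglyMeasurable
      (ae_of_all _ norm_conjKernel_le)
  -- The limit is ρ(ξ) times the integral of an odd kernel. Continuity and boundedness of ρ suffice,
  -- with no Hölder condition.
  have t1 : Tendsto (fun ε : ℝ => ∫ y, ρ (ξ + ε * y) * conjKernel y) (𝓝[>] 0) (𝓝 0) := by
    suffices h : Tendsto (fun ε : ℝ => ∫ y, ρ (ξ + ε * y) * conjKernel y) (𝓝[>] 0)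
        (𝓝 (∫ y, ρ ξ * conjKernel y)) by
      rwa [integral_const_mul, integral_conjKernel, mul_zero] at h
    refine tendsto_integral_filter_of_dominated_convergence (fun y => C * ‖conjKernel y‖)
      (.of_forall fun ε => (hρ.comp (by fun_prop)).aestronglyMeasurable.mul hK.1)
      (.of_forall fun ε => ae_of_all _ fun y => ?_) (hK.norm.const_mul _) (ae_of_all _ fun y => ?_)
    · rw [norm_mul]; exact mul_le_mul_of_nonneg_right (hC _) (norm_nonneg _)
    · have h : Continuous fun ε : ℝ => ρ (ξ + ε * y) := by fun_prop
      have := (h.tendsto 0).mono_left (nhdsWithin_le_nhds (s := Set.Ioi 0))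
      simp only [zero_mul, add_zero] at this
      exact this.mul_const _
  have t2 : Tendsto (fun η : ℝ => (m (ξ + η * Complex.I)).re) (𝓝[>] 0) (𝓝 (m₀ ξ).re) :=
    (Complex.continuous_re.tendsto _).comp (hm₀ ξ)
  have t3 := t1.add t2
  rw [zero_add] at t3
  refine t3.congr' ?_
  filter_upwards [self_mem_nhdsWithin] with ε hε
  have hε : 0 < ε := hε
  have hz : 0 < ((ξ : ℂ) + ε * Complex.I).im := by simpa using hε
  rw [← integral_truncated_sub hρi ξ hε, hm _ hz]
  have hi : Integrable fun x : ℝ => (ρ x : ℂ) * ((x : ℂ) - (ξ + ε * Complex.I))⁻¹ :=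
    hρi.ofReal.mul_bdd (c := 1 / ((ξ : ℂ) + ε * Complex.I).im)
      (measurable_inv_ofReal_sub _).aestronglyMeasurable
      (ae_of_all _ fun x => norm_inv_ofReal_sub_le x hz)
  have : (∫ x, (ρ x : ℂ) * ((x : ℂ) - (ξ + ε * Complex.I))⁻¹).re =
      ∫ x, ρ x * ((x : ℂ) - (ξ + ε * Complex.I))⁻¹.re := by
    refine (integral_re hi).symm.trans ?_
    simp
  rw [this]
  ring

/-- The limit of the Stieltjes transforms is the Stieltjes transform of the limit density. -/
lemma IsStieltjesLimit.eq_integral {ν : ℕ → Measure ℝ} [∀ N, IsFiniteMeasure (ν N)] {g : ℂ → ℂ}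
    {r : ℝ → ℝ} {c C : ℝ} (h : IsStieltjesLimit ν g r c C) {z : ℂ} (hz : 0 < z.im) :
    g z = ∫ x, (r x : ℂ) * ((x : ℂ) - z)⁻¹ := by
  have hcont : Continuous fun x : ℝ => ((x : ℂ) - z)⁻¹ :=
    Continuous.inv₀ (by fun_prop) fun x => ofReal_sub_ne_zero x hz
  have hi : Integrable fun x : ℝ => (r x : ℂ) * ((x : ℂ) - z)⁻¹ :=
    h.integrable.ofReal.mul_bdd (c := 1 / z.im) hcont.aestronglyMeasurable
      (ae_of_all _ fun x => norm_inv_ofReal_sub_le x hz)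
  apply Complex.ext
  · have h1 := h.tendsto_integral (Complex.continuous_re.comp hcont) (B := 1 / z.im)
      fun x => (Complex.abs_re_le_norm _).trans (norm_inv_ofReal_sub_le x hz)
    have h2 := (Complex.continuous_re.tendsto _).comp (h.conv z hz)
    have e : ∀ N, ∫ x, (Complex.re ∘ fun x : ℝ => ((x : ℂ) - z)⁻¹) x ∂(ν N) =
        (stieltjes (ν N) z).re := fun N => integral_re (integrable_inv_ofReal_sub hz)
    simp only [e] at h1
    rw [tendsto_nhds_unique h2 h1]
    refine Eq.trans ?_ (integral_re hi)
    simp [mul_comm]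
  · have h1 := h.tendsto_integral (Complex.continuous_im.comp hcont) (B := 1 / z.im)
      fun x => (Complex.abs_im_le_norm _).trans (norm_inv_ofReal_sub_le x hz)
    have h2 := (Complex.continuous_im.tendsto _).comp (h.conv z hz)
    have e : ∀ N, ∫ x, (Complex.im ∘ fun x : ℝ => ((x : ℂ) - z)⁻¹) x ∂(ν N) =
        (stieltjes (ν N) z).im := fun N => integral_im (integrable_inv_ofReal_sub hz)
    simp only [e] at h1
    rw [tendsto_nhds_unique h2 h1]
    refine Eq.trans ?_ (integral_im hi)
    simp [mul_comm]

end HilbertTransform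

/-! ### Riemann sums with an error uniform in the spectral parameter -/

section RiemannSums

/-- On (k/N, (k+1)/N] the ceiling of N u is k + 1, so the right-endpoint sum is exactly the integral
of a step function and its limit becomes a matter of dominated convergence. -/
lemma sum_eq_integral_ceil {E : Type*} [NormedAddCommGroup E] [NormedSpace ℝ E] [CompleteSpace E]
    (f : ℝ → E) {N : ℕ} (hN : N ≠ 0) :
    (1 / (N : ℝ)) • ∑ j : Fin N, f (((j : ℕ) + 1 : ℝ) / N) =
      ∫ u in Set.Ioc (0 : ℝ) 1, f (⌈N * u⌉₊ / N) := by
  have hN' : (0 : ℝ) < N := by positivity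
  have hle : ∀ k : ℕ, (k / N : ℝ) ≤ (k + 1 : ℕ) / N := fun k => by
    apply div_le_div_of_nonneg_right _ hN'.le; push_cast; linarith
  have hc : ∀ k : ℕ, Set.EqOn (fun u : ℝ => f (⌈N * u⌉₊ / N)) (fun _ => f ((k + 1 : ℝ) / N))
      (Set.Ioc (k / N : ℝ) ((k + 1 : ℕ) / N)) := by
    intro k u hu
    have h1 : (k : ℝ) < N * u := by
      have := (div_lt_iff₀ hN').1 hu.1; linarith
    have h2 : N * u ≤ (k + 1 : ℕ) := by
      have := (le_div_iff₀ hN').1 hu.2; linarith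
    have : ⌈N * u⌉₊ = k + 1 := (Nat.ceil_eq_iff (by omega)).2 ⟨by simpa using h1, h2⟩
    simp only [this]; push_cast; rfl
  have h := intervalIntegral.sum_integral_adjacent_intervals (μ := volume)
    (f := fun u : ℝ => f (⌈N * u⌉₊ / N)) (a := fun k : ℕ => (k / N : ℝ)) (n := N) fun k _ => by
      rw [intervalIntegrable_iff_integrableOn_Ioc_of_le (hle k)]
      exact (integrableOn_congr_fun (hc k) measurableSet_Ioc).2 (by simp)
  simp only [Nat.cast_zero, zero_div, div_self hN'.ne'] at h
  rw [← intervalIntegral.integral_of_le zero_le_one, ← h, Finset.smul_sum, Finset.sum_fin_eq_sum_range,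
    Finset.sum_congr rfl]
  intro k hk
  rw [dif_pos (Finset.mem_range.1 hk), intervalIntegral.integral_of_le (hle k),
    setIntegral_congr_fun measurableSet_Ioc (hc k)]
  simp only [integral_const, MeasurableSet.univ, measureReal_restrict_apply, Set.univ_inter,
    Real.volume_real_Ioc_of_le (hle k)]
  congr 1
  push_cast; ring

lemma tendsto_ceil_div (u : ℝ) (hu : 0 ≤ u) :
    Tendsto (fun N : ℕ => (⌈N * u⌉₊ / N : ℝ)) atTop (𝓝 u) := by
  have := (tendsto_nat_ceil_mul_div_atTop hu).comp tendsto_natCast_atTop_atTop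
  simpa [Function.comp_def, mul_comm] using this

lemma norm_mul_inv_sub_mul_inv_le {c c' x x' η : ℝ} (hc : |c'| ≤ 1) (hη : 0 < η) {w : ℂ}
    (hw : η ≤ w.im) :
    ‖(c : ℂ) * ((x : ℂ) - w)⁻¹ - c' * ((x' : ℂ) - w)⁻¹‖ ≤
      (|c - c'| + |x - x'|) * (1 / η + 1 / η ^ 2) := by
  have hw0 := hη.trans_le hw
  have h1 : ∀ y : ℝ, ‖((y : ℂ) - w)⁻¹‖ ≤ 1 / η := fun y =>
    (norm_inv_ofReal_sub_le y hw0).trans (one_div_le_one_div_of_le hη hw)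
  have e : (c : ℂ) * ((x : ℂ) - w)⁻¹ - c' * ((x' : ℂ) - w)⁻¹ =
      ((c - c' : ℝ) : ℂ) * ((x : ℂ) - w)⁻¹ +
        c' * (((x' - x : ℝ) : ℂ) * (((x : ℂ) - w)⁻¹ * ((x' : ℂ) - w)⁻¹)) := by
    have a1 := ofReal_sub_ne_zero x hw0
    have a2 := ofReal_sub_ne_zero x' hw0
    push_cast
    field_simp
    ring
  rw [e]
  refine (norm_add_le _ _).trans ?_
  simp only [norm_mul, Complex.norm_real, Real.norm_eq_abs]
  have b1 : |c - c'| * ‖((x : ℂ) - w)⁻¹‖ ≤ |c - c'| * (1 / η) :=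
    mul_le_mul_of_nonneg_left (h1 x) (abs_nonneg _)
  have b2 : |c'| * (|x' - x| * (‖((x : ℂ) - w)⁻¹‖ * ‖((x' : ℂ) - w)⁻¹‖)) ≤
      1 * (|x - x'| * (1 / η * (1 / η))) := by
    rw [abs_sub_comm x' x]
    gcongr <;> exact h1 _
  have e2 : (1 : ℝ) / η * (1 / η) = 1 / η ^ 2 := by ring
  rw [e2] at b2
  have : 0 < 1 / η := by positivity
  have : 0 < 1 / η ^ 2 := by positivity
  nlinarith [abs_nonneg (c - c'), abs_nonneg (x - x')]

variable {b : ℝ → ℝ}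

/-- The error e N is the L¹ distance between χ ∘ b and b at the sampling points and at u. It does
not depend on w, because (x − w)⁻¹ has bounds controlled by η alone; this matters since the sums are
later evaluated at points that move with N. -/
lemma exists_riemann_error (hb : Continuous b) {K : ℝ} (hK : ∀ u, |b u| ≤ K) {χ : ℝ → ℝ}
    (hχ : Measurable χ) (hχ1 : ∀ x, |χ x| ≤ 1)
    (hχc : ∀ᵐ u ∂(volume.restrict (Set.Ioc (0 : ℝ) 1)), ContinuousAt χ (b u)) :
    ∃ e : ℕ → ℝ, Tendsto e atTop (𝓝 0) ∧ ∀ N : ℕ, N ≠ 0 →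
      |(1 / (N : ℝ)) * ∑ j : Fin N, χ (b (((j : ℕ) + 1 : ℝ) / N)) -
        ∫ u in Set.Ioc (0 : ℝ) 1, χ (b u)| ≤ e N ∧
      ∀ (η : ℝ) (w : ℂ), 0 < η → η ≤ w.im →
      ‖(1 / (N : ℂ)) * ∑ j : Fin N, (χ (b (((j : ℕ) + 1 : ℝ) / N)) : ℂ) *
          ((b (((j : ℕ) + 1 : ℝ) / N) : ℂ) - w)⁻¹ -
        ∫ u in Set.Ioc (0 : ℝ) 1, (χ (b u) : ℂ) * ((b u : ℂ) - w)⁻¹‖ ≤ e N * (1 / η + 1 / η ^ 2) := by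
  set τ : ℕ → ℝ → ℝ := fun N u => ⌈N * u⌉₊ / N with hτ
  have hτm : ∀ N, Measurable (τ N) := fun N => by
    simp only [hτ]
    exact ((measurable_from_nat (f := fun n : ℕ => (n : ℝ))).comp
      (Nat.measurable_ceil.comp (measurable_const_mul _))).div_const _
  have hτt : ∀ u ∈ Set.Ioc (0 : ℝ) 1, Tendsto (fun N => b (τ N u)) atTop (𝓝 (b u)) := fun u hu =>
    (hb.tendsto u).comp (tendsto_ceil_div u hu.1.le)
  have hbm := hb.measurable
  set d : ℕ → ℝ → ℝ := fun N u => |χ (b (τ N u)) - χ (b u)| + |b (τ N u) - b u| with hd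
  have hdm : ∀ N, Measurable (d N) := fun N => by
    have := hτm N
    simp only [hd]; fun_prop
  have hd2 : ∀ N u, ‖d N u‖ ≤ (1 + 1) + (K + K) := fun N u => by
    rw [Real.norm_of_nonneg (by positivity)]
    exact add_le_add ((abs_sub _ _).trans (add_le_add (hχ1 _) (hχ1 _)))
      ((abs_sub _ _).trans (add_le_add (hK _) (hK _)))
  have hdi : ∀ N, Integrable (d N) (volume.restrict (Set.Ioc (0 : ℝ) 1)) := fun N =>
    .of_bound (hdm N).aestronglyMeasurable _ (ae_of_all _ (hd2 N))
  refine ⟨fun N => ∫ u in Set.Ioc (0 : ℝ) 1, d N u, ?_, fun N hN => ⟨?_, fun η w hη hw => ?_⟩⟩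
  · suffices h : Tendsto (fun N => ∫ u in Set.Ioc (0 : ℝ) 1, d N u) atTop
        (𝓝 (∫ u in Set.Ioc (0 : ℝ) 1, (0 : ℝ))) by simpa using h
    refine tendsto_integral_of_dominated_convergence (fun _ => 1 + 1 + (K + K)) (fun N => (hdm N).aestronglyMeasurable)
      (integrable_const _) (fun N => ae_of_all _ (hd2 N)) ?_
    filter_upwards [hχc, ae_restrict_mem measurableSet_Ioc] with u h1 hu
    have h2 := h1.tendsto.comp (hτt u hu)
    have := ((h2.sub_const (χ (b u))).abs).add (((hτt u hu).sub_const (b u)).abs)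
    simpa using this
  · have e := sum_eq_integral_ceil (fun x => χ (b x)) hN
    rw [smul_eq_mul] at e
    have i : ∀ f : ℝ → ℝ, Measurable f →
        Integrable (fun u => χ (f u)) (volume.restrict (Set.Ioc (0 : ℝ) 1)) := fun f hf =>
      .of_bound (hχ.comp hf).aestronglyMeasurable 1 (ae_of_all _ fun u => hχ1 _)
    rw [e, ← integral_sub (i (fun u => b (τ N u)) (hbm.comp (hτm N))) (i b hbm), ← Real.norm_eq_abs]
    refine norm_integral_le_of_norm_le (hdi N) (ae_of_all _ fun u => ?_)
    exact le_add_of_nonneg_right (abs_nonneg _)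
  · have e := sum_eq_integral_ceil (fun x => (χ (b x) : ℂ) * ((b x : ℂ) - w)⁻¹) hN
    rw [Complex.real_smul] at e
    push_cast at e
    have i : ∀ f : ℝ → ℝ, Measurable f → Integrable (fun u => (χ (f u) : ℂ) * ((f u : ℂ) - w)⁻¹)
        (volume.restrict (Set.Ioc (0 : ℝ) 1)) := fun f hf => by
      refine .of_bound ((Complex.measurable_ofReal.comp (hχ.comp hf)).mul
        ((measurable_inv_ofReal_sub w).comp hf)).aestronglyMeasurable (1 * (1 / w.im))
        (ae_of_all _ fun u => ?_)
      rw [norm_mul, Complex.norm_real]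
      exact mul_le_mul (hχ1 _) (norm_inv_ofReal_sub_le _ (hη.trans_le hw)) (norm_nonneg _)
        zero_le_one
    rw [e, ← integral_sub (i (fun u => b (τ N u)) (hbm.comp (hτm N))) (i b hbm), ← integral_mul_const]
    refine norm_integral_le_of_norm_le ((hdi N).mul_const _) (ae_of_all _ fun u => ?_)
    exact norm_mul_inv_sub_mul_inv_le (hχ1 _) hη hw

end RiemannSums

/-! ### The allocation law -/

section Allocation

variable {a : ℝ → ℝ}

/-- The allocation function, extended from `[0, 1]` by constants. -/
def allocExtend (a : ℝ → ℝ) : ℝ → ℝ :=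
  Set.IccExtend (zero_le_one' ℝ) ((Set.Icc (0 : ℝ) 1).domRestrict a)

/-- The limit of the empirical distributions of the allocations. -/
def allocMeasure (a : ℝ → ℝ) : Measure ℝ :=
  (volume.restrict (Set.Ioc (0 : ℝ) 1)).map (allocExtend a)

lemma allocExtend_of_mem {u : ℝ} (hu : u ∈ Set.Icc (0 : ℝ) 1) : allocExtend a u = a u :=
  Set.IccExtend_of_mem _ _ hu

lemma alloc_eq (a : ℝ → ℝ) (N : ℕ) (j : Fin N) :
    alloc a N j = allocExtend a (((j : ℕ) + 1 : ℝ) / N) := by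
  have hN : (0 : ℝ) < N := by exact_mod_cast j.pos
  refine (allocExtend_of_mem ⟨by positivity, (div_le_one hN).2 ?_⟩).symm
  exact_mod_cast j.2

lemma IsAllocation.continuous_allocExtend (ha : IsAllocation a) : Continuous (allocExtend a) :=
  ha.continuousOn.domRestrict.Icc_extend'

lemma IsAllocation.exists_abs_le (ha : IsAllocation a) : ∃ K, ∀ u, |allocExtend a u| ≤ K := by
  obtain ⟨K, hK⟩ := isCompact_Icc.exists_bound_of_continuousOn ha.continuousOn
  exact ⟨K, fun u => hK _ (Set.projIcc (0 : ℝ) 1 zero_le_one u).2⟩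

lemma IsAllocation.isProbabilityMeasure (ha : IsAllocation a) :
    IsProbabilityMeasure (allocMeasure a) := by
  have : IsProbabilityMeasure (volume.restrict (Set.Ioc (0 : ℝ) 1)) := ⟨by simp⟩
  exact Measure.isProbabilityMeasure_map ha.continuous_allocExtend.aemeasurable

lemma IsAllocation.exists_ae_abs_le (ha : IsAllocation a) : ∃ K, ∀ᵐ x ∂allocMeasure a, |x| ≤ K := by
  obtain ⟨K, hK⟩ := ha.exists_abs_le
  refine ⟨K, ?_⟩
  rw [allocMeasure, ae_map_iff ha.continuous_allocExtend.aemeasurable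
    (measurableSet_le (by fun_prop) measurable_const)]
  exact ae_of_all _ hK

lemma indLE_of_le {x c : ℝ} (h : x ≤ c) : indLE x c = 1 := Set.indicator_of_mem (by exact h) _

lemma indLE_of_lt {x c : ℝ} (h : c < x) : indLE x c = 0 :=
  Set.indicator_of_notMem (by exact not_le.2 h) _

lemma indLE_nonneg (x c : ℝ) : 0 ≤ indLE x c := by
  rcases le_or_gt x c with h | h
  · rw [indLE_of_le h]; exact zero_le_one
  · rw [indLE_of_lt h]

lemma indLE_le_one (x c : ℝ) : indLE x c ≤ 1 := by
  rcases le_or_gt x c with h | h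
  · rw [indLE_of_le h]
  · rw [indLE_of_lt h]; exact zero_le_one

lemma abs_indLE_le (x c : ℝ) : |indLE x c| ≤ 1 := by
  rw [abs_of_nonneg (indLE_nonneg x c)]; exact indLE_le_one x c

lemma measurable_indLE (c : ℝ) : Measurable fun x => indLE x c :=
  measurable_one.indicator measurableSet_Iic

lemma continuousAt_indLE {x c : ℝ} (h : x ≠ c) : ContinuousAt (fun x => indLE x c) x := by
  rcases lt_or_gt_of_ne h with h | h
  · refine continuousAt_const.congr (f := fun _ => (1 : ℝ)) ?_
    filter_upwards [eventually_lt_nhds h] with y hy using (indLE_of_le hy.le).symm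
  · refine continuousAt_const.congr (f := fun _ => (0 : ℝ)) ?_
    filter_upwards [eventually_gt_nhds h] with y hy using (indLE_of_lt hy).symm

/-- By strict monotonicity the level c is attained at most once, so the jump of the indicator is met
only on a null set of u. -/
lemma IsAllocation.ae_continuousAt_indLE (ha : IsAllocation a) (c : ℝ) :
    ∀ᵐ u ∂(volume.restrict (Set.Ioc (0 : ℝ) 1)),
      ContinuousAt (fun x => indLE x c) (allocExtend a u) := by
  have hsub : {u ∈ Set.Ioc (0 : ℝ) 1 | allocExtend a u = c}.Subsingleton := by
    intro u hu v hv
    have hu' := Set.Ioc_subset_Icc_self hu.1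
    have hv' := Set.Ioc_subset_Icc_self hv.1
    refine ha.strictMonoOn.injOn hu' hv' ?_
    rw [← allocExtend_of_mem (a := a) hu', ← allocExtend_of_mem (a := a) hv', hu.2, hv.2]
  rw [ae_restrict_iff' measurableSet_Ioc]
  filter_upwards [compl_mem_ae_iff.2 (hsub.measure_zero volume)] with u hu hu1
  exact continuousAt_indLE fun h => hu ⟨hu1, h⟩

lemma IsAllocation.integral_allocMeasure {E : Type*} [NormedAddCommGroup E] [NormedSpace ℝ E]
    (ha : IsAllocation a) {f : ℝ → E} (hf : AEStronglyMeasurable f (allocMeasure a)) :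
    ∫ x, f x ∂allocMeasure a = ∫ u in Set.Ioc (0 : ℝ) 1, f (allocExtend a u) :=
  integral_map ha.continuous_allocExtend.aemeasurable hf

lemma setIntegral_Iic_eq (μ : Measure ℝ) (c : ℝ) (f : ℝ → ℂ) :
    ∫ x in Set.Iic c, f x ∂μ = ∫ x, (indLE x c : ℂ) * f x ∂μ := by
  rw [← integral_indicator measurableSet_Iic]
  congr 1 with x
  rcases le_or_gt x c with h | h
  · rw [indLE_of_le h, Set.indicator_of_mem (by exact h)]; simp
  · rw [indLE_of_lt h, Set.indicator_of_notMem (by exact not_le.2 h)]; simp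

/-- Riemann sums of the Stieltjes transform of the allocations, uniformly in the spectral
parameter. -/
lemma IsAllocation.exists_error (ha : IsAllocation a) :
    ∃ e : ℕ → ℝ, Tendsto e atTop (𝓝 0) ∧ ∀ N : ℕ, N ≠ 0 → ∀ (η : ℝ) (w : ℂ), 0 < η → η ≤ w.im →
      ‖(1 / (N : ℂ)) * ∑ j : Fin N, ((alloc a N j : ℂ) - w)⁻¹ - stieltjes (allocMeasure a) w‖ ≤
        e N * (1 / η + 1 / η ^ 2) := by
  obtain ⟨K, hK⟩ := ha.exists_abs_le
  obtain ⟨e, he, h⟩ := exists_riemann_error ha.continuous_allocExtend hK (χ := fun _ => 1)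
    measurable_const (by simp) (ae_of_all _ fun _ => continuousAt_const)
  refine ⟨e, he, fun N hN η w hη hw => ?_⟩
  have := (h N hN).2 η w hη hw
  simp only [Complex.ofReal_one, one_mul, ← alloc_eq] at this
  rwa [stieltjes, ha.integral_allocMeasure (measurable_inv_ofReal_sub w).aestronglyMeasurable]

/-- The same for the allocations below a level. -/
lemma IsAllocation.exists_error_Iic (ha : IsAllocation a) (c : ℝ) :
    ∃ e : ℕ → ℝ, Tendsto e atTop (𝓝 0) ∧ ∀ N : ℕ, N ≠ 0 →
      |(1 / (N : ℝ)) * ∑ j : Fin N, indLE (alloc a N j) c -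
        ((allocMeasure a).restrict (Set.Iic c)).real Set.univ| ≤ e N ∧
      ∀ (η : ℝ) (w : ℂ), 0 < η → η ≤ w.im →
      ‖(1 / (N : ℂ)) * ∑ j : Fin N, (indLE (alloc a N j) c : ℂ) * ((alloc a N j : ℂ) - w)⁻¹ -
        stieltjes ((allocMeasure a).restrict (Set.Iic c)) w‖ ≤ e N * (1 / η + 1 / η ^ 2) := by
  obtain ⟨K, hK⟩ := ha.exists_abs_le
  obtain ⟨e, he, h⟩ := exists_riemann_error ha.continuous_allocExtend hK
    (measurable_indLE c) (fun x => abs_indLE_le x c) (ha.ae_continuousAt_indLE c)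
  refine ⟨e, he, fun N hN => ⟨?_, fun η w hη hw => ?_⟩⟩
  · have := (h N hN).1
    simp only [← alloc_eq] at this
    rw [← ha.integral_allocMeasure (f := fun x => indLE x c)
      (measurable_indLE c).aestronglyMeasurable] at this
    have e2 : ∫ x, indLE x c ∂allocMeasure a =
        ((allocMeasure a).restrict (Set.Iic c)).real Set.univ := by
      simp only [indLE]
      rw [integral_indicator_one measurableSet_Iic]
      simp
    rwa [e2] at this
  · have := (h N hN).2 η w hη hw
    simp only [← alloc_eq] at this
    rwa [stieltjes, setIntegral_Iic_eq, ha.integral_allocMeasure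
      (f := fun x => (indLE x c : ℂ) * ((x : ℂ) - w)⁻¹) ((Complex.measurable_ofReal.comp (measurable_indLE c)).mul
        (measurable_inv_ofReal_sub w)).aestronglyMeasurable]

end Allocation

/-! ### Spectral expansion of the resolvent -/

section Eigenbasis

variable {N : ℕ} {M : Matrix (Fin N) (Fin N) ℝ} {lam : Fin N → ℝ}
  {ψ : Fin N → EuclideanSpace ℝ (Fin N)}

lemma _root_.Orthonormal.exists_orthonormalBasis (h : Orthonormal ℝ ψ) :
    ∃ b : OrthonormalBasis (Fin N) ℝ (EuclideanSpace ℝ (Fin N)), ⇑b = ψ := by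
  have hs : ⊤ ≤ Submodule.span ℝ (Set.range ψ) :=
    (h.linearIndependent.span_eq_top_of_card_eq_finrank' (by simp)).ge
  exact ⟨OrthonormalBasis.mk h hs, OrthonormalBasis.coe_mk h hs⟩

lemma sum_inner_sq_left (h : Orthonormal ℝ ψ) (u : EuclideanSpace ℝ (Fin N)) :
    ∑ i, inner ℝ (ψ i) u ^ 2 = ‖u‖ ^ 2 := by
  obtain ⟨b, rfl⟩ := h.exists_orthonormalBasis
  have := b.sum_sq_norm_inner_right u
  simpa using this

lemma sum_inner_sq_right (h : Orthonormal ℝ ψ) (u : EuclideanSpace ℝ (Fin N)) :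
    ∑ i, inner ℝ u (ψ i) ^ 2 = ‖u‖ ^ 2 := by
  simpa only [real_inner_comm] using sum_inner_sq_left h u

lemma resolvent_mulVec_eigenvector (hM : M.IsSymm) {z : ℂ} (hz : 0 < z.im) {u : Fin N → ℝ} {l : ℝ}
    (h : M *ᵥ u = l • u) :
    resolvent M z *ᵥ (fun k => (u k : ℂ)) = ((l : ℂ) - z)⁻¹ • fun k => (u k : ℂ) := by
  have h1 : (M.map Complex.ofReal - z • (1 : Matrix (Fin N) (Fin N) ℂ)) *ᵥ (fun k => (u k : ℂ)) =
      ((l : ℂ) - z) • fun k => (u k : ℂ) := by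
    rw [Matrix.sub_mulVec, Matrix.smul_mulVec, Matrix.one_mulVec, sub_smul]
    congr 1
    ext k
    have := congrFun h k
    simp only [Matrix.mulVec, dotProduct, Pi.smul_apply, smul_eq_mul] at this
    simp only [Matrix.mulVec, dotProduct, Matrix.map_apply, Pi.smul_apply, smul_eq_mul]
    exact_mod_cast this
  have h2 := congrArg (fun v => resolvent M z *ᵥ v) h1
  simp only [Matrix.mulVec_mulVec, resolvent_mul_sub hM hz.ne', Matrix.one_mulVec,
    Matrix.mulVec_smul] at h2
  conv_rhs => rw [h2]
  rw [smul_smul, inv_mul_cancel₀ (ofReal_sub_ne_zero l hz), one_smul]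

/-- Expanding u in the eigenbasis diagonalizes the resolvent. This is the bridge to overlaps: they
are the weights of the spectral measure of M at u. -/
lemma IsOrderedEigenbasis.quadForm_resolvent (h : IsOrderedEigenbasis M lam ψ) (hM : M.IsSymm)
    {z : ℂ} (hz : 0 < z.im) (u : EuclideanSpace ℝ (Fin N)) :
    quadForm u.ofLp (resolvent M z) =
      ∑ i, ((inner ℝ (ψ i) u ^ 2 : ℝ) : ℂ) * ((lam i : ℂ) - z)⁻¹ := by
  obtain ⟨b, hb⟩ := h.orthonormal.exists_orthonormalBasis
  have hu : (fun k => (u.ofLp k : ℂ)) =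
      ∑ i, (inner ℝ (ψ i) u : ℂ) • fun k => ((ψ i).ofLp k : ℂ) := by
    ext k
    have := congrArg (fun v : EuclideanSpace ℝ (Fin N) => v.ofLp k) (b.sum_repr' u)
    simp only [hb] at this
    rw [← this]
    simp [Finset.sum_apply]
  have hin : ∀ i, (fun k => (u.ofLp k : ℂ)) ⬝ᵥ (fun k => ((ψ i).ofLp k : ℂ)) =
      (inner ℝ (ψ i) u : ℂ) := fun i => by
    simp [dotProduct, PiLp.inner_apply]
  rw [quadForm]
  conv_lhs => enter [2, 2]; rw [hu]
  rw [Matrix.mulVec_sum, dotProduct_sum]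
  refine Finset.sum_congr rfl fun i _ => ?_
  rw [Matrix.mulVec_smul, resolvent_mulVec_eigenvector hM hz (h.eigen i), dotProduct_smul,
    dotProduct_smul, hin]
  simp only [smul_eq_mul]
  push_cast
  ring

/-- The completeness relation of a real orthonormal basis computes the trace of a complex matrix as
well. -/
lemma sum_quadForm (h : Orthonormal ℝ ψ) (X : Matrix (Fin N) (Fin N) ℂ) :
    ∑ i, quadForm (ψ i).ofLp X = X.trace := by
  obtain ⟨b, rfl⟩ := h.exists_orthonormalBasis
  have hc : ∀ k l, ∑ i, (b i).ofLp k * (b i).ofLp l = if k = l then (1 : ℝ) else 0 := by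
    intro k l
    have := b.sum_inner_mul_inner (EuclideanSpace.single k (1 : ℝ)) (EuclideanSpace.single l 1)
    simp only [EuclideanSpace.inner_single_left, EuclideanSpace.inner_single_right, map_one,
      one_mul, conj_trivial] at this
    rw [this]
    simp [eq_comm]
  have hc' : ∀ k l, ∑ i, ((b i).ofLp k : ℂ) * ((b i).ofLp l : ℂ) = if k = l then 1 else 0 := by
    intro k l
    have := congrArg Complex.ofReal (hc k l)
    push_cast at this
    rw [this]; split_ifs <;> simp
  simp only [quadForm, dotProduct, Matrix.mulVec, Finset.mul_sum]
  rw [Finset.sum_comm, Matrix.trace]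
  refine Finset.sum_congr rfl fun k _ => ?_
  rw [Finset.sum_comm]
  have : ∀ l, ∑ i, ((b i).ofLp k : ℂ) * (X k l * ((b i).ofLp l : ℂ)) =
      X k l * if k = l then 1 else 0 := fun l => by
    rw [← hc', Finset.mul_sum]
    exact Finset.sum_congr rfl fun i _ => by ring
  simp [this]

lemma IsOrderedEigenbasis.normTrace_resolvent (h : IsOrderedEigenbasis M lam ψ) (hM : M.IsSymm)
    {z : ℂ} (hz : 0 < z.im) :
    normTrace (resolvent M z) = 1 / N * ∑ i, ((lam i : ℂ) - z)⁻¹ := by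
  rw [normTrace, ← sum_quadForm h.orthonormal]
  simp only [h.quadForm_resolvent hM hz]
  rw [Finset.sum_comm]
  congr 1
  refine Finset.sum_congr rfl fun i _ => ?_
  rw [← Finset.sum_mul, ← Complex.ofReal_sum, sum_inner_sq_right h.orthonormal,
    h.orthonormal.1 i]
  simp

lemma IsOrderedEigenbasis.eq_inner (h : IsOrderedEigenbasis M lam ψ) (i : Fin N) :
    lam i = (ψ i).ofLp ⬝ᵥ (M *ᵥ (ψ i).ofLp) := by
  rw [h.eigen i, dotProduct_smul]
  have h1 := h.orthonormal.1 i
  have h2 := EuclideanSpace.real_norm_sq_eq (ψ i)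
  rw [h1] at h2
  have h3 : (ψ i).ofLp ⬝ᵥ (ψ i).ofLp = 1 := by
    simp only [dotProduct, ← sq]; rw [← h2]; norm_num
  rw [h3, smul_eq_mul, mul_one]

end Eigenbasis

/-! ### From Brownian motions to a Gaussian vector -/

section BrownianLaw

variable {Ω : Type*} [MeasurableSpace Ω] {P : Measure Ω} {N : ℕ}
  {B : Fin N → Fin N → ℝ≥0 → Ω → ℝ}

lemma IsIndepBrownianFamily.aemeasurable (hB : IsIndepBrownianFamily B P) (t : ℝ≥0) :
    AEMeasurable (fun ω (p : {p : Fin N × Fin N // p.1 ≤ p.2}) => B p.1.1 p.1.2 t ω) P :=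
  aemeasurable_pi_lambda _ fun p => (hB.brownian _ _ p.2).toIsPreBrownianReal.aemeasurable t

variable [IsProbabilityMeasure P]

/-- Only the single time t matters: evaluating independent paths at t leaves independent Gaussian
variables of variance t. -/
lemma IsIndepBrownianFamily.map_eq (hB : IsIndepBrownianFamily B P) (t : ℝ≥0) :
    P.map (fun ω (p : {p : Fin N × Fin N // p.1 ≤ p.2}) => B p.1.1 p.1.2 t ω) = goeLaw N t := by
  have h := hB.indep.comp (fun _ x => x t) fun _ => measurable_pi_apply t
  have hm : ∀ p : {p : Fin N × Fin N // p.1 ≤ p.2}, AEMeasurable (B p.1.1 p.1.2 t) P := fun p =>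
    (hB.brownian _ _ p.2).toIsPreBrownianReal.aemeasurable t
  have h2 := (iIndepFun_iff_map_fun_eq_pi_map hm).1 h
  rw [h2, goeLaw, gaussianFamily]
  congr 1
  ext1 p
  exact ((hB.brownian _ _ p.2).toIsPreBrownianReal.hasLaw_eval t).map_eq

lemma IsIndepBrownianFamily.integral_goe {E : Type*} [NormedAddCommGroup E] [NormedSpace ℝ E]
    (hB : IsIndepBrownianFamily B P) (t : ℝ≥0) {f : ({p : Fin N × Fin N // p.1 ≤ p.2} → ℝ) → E}
    (hf : AEStronglyMeasurable f (goeLaw N t)) :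
    ∫ x, f x ∂goeLaw N t = ∫ ω, f (fun p => B p.1.1 p.1.2 t ω) ∂P := by
  rw [← hB.map_eq t] at hf ⊢
  exact integral_map (hB.aemeasurable t) hf

end BrownianLaw

/-! ### Mean measures with random weights and atoms -/

section WeightedLaw

variable {Ω ι : Type*} [MeasurableSpace Ω] {P : Measure Ω} [Fintype ι]
  {w l : ι → Ω → ℝ}

/-- The measure `∑ᵢ E[wᵢ δ_{lᵢ}]`. -/
def weightedLaw (P : Measure Ω) (w l : ι → Ω → ℝ) : Measure ℝ :=
  ∑ i, (P.withDensity fun ω => ENNReal.ofReal (w i ω)).map (l i)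

lemma isFiniteMeasure_weightedLaw (hi : ∀ i, Integrable (w i) P) :
    IsFiniteMeasure (weightedLaw P w l) := by
  have : ∀ i, IsFiniteMeasure (P.withDensity fun ω => ENNReal.ofReal (w i ω)) := fun i =>
    isFiniteMeasure_withDensity_ofReal (hi i).2
  unfold weightedLaw
  infer_instance

lemma integral_weightedLaw {E : Type*} [NormedAddCommGroup E] [NormedSpace ℝ E]
    (hi : ∀ i, Integrable (w i) P) (hw : ∀ i ω, 0 ≤ w i ω) (hl : ∀ i, AEMeasurable (l i) P)
    {f : ℝ → E} (hf : StronglyMeasurable f) {C : ℝ} (hC : ∀ x, ‖f x‖ ≤ C) :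
    ∫ x, f x ∂weightedLaw P w l = ∑ i, ∫ ω, w i ω • f (l i ω) ∂P := by
  have : ∀ i, IsFiniteMeasure (P.withDensity fun ω => ENNReal.ofReal (w i ω)) := fun i =>
    isFiniteMeasure_withDensity_ofReal (hi i).2
  rw [weightedLaw, integral_finsetSum_measure fun i _ =>
    .of_bound hf.aestronglyMeasurable C (ae_of_all _ hC)]
  refine Finset.sum_congr rfl fun i _ => ?_
  rw [integral_map ((hl i).mono_ac (withDensity_absolutelyContinuous _ _)) hf.aestronglyMeasurable,
    integral_withDensity_eq_integral_toReal_smul₀ (hi i).1.aemeasurable.ennreal_ofReal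
      (ae_of_all _ fun _ => ENNReal.ofReal_lt_top)]
  refine integral_congr_ae (ae_of_all _ fun ω => ?_)
  simp only [ENNReal.toReal_ofReal (hw i ω)]

end WeightedLaw

/-! ### The mean resolvent in the eigenbasis of the deterministic part -/

section MeanResolvent

variable {N : ℕ} {A : Matrix (Fin N) (Fin N) ℝ} {t : ℝ≥0} {z : ℂ}

/-- The mean of the normalized trace of the resolvent. -/
def meanTrace (A : Matrix (Fin N) (Fin N) ℝ) (t : ℝ≥0) (z : ℂ) : ℂ :=
  ∫ x, normTrace (resolvent (A + goeMatrix x) z) ∂goeLaw N t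

/-- The mean of the quadratic form of the resolvent at `u`. -/
def meanForm (A : Matrix (Fin N) (Fin N) ℝ) (t : ℝ≥0) (z : ℂ) (u : EuclideanSpace ℝ (Fin N)) : ℂ :=
  ∫ x, quadForm u.ofLp (resolvent (A + goeMatrix x) z) ∂goeLaw N t

lemma continuous_quadForm_goe (hA : A.IsSymm) (hz : z.im ≠ 0) (u : Fin N → ℝ) :
    Continuous fun x => quadForm u (resolvent (A + goeMatrix x) z) :=
  (quadFormCLM u).continuous.comp (continuous_resolvent_goe hA hz)

lemma continuous_normTrace_goe (hA : A.IsSymm) (hz : z.im ≠ 0) :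
    Continuous fun x => normTrace (resolvent (A + goeMatrix x) z) := by
  simpa only [Function.comp_def, normTraceCLM_apply] using
    (normTraceCLM N).continuous.comp (continuous_resolvent_goe hA hz)

open scoped Matrix.Norms.L2Operator in
lemma integrable_quadForm_goe (hA : A.IsSymm) (hz : 0 < z.im) (u : Fin N → ℝ) :
    Integrable (fun x => quadForm u (resolvent (A + goeMatrix x) z)) (goeLaw N t) :=
  .of_bound (continuous_quadForm_goe hA hz.ne' u).aestronglyMeasurable (1 / z.im * ∑ i, u i ^ 2)
    (ae_of_all _ fun x => (norm_quadForm_le _ _).trans (mul_le_mul_of_nonneg_right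
      (norm_resolvent_goe_le hA hz x) (Finset.sum_nonneg fun _ _ => sq_nonneg _)))

lemma meanTrace_eq (hA : A.IsSymm) (hz : 0 < z.im) {φ : Fin N → EuclideanSpace ℝ (Fin N)}
    (hφ : Orthonormal ℝ φ) : meanTrace A t z = 1 / N * ∑ j, meanForm A t z (φ j) := by
  simp only [meanTrace, meanForm, normTrace, ← sum_quadForm hφ]
  rw [integral_const_mul, integral_finsetSum _ fun j _ => integrable_quadForm_goe hA hz _]

/-- The loop equation is divided by α − (z + t m_N). As Im m_N ≥ 0, this costs at most a factor 1 /
Im z. -/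
lemma norm_meanForm_sub_le (hA : A.IsSymm) (ht : t ≠ 0) (hz : 0 < z.im)
    (hm : 0 ≤ (meanTrace A t z).im) {u : EuclideanSpace ℝ (Fin N)} (hu : ‖u‖ = 1) {α : ℝ}
    (hAu : A *ᵥ u.ofLp = α • u.ofLp) :
    ‖meanForm A t z u - ((α : ℂ) - (z + t * meanTrace A t z))⁻¹‖ ≤
      loopConst t z.im / N * (1 / z.im) := by
  have hu' : ∑ i, u.ofLp i ^ 2 = 1 := by rw [← EuclideanSpace.real_norm_sq_eq, hu, one_pow]
  have h := norm_loop_le hA ht hz hu' hAu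
  rw [← meanTrace, ← meanForm, sub_sub] at h
  have hle : z.im ≤ (z + t * meanTrace A t z).im := by
    simp only [Complex.add_im, Complex.mul_im]
    simpa using mul_nonneg t.2 hm
  have hx := ofReal_sub_ne_zero α (hz.trans_le hle)
  have e : meanForm A t z u - ((α : ℂ) - (z + t * meanTrace A t z))⁻¹ =
      (((α : ℂ) - (z + t * meanTrace A t z)) * meanForm A t z u - 1) *
        ((α : ℂ) - (z + t * meanTrace A t z))⁻¹ := by
    rw [sub_mul, mul_right_comm, mul_inv_cancel₀ hx, one_mul, one_mul]
  rw [e, norm_mul]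
  exact mul_le_mul h ((norm_inv_ofReal_sub_le α (hz.trans_le hle)).trans
    (one_div_le_one_div_of_le hz hle)) (norm_nonneg _) ((norm_nonneg _).trans h)

lemma norm_sum_meanForm_sub_le (hA : A.IsSymm) (ht : t ≠ 0) (hz : 0 < z.im)
    (hm : 0 ≤ (meanTrace A t z).im) {al : Fin N → ℝ} {φ : Fin N → EuclideanSpace ℝ (Fin N)}
    (hφ : IsOrderedEigenbasis A al φ) {χ : Fin N → ℝ} (hχ : ∀ j, |χ j| ≤ 1) (hN : N ≠ 0) :
    ‖1 / (N : ℂ) * ∑ j, (χ j : ℂ) * meanForm A t z (φ j) -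
      1 / (N : ℂ) * ∑ j, (χ j : ℂ) * ((al j : ℂ) - (z + t * meanTrace A t z))⁻¹‖ ≤
      loopConst t z.im / N * (1 / z.im) := by
  rw [← mul_sub, ← Finset.sum_sub_distrib, norm_mul]
  have h1 : ‖∑ j, ((χ j : ℂ) * meanForm A t z (φ j) -
      (χ j : ℂ) * ((al j : ℂ) - (z + t * meanTrace A t z))⁻¹)‖ ≤
      ∑ _j : Fin N, loopConst t z.im / N * (1 / z.im) := by
    refine norm_sum_le_of_le _ fun j _ => ?_
    rw [← mul_sub, norm_mul, Complex.norm_real]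
    have h2 := norm_meanForm_sub_le hA ht hz hm (hφ.orthonormal.1 j) (hφ.eigen j)
    exact (mul_le_mul (hχ j) h2 (norm_nonneg _) zero_le_one).trans_eq (one_mul _)
  have hN' : (0 : ℝ) < N := by positivity
  rw [Finset.sum_const, Finset.card_univ, Fintype.card_fin, nsmul_eq_mul] at h1
  calc _ ≤ ‖1 / (N : ℂ)‖ * (N * (loopConst t z.im / N * (1 / z.im))) :=
        mul_le_mul_of_nonneg_left h1 (norm_nonneg _)
    _ = _ := by
        rw [norm_div, norm_one, Complex.norm_natCast, ← mul_assoc, one_div_mul_cancel hN'.ne',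
          one_mul]

end MeanResolvent

/-! ### Convergence of the mean resolvent -/

section Model

variable {Ω : Type*} [MeasurableSpace Ω]

/-- The data of a sequence of symmetric Brownian motions started at deterministic matrices. -/
structure IsModel (P : Measure Ω) (a : ℝ → ℝ) (A : (N : ℕ) → Matrix (Fin N) (Fin N) ℝ)
    (φ : (N : ℕ) → Fin N → EuclideanSpace ℝ (Fin N))
    (B : (N : ℕ) → Fin N → Fin N → ℝ≥0 → Ω → ℝ) (t : ℝ≥0) (lam : (N : ℕ) → Fin N → Ω → ℝ)
    (ψ : (N : ℕ) → Fin N → Ω → EuclideanSpace ℝ (Fin N)) : Prop where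
  allocation : IsAllocation a
  symm : ∀ N, (A N).IsSymm
  initial : ∀ N, IsOrderedEigenbasis (A N) (alloc a N) (φ N)
  brownian : ∀ N, IsIndepBrownianFamily (B N) P
  pos : 0 < t
  aemeasurable : ∀ N i, AEMeasurable (ψ N i) P
  eigenbasis : ∀ N, ∀ᵐ ω ∂P, IsOrderedEigenbasis (A N + symmBrownian (B N) t ω)
    (fun i => lam N i ω) (fun i => ψ N i ω)

variable {P : Measure Ω} {a : ℝ → ℝ}
  {A : (N : ℕ) → Matrix (Fin N) (Fin N) ℝ} {φ : (N : ℕ) → Fin N → EuclideanSpace ℝ (Fin N)}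
  {B : (N : ℕ) → Fin N → Fin N → ℝ≥0 → Ω → ℝ} {t : ℝ≥0} {lam : (N : ℕ) → Fin N → Ω → ℝ}
  {ψ : (N : ℕ) → Fin N → Ω → EuclideanSpace ℝ (Fin N)} {z : ℂ}

lemma IsModel.isSymm (h : IsModel P a A φ B t lam ψ) (N : ℕ) (ω : Ω) :
    (A N + symmBrownian (B N) t ω).IsSymm := by
  rw [symmBrownian_eq_goeMatrix]
  exact add_goeMatrix_isSymm (h.symm N) _

variable [IsProbabilityMeasure P]

lemma IsModel.meanTrace_eq_integral (h : IsModel P a A φ B t lam ψ) (hz : 0 < z.im) (N : ℕ) :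
    meanTrace (A N) t z = ∫ ω, normTrace (resolvent (A N + symmBrownian (B N) t ω) z) ∂P := by
  simp only [symmBrownian_eq_goeMatrix]
  exact (h.brownian N).integral_goe t (continuous_normTrace_goe (h.symm N) hz.ne').aestronglyMeasurable

lemma IsModel.meanForm_eq_integral (h : IsModel P a A φ B t lam ψ) (hz : 0 < z.im) (N : ℕ)
    (u : EuclideanSpace ℝ (Fin N)) :
    meanForm (A N) t z u =
      ∫ ω, quadForm u.ofLp (resolvent (A N + symmBrownian (B N) t ω) z) ∂P := by
  simp only [symmBrownian_eq_goeMatrix]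
  exact (h.brownian N).integral_goe t
    (continuous_quadForm_goe (h.symm N) hz.ne' _).aestronglyMeasurable

open scoped Matrix.Norms.L2Operator in
lemma integrable_normTrace_goe {N : ℕ} {A : Matrix (Fin N) (Fin N) ℝ} (hA : A.IsSymm)
    (hz : 0 < z.im) (t : ℝ≥0) :
    Integrable (fun x => normTrace (resolvent (A + goeMatrix x) z)) (goeLaw N t) :=
  .of_bound (continuous_normTrace_goe hA hz.ne').aestronglyMeasurable (1 / z.im)
    (ae_of_all _ fun x => (norm_normTrace_le _).trans (norm_resolvent_goe_le hA hz x))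

lemma IsModel.im_meanTrace_nonneg (h : IsModel P a A φ B t lam ψ) (hz : 0 < z.im) (N : ℕ) :
    0 ≤ (meanTrace (A N) t z).im := by
  have hi : Integrable (fun ω => normTrace (resolvent (A N + symmBrownian (B N) t ω) z)) P := by
    simp only [symmBrownian_eq_goeMatrix]
    have := integrable_normTrace_goe (h.symm N) hz t
    rw [← (h.brownian N).map_eq t] at this
    exact this.comp_aemeasurable ((h.brownian N).aemeasurable t)
  rw [h.meanTrace_eq_integral hz N]
  refine le_of_le_of_eq (integral_nonneg_of_ae ?_) (integral_im hi)
  filter_upwards [h.eigenbasis N] with ω hω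
  rw [hω.normTrace_resolvent (h.isSymm N ω) hz]
  have e : (1 / (N : ℂ) * ∑ i, ((lam N i ω : ℂ) - z)⁻¹) =
      ((1 / N : ℝ) : ℂ) * ∑ i, ((lam N i ω : ℂ) - z)⁻¹ := by push_cast; rfl
  rw [e]
  simp only [RCLike.im_to_complex, Complex.im_ofReal_mul, Complex.im_sum, im_inv_ofReal_sub]
  positivity

/-- Averaging the loop equation over the eigenbasis gives a Riemann sum for g at a point moving with
N; the error from `exists_error` is uniform over all such points. -/
lemma IsModel.tendsto_sub_stieltjes (h : IsModel P a A φ B t lam ψ) (hz : 0 < z.im) :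
    Tendsto (fun N => meanTrace (A N) t z -
      stieltjes (allocMeasure a) (z + (t : ℝ) * meanTrace (A N) t z)) atTop (𝓝 0) := by
  obtain ⟨e, he, hE⟩ := h.allocation.exists_error
  have hlim : Tendsto (fun N : ℕ => loopConst t z.im / N * (1 / z.im) +
      e N * (1 / z.im + 1 / z.im ^ 2)) atTop (𝓝 0) := by
    simpa only [zero_mul, add_zero] using ((tendsto_const_div_atTop_nhds_zero_nat (loopConst t z.im)).mul_const
      (1 / z.im)).add (he.mul_const (1 / z.im + 1 / z.im ^ 2))
  refine squeeze_zero_norm' ?_ hlim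
  filter_upwards [eventually_ne_atTop 0] with N hN
  have hm := h.im_meanTrace_nonneg hz N
  have h1 := norm_sum_meanForm_sub_le (χ := fun _ => 1) (h.symm N) h.pos.ne' hz hm (h.initial N)
    (by simp) hN
  simp only [Complex.ofReal_one, one_mul] at h1
  rw [← meanTrace_eq (h.symm N) hz (h.initial N).orthonormal] at h1
  have hle : z.im ≤ (z + t * meanTrace (A N) t z).im := by
    simp only [Complex.add_im, Complex.mul_im]
    simpa using mul_nonneg t.2 hm
  have h2 := hE N hN z.im _ hz hle
  refine le_trans (le_of_eq ?_) ((norm_add_le _ _).trans (add_le_add h1 h2))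
  rw [sub_add_sub_cancel]

lemma IsModel.exists_isSubordinated (h : IsModel P a A φ B t lam ψ) :
    ∃ m : ℂ → ℂ, IsSubordinated (allocMeasure a) t m ∧
      ∀ z : ℂ, 0 < z.im → Tendsto (fun N => meanTrace (A N) t z) atTop (𝓝 (m z)) := by
  have := h.allocation.isProbabilityMeasure
  obtain ⟨K, hK⟩ := h.allocation.exists_ae_abs_le
  have key : ∀ z : ℂ, ∃ m : ℂ, 0 < z.im → Tendsto (fun N => meanTrace (A N) t z) atTop (𝓝 m) ∧
      0 ≤ m.im ∧ m = stieltjes (allocMeasure a) (z + (t : ℝ) * m) := by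
    intro z
    by_cases hz : 0 < z.im
    · obtain ⟨m, hm⟩ := exists_tendsto_of_approx (t := (t : ℝ)) (by exact_mod_cast h.pos) hK hz
        (h.im_meanTrace_nonneg hz) (h.tendsto_sub_stieltjes hz)
      exact ⟨m, fun _ => hm⟩
    -- A default value outside the upper half-plane, where nothing is required of m.
    · exact ⟨0, fun hz' => absurd hz' hz⟩
  choose m hm using key
  exact ⟨m, fun z hz => (hm z hz).2, fun z hz => (hm z hz).1⟩

/-- The mean resolvent in the initial eigenbasis, restricted to the allocations below a level. -/
lemma IsModel.tendsto_sum_meanForm (h : IsModel P a A φ B t lam ψ) (hz : 0 < z.im) {m : ℂ}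
    (hm : Tendsto (fun N => meanTrace (A N) t z) atTop (𝓝 m)) (c : ℝ) :
    Tendsto (fun N : ℕ => 1 / (N : ℂ) * ∑ j, (indLE (alloc a N j) c : ℂ) * meanForm (A N) t z (φ N j))
      atTop (𝓝 (stieltjes ((allocMeasure a).restrict (Set.Iic c)) (z + (t : ℝ) * m))) := by
  have := h.allocation.isProbabilityMeasure
  obtain ⟨e, he, hE⟩ := h.allocation.exists_error_Iic c
  have hmim : 0 ≤ m.im := ge_of_tendsto' ((Complex.continuous_im.tendsto _).comp hm)
    fun N => h.im_meanTrace_nonneg hz N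
  have him : ∀ u : ℂ, 0 ≤ u.im → z.im ≤ (z + (t : ℝ) * u).im := fun u hu => by
    simp only [Complex.add_im, Complex.im_ofReal_mul]
    simpa using mul_nonneg t.2 hu
  have hw : Tendsto (fun N => stieltjes ((allocMeasure a).restrict (Set.Iic c))
      (z + (t : ℝ) * meanTrace (A N) t z)) atTop
      (𝓝 (stieltjes ((allocMeasure a).restrict (Set.Iic c)) (z + (t : ℝ) * m))) :=
    (continuousAt_stieltjes (hz.trans_le (him m hmim))).tendsto.comp
      (tendsto_const_nhds.add (tendsto_const_nhds.mul hm))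
  have hlim : Tendsto (fun N : ℕ => loopConst t z.im / N * (1 / z.im) +
      e N * (1 / z.im + 1 / z.im ^ 2)) atTop (𝓝 0) := by
    simpa only [zero_mul, add_zero] using ((tendsto_const_div_atTop_nhds_zero_nat (loopConst t z.im)).mul_const
      (1 / z.im)).add (he.mul_const (1 / z.im + 1 / z.im ^ 2))
  have hsub : Tendsto (fun N : ℕ =>
      1 / (N : ℂ) * ∑ j, (indLE (alloc a N j) c : ℂ) * meanForm (A N) t z (φ N j) -
      stieltjes ((allocMeasure a).restrict (Set.Iic c)) (z + (t : ℝ) * meanTrace (A N) t z))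
      atTop (𝓝 0) := by
    refine squeeze_zero_norm' ?_ hlim
    filter_upwards [eventually_ne_atTop 0] with N hN
    have hm := h.im_meanTrace_nonneg hz N
    have h1 := norm_sum_meanForm_sub_le (χ := fun j => indLE (alloc a N j) c) (h.symm N) h.pos.ne'
      hz hm (h.initial N) (fun j => abs_indLE_le _ _) hN
    have h2 := (hE N hN).2 z.im _ hz (him _ hm)
    refine le_trans (le_of_eq ?_) ((norm_add_le _ _).trans (add_le_add h1 h2))
    rw [← sub_add_sub_cancel]
  simpa using hsub.add hw

end Model

/-! ### Empirical measures and extension from a dense set -/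

section Empirical

/-- The empirical distribution of a finite family of real numbers. -/
def empiricalMeasure {N : ℕ} (l : Fin N → ℝ) : Measure ℝ :=
  ∑ i, ENNReal.ofReal (1 / N) • Measure.dirac (l i)

instance {N : ℕ} (l : Fin N → ℝ) : IsFiniteMeasure (empiricalMeasure l) := by
  have : ∀ i, IsFiniteMeasure (ENNReal.ofReal (1 / N) • Measure.dirac (l i)) := fun i =>
    Measure.smul_finite _ ENNReal.ofReal_ne_top
  unfold empiricalMeasure; infer_instance

lemma integral_empiricalMeasure {E : Type*} [NormedAddCommGroup E] [NormedSpace ℝ E]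
    [CompleteSpace E] {N : ℕ} (l : Fin N → ℝ) {f : ℝ → E} (hf : StronglyMeasurable f) {C : ℝ}
    (hC : ∀ x, ‖f x‖ ≤ C) : ∫ x, f x ∂empiricalMeasure l = (1 / N : ℝ) • ∑ i, f (l i) := by
  have : ∀ i, IsFiniteMeasure (ENNReal.ofReal (1 / N) • Measure.dirac (l i)) := fun i =>
    Measure.smul_finite _ ENNReal.ofReal_ne_top
  rw [empiricalMeasure, integral_finsetSum_measure fun i _ =>
    .of_bound hf.aestronglyMeasurable C (ae_of_all _ hC), Finset.smul_sum]
  refine Finset.sum_congr rfl fun i _ => ?_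
  rw [integral_smul_measure, integral_dirac, ENNReal.toReal_ofReal (by positivity)]

lemma stieltjes_empiricalMeasure {N : ℕ} (l : Fin N → ℝ) {z : ℂ} (hz : 0 < z.im) :
    stieltjes (empiricalMeasure l) z = 1 / N * ∑ i, ((l i : ℂ) - z)⁻¹ := by
  rw [stieltjes, integral_empiricalMeasure l (measurable_inv_ofReal_sub z).stronglyMeasurable
    fun x => norm_inv_ofReal_sub_le x hz, Complex.real_smul]
  push_cast; rfl

lemma empiricalMeasure_real_univ {N : ℕ} (hN : N ≠ 0) (l : Fin N → ℝ) :
    (empiricalMeasure l).real Set.univ = 1 := by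
  have h := integral_empiricalMeasure l (f := fun _ => (1 : ℝ)) stronglyMeasurable_const (C := 1)
    (by simp)
  simp only [integral_const, smul_eq_mul, mul_one, Finset.sum_const, Finset.card_univ,
    Fintype.card_fin, nsmul_eq_mul] at h
  rw [h, one_div_mul_cancel (by exact_mod_cast hN)]

lemma empiricalMeasure_real_univ_le {N : ℕ} (l : Fin N → ℝ) :
    (empiricalMeasure l).real Set.univ ≤ 1 := by
  rcases eq_or_ne N 0 with rfl | h
  · simp [empiricalMeasure]
  · exact (empiricalMeasure_real_univ h l).le

lemma empiricalMeasure_real_Iic {N : ℕ} (l : Fin N → ℝ) (c : ℝ) :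
    (empiricalMeasure l).real (Set.Iic c) = 1 / N * ∑ i, indLE (l i) c := by
  have h := integral_empiricalMeasure l (f := fun x => indLE x c)
    (measurable_indLE c).stronglyMeasurable (C := 1) fun x => abs_indLE_le x c
  rw [smul_eq_mul] at h
  rw [← h]
  simp only [indLE]
  rw [integral_indicator_one measurableSet_Iic]

/-- Convergence of Stieltjes transforms of subprobability measures extends from a dense set. -/
lemma tendsto_stieltjes_of_dense {ν : ℕ → Measure ℝ} [∀ N, IsFiniteMeasure (ν N)]
    (hν : ∀ N, (ν N).real Set.univ ≤ 1) {m : ℂ → ℂ} {D : Set ℂ} (hD : Dense D)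
    (h : ∀ d ∈ D, 0 < d.im → Tendsto (fun N => stieltjes (ν N) d) atTop (𝓝 (m d)))
    {z : ℂ} (hz : 0 < z.im) (hm : ContinuousAt m z) :
    Tendsto (fun N => stieltjes (ν N) z) atTop (𝓝 (m z)) := by
  rw [Metric.tendsto_atTop]
  intro ε hε
  -- This bounds the Lipschitz factor 1 / (Im z · Im d) for all d with Im d > Im z / 2.
  set c : ℝ := 2 / z.im ^ 2 with hc
  have hcpos : 0 < c := by positivity
  obtain ⟨δ, hδ, hδm⟩ := Metric.continuousAt_iff.1 hm (ε / 3) (by positivity)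
  set r := min δ (min (z.im / 2) (ε / (3 * c)))
  have hr : 0 < r := by positivity
  obtain ⟨d, hdD, hd⟩ := hD.exists_mem_open Metric.isOpen_ball ⟨z, Metric.mem_ball_self hr⟩
  have hd' : dist d z < r := hd
  have hdim : z.im / 2 < d.im := by
    have h1 := Complex.abs_im_le_norm (d - z)
    rw [← dist_eq_norm, Complex.sub_im] at h1
    have h2 := (h1.trans_lt hd').trans_le ((min_le_right _ _).trans (min_le_left _ _))
    linarith [(abs_lt.1 h2).1]
  have hd0 : 0 < d.im := by linarith
  obtain ⟨n₀, hn₀⟩ := Metric.tendsto_atTop.1 (h d hdD hd0) (ε / 3) (by positivity)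
  refine ⟨n₀, fun N hN => ?_⟩
  have e1 : dist (stieltjes (ν N) z) (stieltjes (ν N) d) ≤ ε / 3 := by
    rw [dist_eq_norm]
    refine (norm_stieltjes_sub_le hz hd0).trans ?_
    have h1 : ‖z - d‖ ≤ ε / (3 * c) := by
      rw [← dist_eq_norm, dist_comm]
      exact hd'.le.trans ((min_le_right _ _).trans (min_le_right _ _))
    have h2 : (ν N).real Set.univ / (z.im * d.im) ≤ c := by
      rw [hc, div_le_div_iff₀ (by positivity) (by positivity)]
      have h3 : z.im ^ 2 ≤ 2 * (z.im * d.im) := by nlinarith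
      have := hν N
      have h0 : 0 ≤ (ν N).real Set.univ := measureReal_nonneg
      nlinarith [sq_nonneg z.im]
    calc _ ≤ ε / (3 * c) * c := mul_le_mul h1 h2 (by positivity) (by positivity)
      _ = ε / 3 := by field_simp
  have e2 : dist (m d) (m z) < ε / 3 := hδm (hd'.trans_le (min_le_left _ _))
  calc dist (stieltjes (ν N) z) (m z) ≤ dist (stieltjes (ν N) z) (stieltjes (ν N) d) +
        dist (stieltjes (ν N) d) (m d) + dist (m d) (m z) := dist_triangle4 _ _ _ _
    _ < ε := by linarith [hn₀ N hN]

end Empirical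

/-! ### Almost sure convergence of the empirical distributions -/

section AlmostSure

variable {Ω : Type*} [MeasurableSpace Ω]

/-- Random variables with summable second moments tend to zero almost surely. -/
lemma ae_tendsto_zero_of_integral_sq_le {P : Measure Ω} {X : ℕ → Ω → ℂ}
    (hX : ∀ N, AEStronglyMeasurable (X N) P) (hXi : ∀ N, Integrable (fun ω => ‖X N ω‖ ^ 2) P)
    {c : ℕ → ℝ} (hc : Summable c) (h : ∀ N, ∫ ω, ‖X N ω‖ ^ 2 ∂P ≤ c N) :
    ∀ᵐ ω ∂P, Tendsto (fun N => X N ω) atTop (𝓝 0) := by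
  have hm : ∀ N, AEMeasurable (fun ω => ENNReal.ofReal (‖X N ω‖ ^ 2)) P := fun N =>
    ((hX N).norm.aemeasurable.pow_const 2).ennreal_ofReal
  have h1 : ∫⁻ ω, ∑' N, ENNReal.ofReal (‖X N ω‖ ^ 2) ∂P ≠ ⊤ := by
    rw [lintegral_tsum hm]
    refine ne_top_of_le_ne_top hc.tsum_ofReal_ne_top (ENNReal.tsum_le_tsum fun N => ?_)
    rw [← ofReal_integral_eq_lintegral_ofReal (hXi N) (ae_of_all _ fun ω => by positivity)]
    exact ENNReal.ofReal_le_ofReal (h N)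
  filter_upwards [ae_lt_top' (AEMeasurable.tsum hm) h1] with ω hω
  have h2 := ENNReal.tendsto_atTop_zero_of_tsum_ne_top hω.ne
  have h3 := (ENNReal.tendsto_toReal ENNReal.zero_ne_top).comp h2
  simp only [Function.comp_def, ENNReal.toReal_zero] at h3
  have h4 : ∀ N, (ENNReal.ofReal (‖X N ω‖ ^ 2)).toReal = ‖X N ω‖ ^ 2 := fun N =>
    ENNReal.toReal_ofReal (by positivity)
  simp only [h4] at h3
  have h5 := (Real.continuous_sqrt.tendsto 0).comp h3
  simp only [Function.comp_def, Real.sqrt_zero, Real.sqrt_sq (norm_nonneg _)] at h5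
  exact tendsto_zero_iff_norm_tendsto_zero.2 h5

variable {P : Measure Ω} [IsProbabilityMeasure P] {a : ℝ → ℝ}
  {A : (N : ℕ) → Matrix (Fin N) (Fin N) ℝ} {φ : (N : ℕ) → Fin N → EuclideanSpace ℝ (Fin N)}
  {B : (N : ℕ) → Fin N → Fin N → ℝ≥0 → Ω → ℝ} {t : ℝ≥0} {lam : (N : ℕ) → Fin N → Ω → ℝ}
  {ψ : (N : ℕ) → Fin N → Ω → EuclideanSpace ℝ (Fin N)} {z : ℂ}

-- The variances are O(1/N²), hence summable, and only the law for each single N enters; the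
-- coupling between different N is therefore irrelevant.
open scoped Matrix.Norms.L2Operator in
lemma IsModel.ae_tendsto_sub (h : IsModel P a A φ B t lam ψ) (hz : 0 < z.im) :
    ∀ᵐ ω ∂P, Tendsto (fun N => normTrace (resolvent (A N + symmBrownian (B N) t ω) z) -
      meanTrace (A N) t z) atTop (𝓝 0) := by
  simp only [symmBrownian_eq_goeMatrix]
  have hc : ∀ N, Continuous fun x => normTrace (resolvent (A N + goeMatrix x) z) -
      meanTrace (A N) t z := fun N =>
    (continuous_normTrace_goe (h.symm N) hz.ne').sub continuous_const
  have hi : ∀ N, Integrable (fun x => ‖normTrace (resolvent (A N + goeMatrix x) z) -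
      meanTrace (A N) t z‖ ^ 2) (goeLaw N t) := fun N => by
    refine .of_bound ((hc N).norm.pow 2).aestronglyMeasurable
      ((1 / z.im + ‖meanTrace (A N) t z‖) ^ 2) (ae_of_all _ fun x => ?_)
    rw [Real.norm_of_nonneg (by positivity)]
    refine pow_le_pow_left₀ (norm_nonneg _) ((norm_sub_le _ _).trans (add_le_add ?_ le_rfl)) 2
    exact (norm_normTrace_le _).trans (norm_resolvent_goe_le (h.symm N) hz x)
  have hs : Summable fun N : ℕ => (Real.pi / 2) ^ 2 * (t * (2 / z.im ^ 4 / (N : ℝ) ^ 2)) := by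
    have h1 : Summable fun N : ℕ => 1 / (N : ℝ) ^ 2 := Real.summable_one_div_nat_pow.2 one_lt_two
    refine (h1.mul_left ((Real.pi / 2) ^ 2 * (t * (2 / z.im ^ 4)))).congr fun N => ?_
    ring
  refine ae_tendsto_zero_of_integral_sq_le (fun N => ?_) (fun N => ?_) hs fun N => ?_
  · exact ((hc N).measurable.comp_aemeasurable ((h.brownian N).aemeasurable t)).aestronglyMeasurable
  · have := hi N
    rw [← (h.brownian N).map_eq t] at this
    exact this.comp_aemeasurable ((h.brownian N).aemeasurable t)
  · refine le_of_eq_of_le ?_ (integral_norm_normTrace_sub_sq_le (h.symm N) t hz)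
    exact ((h.brownian N).integral_goe t (hi N).1).symm

/-- Almost surely, the Stieltjes transforms of the empirical distributions converge. -/
lemma IsModel.ae_tendsto_stieltjes (h : IsModel P a A φ B t lam ψ) {m : ℂ → ℂ}
    (hm : ∀ z : ℂ, 0 < z.im → Tendsto (fun N => meanTrace (A N) t z) atTop (𝓝 (m z)))
    (hmc : ∀ z : ℂ, 0 < z.im → ContinuousAt m z) :
    ∀ᵐ ω ∂P, ∀ z : ℂ, 0 < z.im →
      Tendsto (fun N => stieltjes (empiricalMeasure fun i => lam N i ω) z) atTop (𝓝 (m z)) := by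
  -- The exceptional null set depends on z. A countable dense set gives one common null set, and the
  -- Lipschitz bound then covers all z.
  obtain ⟨D, hDc, hD⟩ := TopologicalSpace.exists_countable_dense ℂ
  have h1 : ∀ᵐ ω ∂P, ∀ d ∈ D, 0 < d.im → Tendsto (fun N =>
      normTrace (resolvent (A N + symmBrownian (B N) t ω) d) - meanTrace (A N) t d)
      atTop (𝓝 0) := by
    refine (ae_ball_iff hDc).2 fun d _ => ?_
    by_cases hd : 0 < d.im
    · filter_upwards [h.ae_tendsto_sub hd] with ω hω using fun _ => hω
    · exact ae_of_all _ fun ω hd' => absurd hd' hd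
  filter_upwards [h1, ae_all_iff.2 h.eigenbasis] with ω hω hb z hz
  refine tendsto_stieltjes_of_dense (fun N => empiricalMeasure_real_univ_le _) hD (fun d hd hd0 => ?_)
    hz (hmc z hz)
  have h2 := (hω d hd hd0).add (hm d hd0)
  rw [zero_add] at h2
  refine h2.congr fun N => ?_
  rw [sub_add_cancel, (hb N).normTrace_resolvent (h.isSymm N ω) hd0, stieltjes_empiricalMeasure _ hd0]

/-- Almost surely, the empirical distributions converge to the boundary density. -/
lemma IsModel.ae_isStieltjesLimit (h : IsModel P a A φ B t lam ψ) {m : ℂ → ℂ}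
    (hs : IsSubordinated (allocMeasure a) t m)
    (hm : ∀ z : ℂ, 0 < z.im → Tendsto (fun N => meanTrace (A N) t z) atTop (𝓝 (m z))) :
    ∀ᵐ ω ∂P, IsStieltjesLimit (fun N => empiricalMeasure fun i => lam N i ω) m
      (fun ξ => (boundaryValue m ξ).im / Real.pi) 1 (1 / √t) := by
  have := h.allocation.isProbabilityMeasure
  obtain ⟨K, hK⟩ := h.allocation.exists_ae_abs_le
  have ht : (0 : ℝ) < t := by exact_mod_cast h.pos
  filter_upwards [h.ae_tendsto_stieltjes hm fun z hz => hs.continuousAt ht hK hz] with ω hω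
  refine ⟨?_, hω, fun z hz => (Complex.abs_im_le_norm _).trans (hs.norm_le ht hz), fun ξ => ?_, ?_⟩
  · refine tendsto_const_nhds.congr' ?_
    filter_upwards [eventually_ne_atTop 0] with N hN
    exact (empiricalMeasure_real_univ hN _).symm
  · exact ((Complex.continuous_im.tendsto _).comp (hs.tendsto_boundaryValue ht hK ξ)).div_const _
  · have h1 := hs.tendsto_mul_im ht hK le_rfl
    rw [probReal_univ] at h1
    refine h1.congr' ?_
    filter_upwards [eventually_gt_atTop 0] with η hη
    rw [← (hs _ (by simpa using hη)).2]

end AlmostSure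

/-! ### The overlap distribution and its random variant -/

section OverlapLaw

variable {Ω : Type*}

/-- The mass which the overlap distribution puts on the `i`-th eigenvalue. -/
def overlapWeight {N : ℕ} (aj : Fin N → ℝ) (φ : Fin N → EuclideanSpace ℝ (Fin N))
    (ψ : Fin N → Ω → EuclideanSpace ℝ (Fin N)) (c : ℝ) (i : Fin N) (ω : Ω) : ℝ :=
  ∑ j, 1 / N * indLE (aj j) c * inner ℝ (ψ i ω) (φ j) ^ 2

lemma overlapWeight_nonneg {N : ℕ} (aj : Fin N → ℝ) (φ : Fin N → EuclideanSpace ℝ (Fin N))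
    (ψ : Fin N → Ω → EuclideanSpace ℝ (Fin N)) (c : ℝ) (i : Fin N) (ω : Ω) :
    0 ≤ overlapWeight aj φ ψ c i ω :=
  Finset.sum_nonneg fun j _ => mul_nonneg (mul_nonneg (by positivity) (indLE_nonneg _ _))
    (sq_nonneg _)

lemma overlapWeight_le {N : ℕ} {aj : Fin N → ℝ} {φ : Fin N → EuclideanSpace ℝ (Fin N)}
    (hφ : Orthonormal ℝ φ) {ψ : Fin N → Ω → EuclideanSpace ℝ (Fin N)} {c : ℝ} {i : Fin N} {ω : Ω}
    (hψ : ‖ψ i ω‖ = 1) : overlapWeight aj φ ψ c i ω ≤ 1 / N := by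
  have h1 := sum_inner_sq_right hφ (ψ i ω)
  rw [hψ, one_pow] at h1
  calc overlapWeight aj φ ψ c i ω ≤ ∑ j, 1 / (N : ℝ) * inner ℝ (ψ i ω) (φ j) ^ 2 := by
        refine Finset.sum_le_sum fun j _ => mul_le_mul_of_nonneg_right ?_ (sq_nonneg _)
        exact mul_le_of_le_one_right (by positivity) (indLE_le_one _ _)
    _ = 1 / N := by rw [← Finset.mul_sum, h1, mul_one]

/-- For monotone families the index sets {f ≤ l} and {g ≤ l} are initial segments, so one contains
the other. -/
lemma indLE_sub_nonneg_or_nonpos {ι : Type*} [LinearOrder ι] {f g : ι → ℝ} (hf : Monotone f)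
    (hg : Monotone g) (l : ℝ) :
    (∀ i, 0 ≤ indLE (f i) l - indLE (g i) l) ∨ ∀ i, indLE (f i) l - indLE (g i) l ≤ 0 := by
  by_contra! hcon
  obtain ⟨⟨i, hi⟩, j, hj⟩ := hcon
  have key : ∀ x y : ℝ, indLE x l - indLE y l < 0 → l < x ∧ y ≤ l := fun x y hxy => by
    by_contra! hc
    rcases le_or_gt x l with hx | hx
    · rw [indLE_of_le hx] at hxy; linarith [indLE_le_one y l]
    · rw [indLE_of_lt hx, indLE_of_lt (hc hx)] at hxy; linarith
  obtain ⟨h1, h2⟩ := key _ _ hi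
  obtain ⟨h3, h4⟩ := key (g j) (f j) (by linarith)
  rcases le_total i j with hij | hij
  · linarith [hf hij]
  · linarith [hg hij]

/-- Terms of one sign cannot cancel, so each weight may be replaced by its upper bound. -/
lemma abs_sum_mul_le {ι : Type*} [Fintype ι] {w d : ι → ℝ} {c : ℝ} (hc : 0 ≤ c)
    (hw : ∀ i, 0 ≤ w i) (hwc : ∀ i, w i ≤ c) (hd : (∀ i, 0 ≤ d i) ∨ ∀ i, d i ≤ 0) :
    |∑ i, w i * d i| ≤ |c * ∑ i, d i| := by
  have key : ∀ d : ι → ℝ, (∀ i, 0 ≤ d i) → |∑ i, w i * d i| ≤ |c * ∑ i, d i| := by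
    intro d hd
    rw [abs_of_nonneg (Finset.sum_nonneg fun i _ => mul_nonneg (hw i) (hd i)),
      abs_of_nonneg (mul_nonneg hc (Finset.sum_nonneg fun i _ => hd i)), Finset.mul_sum]
    exact Finset.sum_le_sum fun i _ => mul_le_mul_of_nonneg_right (hwc i) (hd i)
  rcases hd with hd | hd
  · exact key d hd
  · have := key (fun i => -d i) fun i => neg_nonneg.2 (hd i)
    simpa only [mul_neg, Finset.sum_neg_distrib, abs_neg] using this

variable [MeasurableSpace Ω]

/-- The measure with distribution function `overlapCDF` in the spectral variable. -/
def overlapLaw (P : Measure Ω) {N : ℕ} (aj : Fin N → ℝ) (φ : Fin N → EuclideanSpace ℝ (Fin N))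
    (lam : Fin N → Ω → ℝ) (ψ : Fin N → Ω → EuclideanSpace ℝ (Fin N)) (c : ℝ) : Measure ℝ :=
  weightedLaw P (overlapWeight aj φ ψ c) lam

variable {P : Measure Ω} {a : ℝ → ℝ}
  {A : (N : ℕ) → Matrix (Fin N) (Fin N) ℝ} {φ : (N : ℕ) → Fin N → EuclideanSpace ℝ (Fin N)}
  {B : (N : ℕ) → Fin N → Fin N → ℝ≥0 → Ω → ℝ} {t : ℝ≥0} {lam : (N : ℕ) → Fin N → Ω → ℝ}
  {ψ : (N : ℕ) → Fin N → Ω → EuclideanSpace ℝ (Fin N)} {z : ℂ}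

/-- Measurability is given for the eigenvectors only; each eigenvalue inherits it as a Rayleigh
quotient. -/
lemma IsModel.aemeasurable_lam (h : IsModel P a A φ B t lam ψ) (N : ℕ) (i : Fin N) :
    AEMeasurable (lam N i) P := by
  have h2 : ∀ k, AEMeasurable (fun ω => (ψ N i ω).ofLp k) P := fun k =>
    (EuclideanSpace.proj (𝕜 := ℝ) k).continuous.measurable.comp_aemeasurable (h.aemeasurable N i)
  have h3 : ∀ k l, AEMeasurable (fun ω => (A N + symmBrownian (B N) t ω) k l) P := fun k l => by
    simp only [symmBrownian_eq_goeMatrix]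
    exact ((continuous_const.add continuous_goeMatrix).matrix_elem k l).measurable.comp_aemeasurable
      ((h.brownian N).aemeasurable t)
  have h4 : AEMeasurable (fun ω => (ψ N i ω).ofLp ⬝ᵥ
      ((A N + symmBrownian (B N) t ω) *ᵥ (ψ N i ω).ofLp)) P := by
    simp only [dotProduct, Matrix.mulVec]
    exact Finset.aemeasurable_fun_sum _ fun k _ => (h2 k).mul
      (Finset.aemeasurable_fun_sum _ fun l _ => (h3 k l).mul (h2 l))
  refine h4.congr ?_
  filter_upwards [h.eigenbasis N] with ω hω using (hω.eq_inner i).symm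

variable [IsProbabilityMeasure P]

lemma IsModel.integrable_inner_sq (h : IsModel P a A φ B t lam ψ) {N : ℕ} (i j : Fin N) :
    Integrable (fun ω => inner ℝ (ψ N i ω) (φ N j) ^ 2) P := by
  refine .of_bound (((h.aemeasurable N i).inner aemeasurable_const).pow_const
    2).aestronglyMeasurable 1 ?_
  filter_upwards [h.eigenbasis N] with ω hω
  rw [Real.norm_of_nonneg (sq_nonneg _), sq_le_one_iff_abs_le_one]
  have h1 := abs_real_inner_le_norm (ψ N i ω) (φ N j)
  have h2 : ‖ψ N i ω‖ = 1 := hω.orthonormal.1 i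
  rwa [h2, (h.initial N).orthonormal.1 j, one_mul] at h1

lemma IsModel.integrable_overlapWeight (h : IsModel P a A φ B t lam ψ) {N : ℕ} (c : ℝ)
    (i : Fin N) : Integrable (overlapWeight (alloc a N) (φ N) (ψ N) c i) P :=
  integrable_finsetSum _ fun j _ => (h.integrable_inner_sq i j).const_mul _

lemma IsModel.isFiniteMeasure_overlapLaw (h : IsModel P a A φ B t lam ψ) (N : ℕ) (c : ℝ) :
    IsFiniteMeasure (overlapLaw P (alloc a N) (φ N) (lam N) (ψ N) c) :=
  isFiniteMeasure_weightedLaw fun i => h.integrable_overlapWeight c i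

lemma IsModel.integrable_inner_sq_smul {E : Type*} [NormedAddCommGroup E] [NormedSpace ℝ E]
    (h : IsModel P a A φ B t lam ψ) {N : ℕ} (i j : Fin N) {f : ℝ → E} (hf : StronglyMeasurable f)
    {C : ℝ} (hC : ∀ x, ‖f x‖ ≤ C) :
    Integrable (fun ω => inner ℝ (ψ N i ω) (φ N j) ^ 2 • f (lam N i ω)) P := by
  refine ((h.integrable_inner_sq i j).mul_const C).mono'
    ((h.integrable_inner_sq i j).1.smul
      (hf.aestronglyMeasurable.comp_aemeasurable (h.aemeasurable_lam N i))) (ae_of_all _ fun ω => ?_)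
  rw [norm_smul, Real.norm_of_nonneg (sq_nonneg _)]
  exact mul_le_mul_of_nonneg_left (hC _) (sq_nonneg _)

lemma IsModel.integral_overlapLaw {E : Type*} [NormedAddCommGroup E] [NormedSpace ℝ E]
    (h : IsModel P a A φ B t lam ψ) (N : ℕ) (c : ℝ) {f : ℝ → E} (hf : StronglyMeasurable f)
    {C : ℝ} (hC : ∀ x, ‖f x‖ ≤ C) :
    ∫ x, f x ∂overlapLaw P (alloc a N) (φ N) (lam N) (ψ N) c =
      ∑ i, ∑ j, (1 / N * indLE (alloc a N j) c) •
        ∫ ω, inner ℝ (ψ N i ω) (φ N j) ^ 2 • f (lam N i ω) ∂P := by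
  rw [overlapLaw, integral_weightedLaw (h.integrable_overlapWeight c)
    (overlapWeight_nonneg _ _ _ c) (h.aemeasurable_lam N) hf hC]
  refine Finset.sum_congr rfl fun i _ => ?_
  simp only [overlapWeight, Finset.sum_smul, mul_smul _ (inner ℝ _ _ ^ 2)]
  have hi : ∀ j, Integrable (fun ω => (1 / N * indLE (alloc a N j) c) •
      inner ℝ (ψ N i ω) (φ N j) ^ 2 • f (lam N i ω)) P := fun j =>
    (h.integrable_inner_sq_smul i j hf hC).smul _
  rw [integral_finsetSum _ fun j _ => hi j]
  exact Finset.sum_congr rfl fun j _ => integral_smul _ _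

lemma IsModel.overlapLaw_real_univ (h : IsModel P a A φ B t lam ψ) (N : ℕ) (c : ℝ) :
    (overlapLaw P (alloc a N) (φ N) (lam N) (ψ N) c).real Set.univ =
      1 / N * ∑ j, indLE (alloc a N j) c := by
  have h1 := h.integral_overlapLaw N c (f := fun _ => (1 : ℝ)) stronglyMeasurable_const (C := 1)
    (by simp)
  simp only [integral_const, smul_eq_mul, mul_one] at h1
  rw [h1, Finset.sum_comm, Finset.mul_sum]
  refine Finset.sum_congr rfl fun j _ => ?_
  rw [← Finset.mul_sum, ← integral_finsetSum _ fun i _ => h.integrable_inner_sq i j]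
  have : ∫ ω, ∑ i, inner ℝ (ψ N i ω) (φ N j) ^ 2 ∂P = ∫ ω, (1 : ℝ) ∂P := by
    refine integral_congr_ae ?_
    filter_upwards [h.eigenbasis N] with ω hω
    rw [sum_inner_sq_left hω.orthonormal, (h.initial N).orthonormal.1 j, one_pow]
  rw [this]
  simp

lemma IsModel.overlapLaw_real_Iic (h : IsModel P a A φ B t lam ψ) (N : ℕ) (c l : ℝ) :
    (overlapLaw P (alloc a N) (φ N) (lam N) (ψ N) c).real (Set.Iic l) =
      overlapCDF P (alloc a N) (φ N) (lam N) (ψ N) l c := by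
  have h1 := h.integral_overlapLaw N c (f := fun x => indLE x l)
    (measurable_indLE l).stronglyMeasurable (C := 1) fun x => abs_indLE_le x l
  have h2 : ∀ μ : Measure ℝ, ∫ x, indLE x l ∂μ = μ.real (Set.Iic l) := fun μ => by
    simp only [indLE]; rw [integral_indicator_one measurableSet_Iic]
  rw [h2] at h1
  rw [h1, overlapCDF, Finset.mul_sum]
  simp only [Finset.mul_sum, smul_eq_mul]
  exact Finset.sum_congr rfl fun i _ => Finset.sum_congr rfl fun j _ => by ring

/-- The spectral expansion of the quadratic forms, taken under the expectation, identifies this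
transform with the quantity that the loop equation controls. -/
lemma IsModel.stieltjes_overlapLaw (h : IsModel P a A φ B t lam ψ) (hz : 0 < z.im) (N : ℕ) (c : ℝ) :
    stieltjes (overlapLaw P (alloc a N) (φ N) (lam N) (ψ N) c) z =
      1 / (N : ℂ) * ∑ j, (indLE (alloc a N j) c : ℂ) * meanForm (A N) t z (φ N j) := by
  have hf := (measurable_inv_ofReal_sub z).stronglyMeasurable
  have hC : ∀ x : ℝ, ‖((x : ℂ) - z)⁻¹‖ ≤ 1 / z.im := fun x => norm_inv_ofReal_sub_le x hz
  rw [stieltjes, h.integral_overlapLaw N c hf hC, Finset.sum_comm, Finset.mul_sum]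
  refine Finset.sum_congr rfl fun j _ => ?_
  rw [← Finset.smul_sum, ← integral_finsetSum _ fun i _ => h.integrable_inner_sq_smul i j hf hC,
    h.meanForm_eq_integral hz, Complex.real_smul, ← mul_assoc]
  congr 1
  · push_cast; rfl
  · refine integral_congr_ae ?_
    filter_upwards [h.eigenbasis N] with ω hω
    rw [hω.quadForm_resolvent (h.isSymm N ω) hz]
    rfl

/-- The overlap distributions converge to the boundary density of the truncated allocations. -/
lemma IsModel.isStieltjesLimit_overlapLaw (h : IsModel P a A φ B t lam ψ) {m : ℂ → ℂ}
    (hs : IsSubordinated (allocMeasure a) t m)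
    (hm : ∀ z : ℂ, 0 < z.im → Tendsto (fun N => meanTrace (A N) t z) atTop (𝓝 (m z))) (c : ℝ) :
    IsStieltjesLimit (fun N => overlapLaw P (alloc a N) (φ N) (lam N) (ψ N) c)
      (fun z => stieltjes ((allocMeasure a).restrict (Set.Iic c)) (z + (t : ℝ) * m z))
      (boundaryDensity ((allocMeasure a).restrict (Set.Iic c)) t m)
      (((allocMeasure a).restrict (Set.Iic c)).real Set.univ) (1 / √t) := by
  have := h.allocation.isProbabilityMeasure
  obtain ⟨K, hK⟩ := h.allocation.exists_ae_abs_le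
  have ht : (0 : ℝ) < t := by exact_mod_cast h.pos
  have hle : (allocMeasure a).restrict (Set.Iic c) ≤ allocMeasure a := Measure.restrict_le_self
  refine ⟨?_, fun z hz => ?_, fun z hz => ?_, fun ξ => ?_, ?_⟩
  · obtain ⟨e, he, hE⟩ := h.allocation.exists_error_Iic c
    simp only [h.overlapLaw_real_univ]
    rw [tendsto_iff_norm_sub_tendsto_zero]
    refine squeeze_zero' (.of_forall fun _ => norm_nonneg _) ?_ he
    filter_upwards [eventually_ne_atTop 0] with N hN using (hE N hN).1
  · simp only [h.stieltjes_overlapLaw hz]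
    exact h.tendsto_sum_meanForm hz (hm z hz) c
  · rw [abs_of_nonneg (hs.im_partial_nonneg ht hz)]
    exact (hs.im_partial_le ht hle hz).trans ((le_abs_self _).trans
      ((Complex.abs_im_le_norm _).trans (hs.norm_le ht hz)))
  · exact hs.tendsto_boundaryDensity ht hK hle ξ
  · exact hs.tendsto_mul_im ht hK hle

/-- Replacing the eigenvalues by an independent copy changes the overlap distribution function by
at most the mean difference of the empirical distribution functions. -/
lemma IsModel.abs_overlapCDFRandom_sub_le (h : IsModel P a A φ B t lam ψ) (N : ℕ) (l c : ℝ) {ω : Ω}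
    (hω : Monotone fun i => lam N i ω) :
    |overlapCDFRandom P (alloc a N) (φ N) (lam N) (ψ N) l c ω -
        overlapCDF P (alloc a N) (φ N) (lam N) (ψ N) l c| ≤
      ∫ ω', |(empiricalMeasure fun i => lam N i ω).real (Set.Iic l) -
        (empiricalMeasure fun i => lam N i ω').real (Set.Iic l)| ∂P := by
  -- Both terms carry the weights evaluated at ω'; only the eigenvalue in the indicator changes,
  -- from λ_i(ω) to λ_i(ω').
  have e1 : overlapCDFRandom P (alloc a N) (φ N) (lam N) (ψ N) l c ω -
      overlapCDF P (alloc a N) (φ N) (lam N) (ψ N) l c =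
      ∫ ω', ∑ i, overlapWeight (alloc a N) (φ N) (ψ N) c i ω' *
        (indLE (lam N i ω) l - indLE (lam N i ω') l) ∂P := by
    have i1 : ∀ i j, Integrable (fun ω' => inner ℝ (ψ N i ω') (φ N j) ^ 2 *
        indLE (lam N i ω') l) P := fun i j =>
      h.integrable_inner_sq_smul i j (f := fun x => indLE x l)
        (measurable_indLE l).stronglyMeasurable fun x => abs_indLE_le x l
    have i2 : ∀ i j, Integrable (fun ω' => 1 / N * indLE (alloc a N j) c *
        (inner ℝ (ψ N i ω') (φ N j) ^ 2 * indLE (lam N i ω) l -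
          inner ℝ (ψ N i ω') (φ N j) ^ 2 * indLE (lam N i ω') l)) P := fun i j =>
      (((h.integrable_inner_sq i j).mul_const _).sub (i1 i j)).const_mul _
    have e : ∀ ω', ∑ i, overlapWeight (alloc a N) (φ N) (ψ N) c i ω' *
        (indLE (lam N i ω) l - indLE (lam N i ω') l) =
        ∑ i, ∑ j, 1 / N * indLE (alloc a N j) c *
        (inner ℝ (ψ N i ω') (φ N j) ^ 2 * indLE (lam N i ω) l -
          inner ℝ (ψ N i ω') (φ N j) ^ 2 * indLE (lam N i ω') l) := fun ω' => by
      refine Finset.sum_congr rfl fun i _ => ?_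
      rw [overlapWeight, Finset.sum_mul]
      exact Finset.sum_congr rfl fun j _ => by ring
    simp only [e]
    rw [integral_finsetSum _ fun i _ => integrable_finsetSum _ fun j _ => i2 i j, overlapCDFRandom,
      overlapCDF, ← mul_sub, ← Finset.sum_sub_distrib, Finset.mul_sum]
    refine Finset.sum_congr rfl fun i _ => ?_
    rw [integral_finsetSum _ fun j _ => i2 i j, ← Finset.sum_sub_distrib, Finset.mul_sum]
    refine Finset.sum_congr rfl fun j _ => ?_
    rw [integral_const_mul, integral_sub ((h.integrable_inner_sq i j).mul_const _) (i1 i j),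
      integral_mul_const]
    ring
  have hemp : ∀ ω', (empiricalMeasure fun i => lam N i ω).real (Set.Iic l) -
        (empiricalMeasure fun i => lam N i ω').real (Set.Iic l) =
      1 / N * ∑ i, (indLE (lam N i ω) l - indLE (lam N i ω') l) := fun ω' => by
    rw [empiricalMeasure_real_Iic, empiricalMeasure_real_Iic, ← mul_sub, Finset.sum_sub_distrib]
  simp only [hemp, e1]
  rw [← Real.norm_eq_abs]
  refine norm_integral_le_of_norm_le ?_ ?_
  · have : ∀ i, AEStronglyMeasurable (fun ω' => indLE (lam N i ω') l) P := fun i =>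
      ((measurable_indLE l).comp_aemeasurable (h.aemeasurable_lam N i)).aestronglyMeasurable
    refine ((integrable_finsetSum _ fun i _ => (integrable_const _).sub
      (.of_bound (this i) 1 (ae_of_all _ fun _ => abs_indLE_le _ _))).const_mul _).abs
  · filter_upwards [h.eigenbasis N] with ω' hω'
    rw [Real.norm_eq_abs]
    exact abs_sum_mul_le (by positivity) (overlapWeight_nonneg _ _ _ c · ω')
      (fun i => overlapWeight_le (h.initial N).orthonormal (hω'.orthonormal.1 i))
      (indLE_sub_nonneg_or_nonpos hω hω'.monotone l)

end OverlapLaw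

/-! ### The substitution x = a(u) in the limit integral -/

section ChangeOfVariables

variable {a : ℝ → ℝ}

lemma IsAllocation.hasDerivWithinAt (ha : IsAllocation a) :
    ∀ u ∈ Set.Ioo (0 : ℝ) 1, HasDerivWithinAt a (deriv a u) (Set.Ioo 0 1) u := fun u hu =>
  (ha.differentiableAt u hu).hasDerivAt.hasDerivWithinAt

lemma IsAllocation.injOn_Ioo (ha : IsAllocation a) : Set.InjOn a (Set.Ioo 0 1) :=
  ha.strictMonoOn.injOn.mono Set.Ioo_subset_Icc_self

/-- Only the two endpoint values can differ; the substitution is made on the open interval, where a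
is differentiable. -/
lemma image_Icc_ae_eq (a : ℝ → ℝ) : a '' Set.Icc 0 1 =ᵐ[volume] a '' Set.Ioo 0 1 := by
  refine (ae_eq_set.2 ⟨measure_mono_null (t := {a 0, a 1}) ?_ ((Set.toFinite _).measure_zero _), ?_⟩)
  · rintro _ ⟨⟨u, hu, rfl⟩, hn⟩
    rcases hu.1.eq_or_lt with h0 | h0
    · left; rw [h0]
    rcases hu.2.eq_or_lt with h1 | h1
    · right; rw [h1]; rfl
    · exact absurd ⟨u, ⟨h0, h1⟩, rfl⟩ hn
  · rw [Set.sdiff_eq_empty.2 (Set.image_mono Set.Ioo_subset_Icc_self), measure_empty]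

/-- The Jacobian cancels the weight 1 / a'(a⁻¹(x)) wherever a' > 0, that is, almost everywhere. -/
lemma IsAllocation.abs_deriv_mul_ae_eq (ha : IsAllocation a) (k : ℝ → ℝ) :
    (fun u => |deriv a u| • (1 / deriv a (Function.invFunOn a (Set.Icc 0 1) (a u)) * k (a u)))
      =ᵐ[volume.restrict (Set.Ioo 0 1)] fun u => k (allocExtend a u) := by
  filter_upwards [ha.deriv_pos, ae_restrict_mem measurableSet_Ioo] with u hu hu1
  have hu' := Set.Ioo_subset_Icc_self hu1
  rw [ha.strictMonoOn.injOn.leftInvOn_invFunOn hu', abs_of_pos hu, allocExtend_of_mem hu',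
    smul_eq_mul, ← mul_assoc, mul_one_div_cancel hu.ne', one_mul]

lemma IsAllocation.integrableOn_image (ha : IsAllocation a) {k : ℝ → ℝ} (hk : Measurable k) {C : ℝ}
    (hC : ∀ x, |k x| ≤ C) :
    IntegrableOn (fun x => 1 / deriv a (Function.invFunOn a (Set.Icc 0 1) x) * k x)
      (a '' Set.Icc 0 1) := by
  refine IntegrableOn.congr_set_ae ?_ (image_Icc_ae_eq a)
  rw [integrableOn_image_iff_integrableOn_abs_deriv_smul measurableSet_Ioo ha.hasDerivWithinAt
    ha.injOn_Ioo]
  have : Integrable (fun u => k (allocExtend a u)) (volume.restrict (Set.Ioo 0 1)) :=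
    .of_bound (hk.comp ha.continuous_allocExtend.measurable).aestronglyMeasurable C
      (ae_of_all _ fun u => hC _)
  exact this.congr (ha.abs_deriv_mul_ae_eq k).symm

lemma IsAllocation.setIntegral_image (ha : IsAllocation a) {k : ℝ → ℝ} (hk : Measurable k) (c : ℝ) :
    ∫ x in Set.Iic c ∩ a '' Set.Icc 0 1,
      1 / deriv a (Function.invFunOn a (Set.Icc 0 1) x) * k x =
    ∫ x in Set.Iic c, k x ∂allocMeasure a := by
  rw [Set.inter_comm, ← setIntegral_indicator measurableSet_Iic,
    setIntegral_congr_set (image_Icc_ae_eq a),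
    integral_image_eq_integral_abs_deriv_smul measurableSet_Ioo ha.hasDerivWithinAt ha.injOn_Ioo,
    ← integral_indicator measurableSet_Iic,
    ha.integral_allocMeasure (hk.indicator measurableSet_Iic).aestronglyMeasurable,
    integral_Ioc_eq_integral_Ioo]
  have e : ∀ x, (Set.Iic c).indicator
      (fun x => 1 / deriv a (Function.invFunOn a (Set.Icc 0 1) x) * k x) x =
      1 / deriv a (Function.invFunOn a (Set.Icc 0 1) x) * (Set.Iic c).indicator k x := fun x => by
    by_cases hx : x ∈ Set.Iic c
    · rw [Set.indicator_of_mem hx, Set.indicator_of_mem hx]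
    · rw [Set.indicator_of_notMem hx, Set.indicator_of_notMem hx, mul_zero]
  simp only [e]
  exact integral_congr_ae (ha.abs_deriv_mul_ae_eq _)

variable {t : ℝ} {m : ℂ → ℂ}

/-- With w = ξ + t m(ξ), the denominator is |x − w|² split into real and imaginary parts. -/
lemma norm_inv_sub_boundary_sq (m : ℂ → ℂ) (t ξ x : ℝ) :
    t / ((x - ξ - t * (boundaryValue m ξ).re) ^ 2 +
      t ^ 2 * Real.pi ^ 2 * ((boundaryValue m ξ).im / Real.pi) ^ 2) =
    t * ‖((x : ℂ) - (ξ + t * boundaryValue m ξ))⁻¹‖ ^ 2 := by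
  rw [norm_inv, inv_pow, ← Complex.normSq_eq_norm_sq, Complex.normSq_apply]
  have hpi := Real.pi_ne_zero
  simp only [Complex.sub_re, Complex.sub_im, Complex.add_re, Complex.add_im, Complex.ofReal_re,
    Complex.ofReal_im, Complex.re_ofReal_mul, Complex.im_ofReal_mul]
  rw [div_eq_mul_inv]
  congr 2
  field_simp
  ring

/-- The limiting inner integral converges where the spectral density is positive. -/
lemma IsAllocation.integrableOn_limitIntegrand (ha : IsAllocation a) (ht : 0 < t) {ξ : ℝ}
    (hξ : 0 < (boundaryValue m ξ).im) :
    IntegrableOn (limitIntegrand a t (fun ξ => (boundaryValue m ξ).im / Real.pi)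
      (fun ξ => (boundaryValue m ξ).re) ξ) (a '' Set.Icc 0 1) := by
  unfold limitIntegrand
  simp only [norm_inv_sub_boundary_sq]
  have hw : 0 < ((ξ : ℂ) + t * boundaryValue m ξ).im := by
    simpa using mul_pos ht hξ
  refine ha.integrableOn_image (C := t * (1 / ((ξ : ℂ) + t * boundaryValue m ξ).im) ^ 2)
    (((measurable_inv_ofReal_sub _).norm.pow_const 2).const_mul t) fun x => ?_
  rw [abs_of_nonneg (by positivity)]
  exact mul_le_mul_of_nonneg_left
    (pow_le_pow_left₀ (norm_nonneg _) (norm_inv_ofReal_sub_le x hw) 2) ht.le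

/-- The boundary density of the truncated allocations is the integrand of the limit. -/
lemma IsAllocation.boundaryDensity_eq (ha : IsAllocation a) (ht : 0 < t) {ξ : ℝ}
    (hξ : 0 ≤ (boundaryValue m ξ).im) (c : ℝ) :
    boundaryDensity ((allocMeasure a).restrict (Set.Iic c)) t m ξ =
      (boundaryValue m ξ).im / Real.pi * limitInner a t (fun ξ => (boundaryValue m ξ).im / Real.pi)
        (fun ξ => (boundaryValue m ξ).re) ξ c := by
  have := ha.isProbabilityMeasure
  rw [boundaryDensity]
  rcases hξ.eq_or_lt with h0 | h0
  · rw [← h0, if_neg (lt_irrefl _), zero_div, zero_mul]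
  have hw : 0 < ((ξ : ℂ) + t * boundaryValue m ξ).im := by
    simpa using mul_pos ht h0
  rw [if_pos h0, im_stieltjes hw, limitInner]
  unfold limitIntegrand
  simp only [norm_inv_sub_boundary_sq]
  rw [ha.setIntegral_image (((measurable_inv_ofReal_sub _).norm.pow_const 2).const_mul t) c,
    integral_const_mul]
  simp only [Complex.add_im, Complex.ofReal_im, Complex.im_ofReal_mul, zero_add]
  ring

end ChangeOfVariables

/-! ### Convergence of the overlap distribution functions -/

section Limit

variable {Ω : Type*} [MeasurableSpace Ω] {P : Measure Ω} [IsProbabilityMeasure P] {a : ℝ → ℝ}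
  {A : (N : ℕ) → Matrix (Fin N) (Fin N) ℝ} {φ : (N : ℕ) → Fin N → EuclideanSpace ℝ (Fin N)}
  {B : (N : ℕ) → Fin N → Fin N → ℝ≥0 → Ω → ℝ} {t : ℝ≥0} {lam : (N : ℕ) → Fin N → Ω → ℝ}
  {ψ : (N : ℕ) → Fin N → Ω → EuclideanSpace ℝ (Fin N)} {ν : ℕ → Measure ℝ}
  [∀ N, IsFiniteMeasure (ν N)] {g : ℂ → ℂ} {r : ℝ → ℝ} {c C : ℝ}

lemma IsStieltjesLimit.integral_eq (h : IsStieltjesLimit ν g r c C) : ∫ x, r x = c := by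
  have h1 := h.tendsto_integral (f := fun _ => 1) continuous_const (B := 1) (by simp)
  simp only [integral_const, smul_eq_mul, mul_one, one_mul] at h1
  exact tendsto_nhds_unique h1 h.mass

lemma IsStieltjesLimit.abs_le (h : IsStieltjesLimit ν g r c C) (ξ : ℝ) : |r ξ| ≤ C / Real.pi := by
  rw [abs_of_nonneg (h.nonneg ξ)]
  refine le_of_tendsto (h.boundary ξ) ?_
  filter_upwards [self_mem_nhdsWithin] with η hη
  exact div_le_div_of_nonneg_right ((le_abs_self _).trans (h.bound _ (by simpa using hη)))
    Real.pi_pos.le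

lemma IsStieltjesLimit.empiricalTendsto {l : (N : ℕ) → Fin N → ℝ}
    (h : IsStieltjesLimit (fun N => empiricalMeasure (l N)) g r c C) : EmpiricalTendsto l r := by
  intro f
  refine (h.tendsto_integral f.continuous f.norm_coe_le_norm).congr fun N => ?_
  rw [integral_empiricalMeasure _ f.continuous.stronglyMeasurable f.norm_coe_le_norm, smul_eq_mul]

lemma IsModel.tendsto_overlapCDF (h : IsModel P a A φ B t lam ψ) {m : ℂ → ℂ}
    (hs : IsSubordinated (allocMeasure a) t m)
    (hm : ∀ z : ℂ, 0 < z.im → Tendsto (fun N => meanTrace (A N) t z) atTop (𝓝 (m z))) (l c : ℝ) :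
    Tendsto (fun N => overlapCDF P (alloc a N) (φ N) (lam N) (ψ N) l c) atTop
      (𝓝 (∫ x in Set.Iic l, boundaryDensity ((allocMeasure a).restrict (Set.Iic c)) t m x)) := by
  have := fun N => h.isFiniteMeasure_overlapLaw N c
  simpa only [h.overlapLaw_real_Iic] using (h.isStieltjesLimit_overlapLaw hs hm c).tendsto_cdf l

/-- The random overlap distribution functions have the same limit as their means. -/
lemma IsModel.ae_tendsto_overlapCDFRandom_sub (h : IsModel P a A φ B t lam ψ) {m : ℂ → ℂ}
    (hs : IsSubordinated (allocMeasure a) t m)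
    (hm : ∀ z : ℂ, 0 < z.im → Tendsto (fun N => meanTrace (A N) t z) atTop (𝓝 (m z))) :
    ∀ᵐ ω ∂P, ∀ l c, Tendsto (fun N => overlapCDFRandom P (alloc a N) (φ N) (lam N) (ψ N) l c ω -
      overlapCDF P (alloc a N) (φ N) (lam N) (ψ N) l c) atTop (𝓝 0) := by
  have hae := h.ae_isStieltjesLimit hs hm
  filter_upwards [hae, ae_all_iff.2 h.eigenbasis] with ω hω hb l c
  refine squeeze_zero_norm (fun N => h.abs_overlapCDFRandom_sub_le N l c (hb N).monotone) ?_
  have hF : ∀ (N : ℕ) (ω' : Ω), |(empiricalMeasure fun i => lam N i ω').real (Set.Iic l)| ≤ 1 :=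
    fun N ω' => by
      rw [abs_of_nonneg measureReal_nonneg]
      exact (measureReal_mono (Set.subset_univ _)).trans (empiricalMeasure_real_univ_le _)
  suffices hlim : Tendsto (fun N => ∫ ω', |(empiricalMeasure fun i => lam N i ω).real (Set.Iic l) -
      (empiricalMeasure fun i => lam N i ω').real (Set.Iic l)| ∂P) atTop (𝓝 (∫ _, 0 ∂P)) by
    simpa using hlim
  refine tendsto_integral_of_dominated_convergence (fun _ => 1 + 1) (fun N => ?_)
    (integrable_const _) (fun N => ae_of_all _ fun ω' => ?_) ?_
  · have : AEMeasurable (fun ω' => (empiricalMeasure fun i => lam N i ω').real (Set.Iic l)) P := by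
      simp only [empiricalMeasure_real_Iic]
      exact (Finset.aemeasurable_fun_sum _ fun i _ =>
        (measurable_indLE l).comp_aemeasurable (h.aemeasurable_lam N i)).const_mul _
    exact (aemeasurable_const.sub this).norm.aestronglyMeasurable
  · rw [Real.norm_eq_abs, abs_abs]
    exact (abs_sub _ _).trans (add_le_add (hF N ω) (hF N ω'))
  -- The empirical distribution functions at ω and at almost every ω' have the same deterministic
  -- limit.
  · filter_upwards [hae] with ω' hω'
    simpa using ((hω.tendsto_cdf l).sub (hω'.tendsto_cdf l)).abs

end Limit

end FreeOverlap

end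

/-! ### Assembly of the theorem -/

/-- Almost surely in the conclusion is with respect to `P`; the Brownian families for different
`N` may be coupled in any way, and any choice of ordered random eigenbases is allowed. -/
theorem mainTheorem1 {Ω : Type*} [MeasurableSpace Ω] (P : Measure Ω) [IsProbabilityMeasure P]
    (a : ℝ → ℝ) (ha : FreeOverlap.IsAllocation a)
    (A : (N : ℕ) → Matrix (Fin N) (Fin N) ℝ) (hA : ∀ N, (A N).IsSymm)
    (φ : (N : ℕ) → Fin N → EuclideanSpace ℝ (Fin N))
    (hφ : ∀ N, FreeOverlap.IsOrderedEigenbasis (A N) (FreeOverlap.alloc a N) (φ N))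
    (B : (N : ℕ) → Fin N → Fin N → ℝ≥0 → Ω → ℝ)
    (hB : ∀ N, FreeOverlap.IsIndepBrownianFamily (B N) P)
    (t : ℝ≥0) (ht : 0 < t)
    (lam : (N : ℕ) → Fin N → Ω → ℝ)
    (ψ : (N : ℕ) → Fin N → Ω → EuclideanSpace ℝ (Fin N))
    (hψ_meas : ∀ N i, AEMeasurable (ψ N i) P)
    (hψ : ∀ N, ∀ᵐ ω ∂P, FreeOverlap.IsOrderedEigenbasis
      (A N + FreeOverlap.symmBrownian (B N) t ω) (fun i => lam N i ω) (fun i => ψ N i ω)) :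
    ∃ ρ H : ℝ → ℝ,
      -- `ρ` is the limiting spectral density, `H` its Hilbert transform
      FreeOverlap.IsContinuousDensity ρ ∧
      (∀ᵐ ω ∂P, FreeOverlap.EmpiricalTendsto (fun N i => lam N i ω) ρ) ∧
      FreeOverlap.IsHilbertTransform ρ H ∧
      -- the integrals that define the limit converge
      (∀ ξ, 0 < ρ ξ → IntegrableOn (FreeOverlap.limitIntegrand a t ρ H ξ) (a '' Set.Icc 0 1)) ∧
      (∀ α, Integrable (fun ξ => ρ ξ * FreeOverlap.limitInner a t ρ H ξ α)) ∧
      -- convergence of the bivariate distribution function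
      (∀ l α, Tendsto
        (fun N => FreeOverlap.overlapCDF P (FreeOverlap.alloc a N) (φ N) (lam N) (ψ N) l α)
        atTop (𝓝 (FreeOverlap.limitCDF a t ρ H l α))) ∧
      (∀ᵐ ω ∂P, ∀ l α, Tendsto
        (fun N => FreeOverlap.overlapCDFRandom P (FreeOverlap.alloc a N) (φ N) (lam N) (ψ N)
          l α ω)
        atTop (𝓝 (FreeOverlap.limitCDF a t ρ H l α))) := by
  have h : FreeOverlap.IsModel P a A φ B t lam ψ := ⟨ha, hA, hφ, hB, ht, hψ_meas, hψ⟩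
  have := ha.isProbabilityMeasure
  obtain ⟨K, hK⟩ := ha.exists_ae_abs_le
  have ht' : (0 : ℝ) < t := by exact_mod_cast ht
  obtain ⟨m, hs, hm⟩ := h.exists_isSubordinated
  have hae := h.ae_isStieltjesLimit hs hm
  have him := hs.im_boundaryValue_nonneg ht' hK
  have hcont := hs.continuous_boundaryValue ht' hK
  have hdens : ∀ c, FreeOverlap.boundaryDensity
      ((FreeOverlap.allocMeasure a).restrict (Set.Iic c)) t m = fun ξ => _ := fun c =>
    funext fun ξ => ha.boundaryDensity_eq ht' (him ξ) c
  -- The density and m are deterministic, so a single good realization yields integrability, total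
  -- mass and the Cauchy integral formula.
  obtain ⟨ω₀, h₀⟩ := hae.exists
  have hρc : Continuous fun ξ => (FreeOverlap.boundaryValue m ξ).im / Real.pi :=
    (Complex.continuous_im.comp hcont).div_const _
  have hcdf : ∀ l c, Tendsto
      (fun N => FreeOverlap.overlapCDF P (FreeOverlap.alloc a N) (φ N) (lam N) (ψ N) l c) atTop
      (𝓝 (FreeOverlap.limitCDF a t (fun ξ => (FreeOverlap.boundaryValue m ξ).im / Real.pi)
        (fun ξ => (FreeOverlap.boundaryValue m ξ).re) l c)) := fun l c => by
    have h1 := h.tendsto_overlapCDF hs hm l c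
    rwa [hdens] at h1
  refine ⟨fun ξ => (FreeOverlap.boundaryValue m ξ).im / Real.pi,
    fun ξ => (FreeOverlap.boundaryValue m ξ).re, ⟨hρc, h₀.nonneg, h₀.integrable, h₀.integral_eq⟩,
    hae.mono fun ω hω => hω.empiricalTendsto,
    FreeOverlap.isHilbertTransform_of_tendsto hρc h₀.integrable h₀.abs_le
      (fun z hz => h₀.eq_integral hz) (hs.tendsto_boundaryValue ht' hK),
    fun ξ hξ => ha.integrableOn_limitIntegrand ht' ((div_pos_iff_of_pos_right Real.pi_pos).1 hξ),
    fun c => ?_, hcdf, ?_⟩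
  · have := fun N => h.isFiniteMeasure_overlapLaw N c
    have h1 := (h.isStieltjesLimit_overlapLaw hs hm c).integrable
    rwa [hdens] at h1
  · filter_upwards [h.ae_tendsto_overlapCDFRandom_sub hs hm] with ω hω l c
    simpa using (hω l c).add (hcdf l c)
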